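/- Let $\mathbb T=\mathbb R/2\pi\mathbb Z$. For a distribution $u$ on $\mathbb T$ put $\hat u(k)=(2\pi)^{-1/2}\langle u,e^{-ik\cdot}\rangle$, $\delta_0u=(2\pi)^{-1/2}\hat u(0)$ and $\delta_nu(x)=(2\pi)^{-1/2}\sum_{2^{n-1}\le|k|<2^n}\hat u(k)e^{ikx}$ for $n\ge1$. For $\gamma<0$ let $\|u\|_{\mathcal C^\gamma}=\sup_{n\ge0}2^{\gamma n}\sup_x|\delta_nu(x)|$. For $\gamma\in(0,1)$ let $\|u\|_{\mathcal C^\gamma}=\sup_x|u(x)|+\sup_{x\ne y}|u(x)-u(y)|/|x-y|^\gamma$ if $u$ is a continuous function, and $\|u\|_{\mathcal C^\gamma}=\infty$ otherwise. Let $T>0$, $m\in\mathbb N$, $\delta>0$, $\alpha<1$ with $\alpha\ne0$, and $\gamma<\alpha$ with $\gamma\neq0$. Then there is a constant $C=C(\alpha,\gamma,\delta,T,m)>0$ such that the following holds. Let $\psi=(\psi(t))_{t\in[0,T]}$ be a family of random (real- or complex-valued) distributions on $\mathbb T$, defined on a probability space that carries a linear space $G\subset L^2$ of centred Gaussian random variables,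 such that for every $t\in[0,T]$ and every test function $\varphi$ the real and imaginary parts of $\langle\psi(t),\varphi\rangle$ belong to the sum of the Wiener chaoses over $G$ of orders $0,\dots,m$ (for instance, to the homogeneous chaos of order $m$; the $k$th chaos is the closed linear span in $L^2$ of the variables $H_k(\xi)$, $\xi\in G$, $\mathbb E\xi^2=1$, with $H_k$ the $k$th Hermite polynomial, and consists of the constants for $k=0$). Suppose that, for some $A,B>0$, $$\mathbb E|\delta_n\psi(t,x)|^2\le A\,2^{-2n\alpha},\qquad \mathbb E|\delta_n\psi(t,x)-\delta_n\psi(s,x)|^2\le B\,2^{-2n\alpha}|t-s|^\delta$$ for all $n\ge0$, $x\in\mathbb T$ and $s,t\in[0,T]$. Then $\psi$ has a modification for which $t\mapsto\psi(t)$ is almost surely continuous on $[0,T]$ in the sense of distributions, and every such modification, again denoted by $\psi$ (in particular $\psi$ itself, if it is almost surely continuous in time), satisfies: $\sup_{t\in[0,T]}\|\psi(t)\|_{\mathcal C^\gamma}$ is measurable up to a null set, and $$\mathbb E\sup_{t\in[0,T]}\|\psi(t)\|_{\mathcal C^\gamma}\le C(A+B)^{1/2}.$$ -/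

import Mathlib

open MeasureTheory ProbabilityTheory
open scoped ENNReal NNReal

noncomputable section

/-! ### Distributions on the circle `𝕋 = ℝ / 2πℤ`

Functions on the circle are identified with `2π`-periodic functions on the line. -/

/-- The space of test functions on the circle: smooth `2π`-periodic complex-valued functions. -/
def CircleTest : Submodule ℂ (ℝ → ℂ) where
  carrier := {φ | ContDiff ℝ ((⊤ : ℕ∞) : WithTop ℕ∞) φ ∧ Function.Periodic φ (2 * Real.pi)}
  add_mem' := fun ha hb => ⟨ha.1.add hb.1, ha.2.add hb.2⟩
  zero_mem' := ⟨contDiff_const, fun _ => rfl⟩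
  smul_mem' := fun c _ ha => ⟨contDiff_const.smul ha.1, fun x => by
    simp only [Pi.smul_apply, ha.2 x]⟩

/-- A distribution on the circle: a linear functional on the test functions that is continuous
for the `C^∞` topology, i.e. bounded by a multiple of `max_{j ≤ N} sup_x |φ⁽ʲ⁾(x)|`
for some `N`. -/
structure CircleDistribution where
  toLin : CircleTest →ₗ[ℂ] ℂ
  bounded : ∃ (N : ℕ) (K : ℝ), ∀ (φ : CircleTest) (M : ℝ),
    (∀ j ≤ N, ∀ x : ℝ, ‖iteratedDeriv j (φ : ℝ → ℂ) x‖ ≤ M) → ‖toLin φ‖ ≤ K * M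

namespace CircleDistribution

/-- The exponential `x ↦ e^{ikx}` as a test function. -/
def expTest (k : ℤ) : CircleTest :=
  ⟨fun x : ℝ => Complex.exp (Complex.I * k * x), by
    constructor
    · have h : ContDiff ℝ ((⊤ : ℕ∞) : WithTop ℕ∞) (fun x : ℝ => (x : ℂ)) := Complex.ofRealCLM.contDiff
      exact (contDiff_const.mul h).cexp
    · intro x
      have h : Complex.I * (k : ℂ) * ((x + 2 * Real.pi : ℝ) : ℂ)
          = Complex.I * k * x + k * (2 * Real.pi * Complex.I) := by
        push_cast; ring
      simp only [h, Complex.exp_add, Complex.exp_int_mul_two_pi_mul_I, mul_one]⟩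

/-- The Fourier coefficient `(2π)^{-1/2} ⟨u, e^{-ik·}⟩`. -/
def coeff (u : CircleDistribution) (k : ℤ) : ℂ :=
  ((Real.sqrt (2 * Real.pi) : ℝ) : ℂ)⁻¹ * u.toLin (expTest (-k))

/-- The frequencies of the `n`th dyadic block: `{0}` for `n = 0` and
`{k : 2^{n-1} ≤ |k| < 2^n}` for `n ≥ 1`. -/
def dyadicFreq (n : ℕ) : Finset ℤ :=
  if n = 0 then {0}
  else (Finset.Icc (-(2 : ℤ) ^ n) (2 ^ n)).filter
    (fun k => (2 : ℤ) ^ (n - 1) ≤ |k| ∧ |k| < 2 ^ n)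

/-- The `n`th Paley-Littlewood block of `u`. -/
def block (n : ℕ) (u : CircleDistribution) (x : ℝ) : ℂ :=
  ((Real.sqrt (2 * Real.pi) : ℝ) : ℂ)⁻¹ *
    ∑ k ∈ dyadicFreq n, u.coeff k * Complex.exp (Complex.I * k * x)

/-- The supremum norm, with values in `[0, ∞]`. -/
def supNorm (f : ℝ → ℂ) : ℝ≥0∞ := ⨆ x : ℝ, ‖f x‖ₑ

/-- The norm of the Besov space `B^γ_{∞,∞}(𝕋)`, with values in `[0, ∞]`. -/
def besovNorm (γ : ℝ) (u : CircleDistribution) : ℝ≥0∞ :=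
  ⨆ n : ℕ, ENNReal.ofReal ((2 : ℝ) ^ (γ * (n : ℝ))) * supNorm (block n u)

/-- `u` is (integration against) the continuous periodic function `f`. -/
def IsRepresentedBy (u : CircleDistribution) (f : ℝ → ℂ) : Prop :=
  Continuous f ∧ Function.Periodic f (2 * Real.pi) ∧
    ∀ φ : CircleTest, u.toLin φ = ∫ x in (0 : ℝ)..(2 * Real.pi), f x * (φ : ℝ → ℂ) x

/-- The Hölder seminorm `sup_{x ≠ y} |f x - f y| / |x - y|^γ`, with values in `[0, ∞]`. -/
def holderSeminorm (γ : ℝ) (f : ℝ → ℂ) : ℝ≥0∞ :=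
  ⨆ (x : ℝ) (y : ℝ) (_ : x ≠ y), ‖f x - f y‖ₑ / ENNReal.ofReal (|x - y| ^ γ)

/-- The Hölder norm `‖f‖_{C⁰} + ‖f‖_γ` of the continuous function `f` that represents `u`
(there is at most one); it is `∞` if `u` is not a continuous function. -/
def holderNorm (γ : ℝ) (u : CircleDistribution) : ℝ≥0∞ :=
  ⨅ (f : ℝ → ℂ) (_ : u.IsRepresentedBy f), supNorm f + holderSeminorm γ f

/-- The norm of `C^γ(𝕋)` for `γ < 1`, `γ ≠ 0`: the Hölder norm for `γ ∈ (0,1)`, and the Besov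
norm of `B^γ_{∞,∞}` for `γ < 0`. -/
def cNorm (γ : ℝ) (u : CircleDistribution) : ℝ≥0∞ :=
  if γ < 0 then besovNorm γ u else holderNorm γ u

end CircleDistribution

/-! ### Wiener chaos -/

/-- A Gaussian linear space: a linear subspace of `L²(P)` consisting of centred (possibly
degenerate) Gaussian random variables. -/
def IsGaussianSpace {Ω : Type*} [MeasurableSpace Ω] {P : Measure Ω}
    (G : Submodule ℝ (Lp ℝ 2 P)) : Prop :=
  ∀ ξ ∈ G, ∃ v : ℝ≥0, P.map (ξ : Ω → ℝ) = gaussianReal 0 v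

/-- The `k`th homogeneous Wiener chaos over `G`: the closed linear span in `L²(P)` of the
variables `H_k(ξ)`, with `ξ ∈ G` of unit variance and `H_k` the `k`th Hermite polynomial.
For `k = 0` these are the constants (also when `G = 0`). -/
def wienerChaos {Ω : Type*} [MeasurableSpace Ω] {P : Measure Ω}
    (G : Submodule ℝ (Lp ℝ 2 P)) (k : ℕ) : Submodule ℝ (Lp ℝ 2 P) :=
  (Submodule.span ℝ {f : Lp ℝ 2 P | ∃ ξ ∈ G, (‖ξ‖ = 1 ∨ k = 0) ∧
    (f : Ω → ℝ) =ᵐ[P] fun ω => Polynomial.aeval (ξ ω) (Polynomial.hermite k)}).topologicalClosure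

/-- The sum of the homogeneous Wiener chaoses of order at most `m` (it contains the `m`th
homogeneous one). -/
def wienerChaosLE {Ω : Type*} [MeasurableSpace Ω] {P : Measure Ω}
    (G : Submodule ℝ (Lp ℝ 2 P)) (m : ℕ) : Submodule ℝ (Lp ℝ 2 P) :=
  ⨆ (k : ℕ) (_ : k ≤ m), wienerChaos G k

/-- A random distribution takes values in the space `H` of real random variables if the real
and the imaginary part of its pairing with every test function belong to `H`. -/
def TakesValuesIn {Ω : Type*} [MeasurableSpace Ω] {P : Measure Ω}
    (H : Submodule ℝ (Lp ℝ 2 P)) (u : Ω → CircleDistribution) : Prop :=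
  ∀ φ : CircleTest, ∃ f ∈ H, ∃ g ∈ H,
    (fun ω => ((u ω).toLin φ).re) =ᵐ[P] (f : Ω → ℝ) ∧
    (fun ω => ((u ω).toLin φ).im) =ᵐ[P] (g : Ω → ℝ)

/-- `ψ'` is a modification of `ψ` on the time interval `[0,T]`. -/
def IsModificationOn {Ω : Type*} [MeasurableSpace Ω] (P : Measure Ω) (T : ℝ)
    (ψ' ψ : ℝ → Ω → CircleDistribution) : Prop :=
  ∀ t ∈ Set.Icc (0 : ℝ) T, ∀ᵐ ω ∂P, ψ' t ω = ψ t ω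

/-- Almost surely, `t ↦ ψ(t)` is continuous on `[0,T]` in the sense of distributions. -/
def HasContinuousPathsOn {Ω : Type*} [MeasurableSpace Ω] (P : Measure Ω) (T : ℝ)
    (ψ : ℝ → Ω → CircleDistribution) : Prop :=
  ∀ᵐ ω ∂P, ∀ φ : CircleTest, ContinuousOn (fun t => (ψ t ω).toLin φ) (Set.Icc (0 : ℝ) T)

end

/-!
The argument combines an equivalence of moments on Wiener chaoses with Kolmogorov chaining, in the
space variable for each Paley-Littlewood block and in time.

*Moments.* On the chaoses of order at most `m`, the moment of order `2q` is bounded by a constant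
times the `q`th power of the second moment (`exists_lintegral_chaos_pow_le`). By density it suffices
to consider polynomials in finitely many orthonormal elements of `G`, which are independent standard
Gaussian variables. For those, `exists_integral_eval_pow_le` proves the inequality with a constant
independent of the number of variables, by induction on this number: a polynomial is its mean over
one variable plus a centred polynomial in that variable, whose coefficients have smaller degree. Only
the equivalence of norms on the finite-dimensional space of centred polynomials in one variable is
used, and no hypercontractive semigroup.

*Space.* The `n`th block is a trigonometric polynomial of degree `2^n`. By Bernstein's inequality its
supremum is at most twice the maximum over a grid of `32 * 2^n` points (`IsTrigPoly.supNorm_le_grid`),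
so that in expectation the supremum costs only a factor `2^{n/2q}` over the bound at one point. The
norm of `C^γ` is at most three times `∑ 2^{γn} ‖δ_n u‖_∞`, for either sign of `γ` (`cNorm_le_tsum`);
for `q` large the sum converges because `γ < α`.

*Time.* For a weakly continuous path, dyadic chaining bounds the supremum over `t` of each block by
its value at time `0` and its increments over dyadic intervals; the maximum over the `2^i` intervals of
level `i` costs `2^{i/2q}`, less than the gain `2^{-iδ/2}`. The resulting bound `pathBound` involves
dyadic times only, and `HasBlockBounds.lintegral_pathBound_le` estimates its expectation.

*Modification and measurability.* Where `pathBound` is finite, the Fourier coefficients converge along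
dyadic times, uniformly enough to define a weakly continuous path of distributions
(`exists_continuous_path`), and at each fixed time the limit is almost surely the original value. For
a weakly continuous path the supremum of the norm over `[0,T]` equals that over the dyadic times, since
the norm is lower semicontinuous under the block bounds (`cNorm_le_of_tendsto`); as a countable
supremum it is measurable.
-/

noncomputable section

/-! ### Centred polynomials under the Gaussian measure -/

/-- Taylor expansion to first order of the even power `(b + s) ^ (2q)`: each remaining term
`b^{2q-j} s^j` with `j ≥ 2` is dominated by the two extreme ones, and the binomial coefficients
add up to at most `4 ^ q`. -/
lemma add_pow_le_taylor (q : ℕ) (hq : 1 ≤ q) (b s : ℝ) :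
    (b + s) ^ (2 * q) ≤ b ^ (2 * q) + 2 * q * b ^ (2 * q - 1) * s
      + 4 ^ q * (b ^ (2 * q - 2) * s ^ 2 + s ^ (2 * q)) := by
  obtain ⟨r, rfl⟩ : ∃ r, q = r + 1 := ⟨q - 1, by omega⟩
  have key : ∀ k ∈ Finset.range (2 * r + 1),
      s ^ (k + 2) * b ^ (2 * r - k) ≤ b ^ (2 * r) * s ^ 2 + s ^ (2 * r + 2) := by
    intro k hk
    have hk : k ≤ 2 * r := by simpa [Nat.lt_succ_iff] using hk
    have hb0 : b ^ (2 * r) = |b| ^ (2 * r) := by rw [pow_mul, pow_mul, sq_abs]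
    have hs0 : s ^ (2 * r + 2) = |s| ^ (2 * r) * |s| ^ 2 := by
      rw [pow_add, pow_mul, pow_mul, sq_abs]
    have h1 : s ^ (k + 2) * b ^ (2 * r - k) ≤ |s| ^ 2 * (|s| ^ k * |b| ^ (2 * r - k)) := by
      refine (le_abs_self _).trans (le_of_eq ?_)
      rw [abs_mul, abs_pow, abs_pow]; ring
    refine h1.trans ?_
    rw [hb0, hs0, ← sq_abs s, mul_comm (|b| ^ (2 * r)), mul_comm (|s| ^ (2 * r)), ← mul_add]
    refine mul_le_mul_of_nonneg_left ?_ (by positivity)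
    have e1 : ∀ c : ℝ, c ^ (2 * r) = c ^ k * c ^ (2 * r - k) := fun c => by
      rw [← pow_add]; congr 1; omega
    rcases le_total |s| |b| with h | h
    · have : |s| ^ k * |b| ^ (2 * r - k) ≤ |b| ^ (2 * r) := by
        rw [e1]; gcongr
      have := pow_nonneg (abs_nonneg s) (2 * r)
      linarith
    · have : |s| ^ k * |b| ^ (2 * r - k) ≤ |s| ^ (2 * r) := by
        rw [e1]; gcongr
      have := pow_nonneg (abs_nonneg b) (2 * r)
      linarith
  have hnn : 0 ≤ b ^ (2 * r) * s ^ 2 + s ^ (2 * r + 2) := by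
    have : Even (2 * r) := even_two_mul r
    have h2 : Even (2 * r + 2) := ⟨r + 1, by ring⟩
    have := this.pow_nonneg b
    have := h2.pow_nonneg s
    positivity
  have hsum : ∑ k ∈ Finset.range (2 * r + 1),
      s ^ (k + 2) * b ^ (2 * r - k) * ((2 * r + 2).choose (k + 2) : ℝ)
      ≤ 4 ^ (r + 1) * (b ^ (2 * r) * s ^ 2 + s ^ (2 * r + 2)) := by
    have hch : ∑ k ∈ Finset.range (2 * r + 1), ((2 * r + 2).choose (k + 2) : ℝ) ≤ 4 ^ (r + 1) := by
      have := Nat.sum_range_choose (2 * r + 2)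
      rw [Finset.sum_range_succ', Finset.sum_range_succ'] at this
      have h4 : (4 : ℝ) ^ (r + 1) = ((2 ^ (2 * r + 2) : ℕ) : ℝ) := by
        push_cast; rw [show 2 * r + 2 = 2 * (r + 1) by ring, pow_mul]; norm_num
      rw [h4, ← this]
      push_cast
      have : (0:ℝ) ≤ ((2 * r + 2).choose (0 + 1)) := by positivity
      have : (0:ℝ) ≤ ((2 * r + 2).choose 0) := by positivity
      simp only [add_assoc] at *
      norm_num at *
      linarith
    calc _ ≤ ∑ k ∈ Finset.range (2 * r + 1),
        (b ^ (2 * r) * s ^ 2 + s ^ (2 * r + 2)) * ((2 * r + 2).choose (k + 2) : ℝ) :=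
          Finset.sum_le_sum fun k hk => mul_le_mul_of_nonneg_right (key k hk) (by positivity)
      _ ≤ _ := by
          rw [← Finset.mul_sum, mul_comm]
          exact mul_le_mul_of_nonneg_right hch hnn
  have hexp : (b + s) ^ (2 * (r + 1)) = b ^ (2 * (r + 1)) + 2 * ((r + 1 : ℕ) : ℝ) * b ^ (2 * r + 1) * s
      + ∑ k ∈ Finset.range (2 * r + 1),
        s ^ (k + 2) * b ^ (2 * r - k) * ((2 * r + 2).choose (k + 2) : ℝ) := by
    rw [add_comm b s, add_pow, show 2 * (r + 1) + 1 = (2 * r + 1) + 1 + 1 by ring,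
      Finset.sum_range_succ', Finset.sum_range_succ']
    simp only [show ∀ k, 2 * (r + 1) - (k + 1 + 1) = 2 * r - k from fun k => by omega]
    simp [show 2 * (r + 1) = 2 * r + 2 by ring]
    ring
  rw [hexp]
  have e1 : 2 * (r + 1) - 1 = 2 * r + 1 := by omega
  have e2 : 2 * (r + 1) - 2 = 2 * r := by omega
  rw [e1, e2]
  exact add_le_add_right hsum _

/-- Hölder's inequality with the exponents `q / (q - 1)` and `q`. -/
lemma integral_pow_mul_le {X : Type*} [MeasurableSpace X] {μ : Measure X} {f g : X → ℝ} {q : ℕ}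
    (hq : 2 ≤ q) (hf0 : ∀ x, 0 ≤ f x) (hg0 : ∀ x, 0 ≤ g x)
    (hfm : AEStronglyMeasurable f μ) (hgm : AEStronglyMeasurable g μ)
    (hf : Integrable (fun x => f x ^ q) μ) (hg : Integrable (fun x => g x ^ q) μ) {a b : ℝ}
    (ha : 0 ≤ a) (hb : 0 ≤ b) (hfa : ∫ x, f x ^ q ∂μ ≤ a ^ q) (hgb : ∫ x, g x ^ q ∂μ ≤ b ^ q) :
    ∫ x, f x ^ (q - 1) * g x ∂μ ≤ a ^ (q - 1) * b := by
  have hq0 : (0 : ℝ) < q := by positivity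
  have hq1 : (0 : ℝ) < (q : ℝ) - 1 := by
    have : (2 : ℝ) ≤ q := by exact_mod_cast hq
    linarith
  have hc : Real.HolderConjugate ((q : ℝ) / (q - 1)) q := by
    rw [Real.holderConjugate_iff]
    constructor
    · rw [lt_div_iff₀ hq1]; linarith
    · field_simp; ring
  have hpow : ∀ x, (f x ^ (q - 1)) ^ ((q : ℝ) / (q - 1)) = f x ^ q := by
    intro x
    rw [← Real.rpow_natCast, ← Real.rpow_mul (hf0 x), ← Real.rpow_natCast]
    congr 1
    rw [Nat.cast_sub (by omega)]; field_simp; simp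
  have hp0 : (0:ℝ) < (q : ℝ) / (q - 1) := by positivity
  have h1 : MemLp (fun x => f x ^ (q - 1)) (ENNReal.ofReal ((q : ℝ) / (q - 1))) μ := by
    rw [← integrable_norm_rpow_iff (f := fun x => f x ^ (q - 1)) (hfm.pow _) (by simpa using hp0) ENNReal.ofReal_ne_top]
    refine hf.congr (ae_of_all _ fun x => ?_)
    simp only
    rw [ENNReal.toReal_ofReal hp0.le, Real.norm_of_nonneg (pow_nonneg (hf0 x) _), hpow]
  have h2 : MemLp g (ENNReal.ofReal (q : ℝ)) μ := by
    rw [← integrable_norm_rpow_iff hgm (by simpa using (by omega : q ≠ 0)) ENNReal.ofReal_ne_top]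
    refine hg.congr (ae_of_all _ fun x => ?_)
    simp only
    rw [ENNReal.toReal_ofReal hq0.le, Real.norm_of_nonneg (hg0 x), Real.rpow_natCast]
  have := integral_mul_le_Lp_mul_Lq_of_nonneg hc (ae_of_all _ fun x => pow_nonneg (hf0 x) _)
    (ae_of_all _ hg0) h1 h2
  refine this.trans ?_
  simp only [hpow, Real.rpow_natCast]
  have i1 : (0:ℝ) ≤ ∫ x, f x ^ q ∂μ := integral_nonneg fun x => pow_nonneg (hf0 x) _
  have i2 : (0:ℝ) ≤ ∫ x, g x ^ q ∂μ := integral_nonneg fun x => pow_nonneg (hg0 x) _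
  refine mul_le_mul ?_ ?_ (by positivity) (by positivity)
  · calc _ ≤ (a ^ q) ^ (1 / ((q : ℝ) / (q - 1))) := by gcongr
      _ = _ := by
        rw [← Real.rpow_natCast, ← Real.rpow_mul ha, ← Real.rpow_natCast]
        congr 1
        rw [Nat.cast_sub (by omega)]; field_simp; simp
  · calc _ ≤ (b ^ q) ^ (1 / (q : ℝ)) := by gcongr
      _ = _ := by
        rw [← Real.rpow_natCast, ← Real.rpow_mul hb]
        simp [hq0.ne']

/-- The standard Gaussian measure on the line. -/
abbrev stdGaussianReal : Measure ℝ := gaussianReal 0 1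

/-- The standard Gaussian measure on `Fin d → ℝ`. -/
abbrev gaussPi (d : ℕ) : Measure (Fin d → ℝ) := Measure.pi fun _ => stdGaussianReal

lemma integrable_pow_gaussian (k : ℕ) : Integrable (fun x : ℝ => x ^ k) stdGaussianReal := by
  rcases Nat.eq_zero_or_pos k with rfl | hk
  · simp
  have := memLp_id_gaussianReal (μ := 0) (v := 1) (k : ℝ≥0)
  have h2 := this.integrable_norm_pow (p := k) (by omega)
  refine (integrable_norm_iff (by fun_prop)).1 (h2.congr (ae_of_all _ fun x => ?_))
  simp

lemma integrable_eval_gaussPi {d : ℕ} (p : MvPolynomial (Fin d) ℝ) :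
    Integrable (fun z => MvPolynomial.eval z p) (gaussPi d) := by
  simp only [MvPolynomial.eval_eq']
  refine integrable_finsetSum _ fun s _ => Integrable.const_mul ?_ _
  exact Integrable.fintype_prod (f := fun i (x : ℝ) => x ^ s i) fun i => integrable_pow_gaussian _

/-- The `k`th moment of the standard Gaussian measure. -/
def gaussMoment (k : ℕ) : ℝ := ∫ x, x ^ k ∂stdGaussianReal

/-- The polynomial `∑ a_j (x^{j+1} - E x^{j+1})`. Every polynomial of degree at most `m` with mean
zero under the standard Gaussian measure has this form, with `j` ranging over `0, …, m - 1`. -/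
def centeredPoly {m : ℕ} (a : Fin m → ℝ) : Polynomial ℝ :=
  ∑ j, Polynomial.C (a j) * (Polynomial.X ^ (j.1 + 1) - Polynomial.C (gaussMoment (j.1 + 1)))

lemma eval_centeredPoly {m : ℕ} (a : Fin m → ℝ) (x : ℝ) :
    (centeredPoly a).eval x = ∑ j, a j * (x ^ (j.1 + 1) - gaussMoment (j.1 + 1)) := by
  simp [centeredPoly, Polynomial.eval_finsetSum]

lemma integrable_polynomial_gaussian (p : Polynomial ℝ) :
    Integrable (fun x => p.eval x) stdGaussianReal := by
  simp only [Polynomial.eval_eq_sum, Polynomial.sum]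
  exact integrable_finsetSum _ fun s _ => (integrable_pow_gaussian _).const_mul _

lemma integral_centeredPoly {m : ℕ} (a : Fin m → ℝ) :
    ∫ x, (centeredPoly a).eval x ∂stdGaussianReal = 0 := by
  simp only [eval_centeredPoly]
  rw [integral_finsetSum]
  · refine Finset.sum_eq_zero fun j _ => ?_
    rw [integral_const_mul, integral_sub (integrable_pow_gaussian _) (integrable_const _)]
    simp [gaussMoment]
  · intro j _
    exact ((integrable_pow_gaussian _).sub (integrable_const _)).const_mul _

lemma polynomial_eq_zero_of_ae_gaussian {p : Polynomial ℝ}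
    (h : ∀ᵐ x ∂stdGaussianReal, p.eval x = 0) : p = 0 := by
  by_contra hp
  have hac : (volume : Measure ℝ) ≪ stdGaussianReal := gaussianReal_absolutelyContinuous' 0 one_ne_zero
  have h2 : ∀ᵐ x : ℝ, p.eval x = 0 := hac.ae_le h
  have h3 : (volume : Measure ℝ) {x | p.eval x = 0} = 0 := by
    have : {x | p.eval x = 0} = (p.rootSet ℝ : Set ℝ) := by
      ext x; simp [Polynomial.mem_rootSet, hp]
    rw [this]
    exact (Polynomial.rootSet_finite p ℝ).measure_zero _
  have h4 : (volume : Measure ℝ) {x | ¬ p.eval x = 0} = 0 := h2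
  have h5 : (volume : Measure ℝ) Set.univ = 0 := by
    rw [← Set.union_compl_self {x : ℝ | p.eval x = 0}]
    exact measure_union_null h3 h4
  simp at h5

lemma centeredPoly_eq_zero {m : ℕ} {a : Fin m → ℝ} (h : centeredPoly a = 0) : a = 0 := by
  funext i
  have := congrArg (fun p => Polynomial.coeff p (i.1 + 1)) h
  simp [centeredPoly, Polynomial.coeff_X_pow] at this
  simpa [← Fin.ext_iff] using this

lemma integral_centeredPoly_sq_eq {m : ℕ} (a : Fin m → ℝ) :
    ∫ x, (centeredPoly a).eval x ^ 2 ∂stdGaussianReal =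
      ∑ i, ∑ j, a i * a j * ∫ x, (x ^ (i.1 + 1) - gaussMoment (i.1 + 1)) *
        (x ^ (j.1 + 1) - gaussMoment (j.1 + 1)) ∂stdGaussianReal := by
  have hint : ∀ i j : Fin m, Integrable (fun x => (x ^ (i.1 + 1) - gaussMoment (i.1 + 1)) *
        (x ^ (j.1 + 1) - gaussMoment (j.1 + 1))) stdGaussianReal := by
    intro i j
    have := integrable_polynomial_gaussian
      ((Polynomial.X ^ (i.1 + 1) - Polynomial.C (gaussMoment (i.1 + 1))) *
      (Polynomial.X ^ (j.1 + 1) - Polynomial.C (gaussMoment (j.1 + 1))))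
    simpa using this
  simp only [eval_centeredPoly, sq, Finset.sum_mul_sum]
  rw [integral_finsetSum]
  · refine Finset.sum_congr rfl fun i _ => ?_
    rw [integral_finsetSum]
    · refine Finset.sum_congr rfl fun j _ => ?_
      rw [← integral_const_mul]
      congr 1; funext x; ring
    · intro j _
      refine ((hint i j).const_mul (a i * a j)).congr (ae_of_all _ fun x => ?_)
      simp only; ring
  · intro i _
    refine integrable_finsetSum _ fun j _ => ?_
    refine ((hint i j).const_mul (a i * a j)).congr (ae_of_all _ fun x => ?_)
    simp only; ring

/-- On the finite-dimensional space of centred polynomials of degree at most `m`, the `L²` norm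
of the Gaussian measure dominates the Euclidean norm of the coefficients. -/
lemma exists_le_integral_centeredPoly_sq (m : ℕ) : ∃ c : ℝ, 0 < c ∧ ∀ a : Fin m → ℝ,
    c * ∑ j, a j ^ 2 ≤ ∫ x, (centeredPoly a).eval x ^ 2 ∂stdGaussianReal := by
  set Φ : (Fin m → ℝ) → ℝ := fun a => ∫ x, (centeredPoly a).eval x ^ 2 ∂stdGaussianReal with hΦ
  have hcont : Continuous Φ := by
    have : Φ = _ := funext fun a => integral_centeredPoly_sq_eq a
    rw [this]; fun_prop
  have hsq : ∀ p : Polynomial ℝ, Integrable (fun x => p.eval x ^ 2) stdGaussianReal := fun p =>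
    (integrable_polynomial_gaussian (p ^ 2)).congr (ae_of_all _ fun x => Polynomial.eval_pow 2)
  have hpos : ∀ a : Fin m → ℝ, a ≠ 0 → 0 < Φ a := by
    intro a ha
    refine lt_of_le_of_ne (integral_nonneg fun x => sq_nonneg _) fun h => ha ?_
    have := (integral_eq_zero_iff_of_nonneg (fun x => sq_nonneg _) (hsq _)).1 h.symm
    refine centeredPoly_eq_zero (polynomial_eq_zero_of_ae_gaussian ?_)
    filter_upwards [this] with x hx
    simpa using hx
  have hhom : ∀ (r : ℝ) a, Φ (r • a) = r ^ 2 * Φ a := by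
    intro r a
    simp only [hΦ]
    rw [← integral_const_mul]
    congr 1; funext x
    rw [← mul_pow]
    simp only [eval_centeredPoly, Finset.mul_sum, Pi.smul_apply, smul_eq_mul, mul_assoc]
  set S : Set (Fin m → ℝ) := {a | ∑ j, a j ^ 2 = 1} with hS
  have hScomp : IsCompact S := by
    refine Metric.isCompact_of_isClosed_isBounded ?_ ?_
    · exact isClosed_eq (by fun_prop) continuous_const
    · refine (Metric.isBounded_closedBall (x := (0 : Fin m → ℝ)) (r := 1)).subset fun a ha => ?_
      rw [mem_closedBall_zero_iff, pi_norm_le_iff_of_nonneg zero_le_one]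
      intro i
      rw [Real.norm_eq_abs, ← sq_le_one_iff_abs_le_one]
      have h1 : ∑ j, a j ^ 2 = 1 := ha
      rw [← h1]
      exact Finset.single_le_sum (f := fun j => a j ^ 2) (fun j _ => sq_nonneg _)
        (Finset.mem_univ i)
  rcases S.eq_empty_or_nonempty with hE | hne
  · refine ⟨1, one_pos, fun a => ?_⟩
    have : ∑ j, a j ^ 2 = 0 := by
      by_contra h
      have h0 : 0 < ∑ j, a j ^ 2 := lt_of_le_of_ne (Finset.sum_nonneg fun j _ => sq_nonneg _) (Ne.symm h)
      have : (Real.sqrt (∑ j, a j ^ 2))⁻¹ • a ∈ S := by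
        simp only [hS, Set.mem_ofPred_eq, Pi.smul_apply, smul_eq_mul, mul_pow, ← Finset.mul_sum,
          inv_pow, Real.sq_sqrt h0.le]
        exact inv_mul_cancel₀ h
      rw [hE] at this; exact this
    rw [this, mul_zero]
    exact integral_nonneg fun x => sq_nonneg _
  · obtain ⟨a₀, ha₀, hmin⟩ := hScomp.exists_isMinOn hne hcont.continuousOn
    have ha₀0 : a₀ ≠ 0 := by
      rintro rfl
      simp [hS] at ha₀
    refine ⟨Φ a₀, hpos _ ha₀0, fun a => ?_⟩
    by_cases h : ∑ j, a j ^ 2 = 0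
    · rw [h, mul_zero]
      exact integral_nonneg fun x => sq_nonneg _
    have h0 : 0 < ∑ j, a j ^ 2 := lt_of_le_of_ne (Finset.sum_nonneg fun j _ => sq_nonneg _) (Ne.symm h)
    have hm : (Real.sqrt (∑ j, a j ^ 2))⁻¹ • a ∈ S := by
      simp only [hS, Set.mem_ofPred_eq, Pi.smul_apply, smul_eq_mul, mul_pow, ← Finset.mul_sum,
        inv_pow, Real.sq_sqrt h0.le]
      exact inv_mul_cancel₀ h
    have := hmin hm
    simp only [Set.mem_ofPred_eq] at this
    rw [hhom, inv_pow, Real.sq_sqrt h0.le, inv_mul_eq_div, le_div_iff₀ h0] at this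
    exact this

/-- Moments of order `2q` of a constant plus a centred polynomial. Since the linear term of
`add_pow_le_taylor` integrates to zero, `b ^ (2q)` comes with the factor `1` exactly, which is what
makes the bound stable under iteration over the variables. -/
lemma exists_integral_add_centeredPoly_pow_le (m q : ℕ) (hq : 1 ≤ q) :
    ∃ M : ℝ, 0 ≤ M ∧ ∀ (b : ℝ) (a : Fin m → ℝ),
      ∫ x, (b + (centeredPoly a).eval x) ^ (2 * q) ∂stdGaussianReal ≤
        b ^ (2 * q) + M * ((b ^ 2) ^ (q - 1) * ∑ j, a j ^ 2 + (∑ j, a j ^ 2) ^ q) := by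
  set w : Polynomial ℝ := ∑ j : Fin m,
    (Polynomial.X ^ (j.1 + 1) - Polynomial.C (gaussMoment (j.1 + 1))) ^ 2 with hw
  have hw0 : ∀ x, 0 ≤ w.eval x := fun x => by
    simp only [hw, Polynomial.eval_finsetSum, Polynomial.eval_pow]
    exact Finset.sum_nonneg fun j _ => sq_nonneg _
  have hcs : ∀ (a : Fin m → ℝ) x, (centeredPoly a).eval x ^ 2 ≤ (∑ j, a j ^ 2) * w.eval x := by
    intro a x
    rw [eval_centeredPoly]
    simp only [hw, Polynomial.eval_finsetSum, Polynomial.eval_pow, Polynomial.eval_sub,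
      Polynomial.eval_X, Polynomial.eval_C]
    exact Finset.sum_mul_sq_le_sq_mul_sq _ _ _
  have I1 : 0 ≤ ∫ x, w.eval x ∂stdGaussianReal := integral_nonneg hw0
  have I2 : 0 ≤ ∫ x, w.eval x ^ q ∂stdGaussianReal := integral_nonneg fun x => pow_nonneg (hw0 x) _
  refine ⟨4 ^ q * (∫ x, w.eval x ∂stdGaussianReal + ∫ x, w.eval x ^ q ∂stdGaussianReal),
    by positivity, fun b a => ?_⟩
  set A := ∑ j, a j ^ 2 with hA
  have hA0 : 0 ≤ A := Finset.sum_nonneg fun j _ => sq_nonneg _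
  have hb : b ^ (2 * q - 2) = (b ^ 2) ^ (q - 1) := by rw [← pow_mul]; congr 1; omega
  have hbn : 0 ≤ (b ^ 2) ^ (q - 1) := by positivity
  have ip := integrable_polynomial_gaussian
  have hle : ∀ x, (b + (centeredPoly a).eval x) ^ (2 * q) ≤
      b ^ (2 * q) + 2 * q * b ^ (2 * q - 1) * (centeredPoly a).eval x
      + 4 ^ q * ((b ^ 2) ^ (q - 1) * (A * w.eval x) + A ^ q * w.eval x ^ q) := by
    intro x
    refine (add_pow_le_taylor q hq b _).trans ?_
    rw [hb]
    have h1 := hcs a x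
    have h2 : (centeredPoly a).eval x ^ (2 * q) ≤ A ^ q * w.eval x ^ q := by
      rw [pow_mul, ← mul_pow]
      exact pow_le_pow_left₀ (sq_nonneg _) h1 _
    gcongr
  have i1 : Integrable (fun x => (b + (centeredPoly a).eval x) ^ (2 * q)) stdGaussianReal := by
    simpa using ip ((Polynomial.C b + centeredPoly a) ^ (2 * q))
  have iw : Integrable (fun x => w.eval x ^ q) stdGaussianReal := by simpa using ip (w ^ q)
  have i2 : Integrable (fun x => b ^ (2 * q) + 2 * q * b ^ (2 * q - 1) * (centeredPoly a).eval x)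
    stdGaussianReal := (integrable_const _).add ((ip _).const_mul _)
  have i3 : Integrable (fun x => 4 ^ q * ((b ^ 2) ^ (q - 1) * (A * w.eval x) + A ^ q * w.eval x ^ q))
    stdGaussianReal := ((((ip _).const_mul _).const_mul _).add (iw.const_mul _)).const_mul _
  refine (integral_mono i1 (i2.add i3) hle).trans ?_
  simp only [Pi.add_apply]
  rw [integral_add i2 i3, integral_add (integrable_const _) ((ip _).const_mul _),
    integral_const_mul, integral_const_mul, integral_add (((ip _).const_mul _).const_mul _)
    (iw.const_mul _), integral_const_mul, integral_const_mul, integral_const_mul,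
    integral_centeredPoly]
  simp only [integral_const, probReal_univ, one_smul, mul_zero, add_zero]
  have hAq : 0 ≤ A ^ q := by positivity
  have t1 : 0 ≤ (b ^ 2) ^ (q - 1) * A * ∫ x, w.eval x ^ q ∂stdGaussianReal := by positivity
  have t2 : 0 ≤ A ^ q * ∫ x, w.eval x ∂stdGaussianReal := by positivity
  have : (b ^ 2) ^ (q - 1) * (A * ∫ x, w.eval x ∂stdGaussianReal) +
      A ^ q * ∫ x, w.eval x ^ q ∂stdGaussianReal ≤
      (∫ x, w.eval x ∂stdGaussianReal + ∫ x, w.eval x ^ q ∂stdGaussianReal) *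
        ((b ^ 2) ^ (q - 1) * A + A ^ q) := by nlinarith
  have h4 : (0:ℝ) ≤ 4 ^ q := by positivity
  nlinarith [mul_le_mul_of_nonneg_left this h4]

/-! ### Moments of polynomials in several Gaussian variables -/

/-- Decomposition of a polynomial as its mean over the first variable, a polynomial in the others,
plus a centred polynomial in the first variable. -/
lemma eval_cons_eq_add_centeredPoly {d m : ℕ} {p : MvPolynomial (Fin (d + 1)) ℝ}
    (hp : p.totalDegree ≤ m) (x : ℝ) (y : Fin d → ℝ) :
    MvPolynomial.eval (Fin.cons x y : Fin (d + 1) → ℝ) p =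
      MvPolynomial.eval y (∑ j ∈ Finset.range (m + 1), MvPolynomial.C (gaussMoment j) *
        (MvPolynomial.finSuccEquiv ℝ d p).coeff j) +
      (centeredPoly fun j : Fin m =>
        MvPolynomial.eval y ((MvPolynomial.finSuccEquiv ℝ d p).coeff (j.1 + 1))).eval x := by
  have hdeg : (Polynomial.map (MvPolynomial.eval y) (MvPolynomial.finSuccEquiv ℝ d p)).natDegree
      < m + 1 := by
    refine lt_of_le_of_lt Polynomial.natDegree_map_le ?_
    rw [MvPolynomial.natDegree_finSuccEquiv]
    exact Nat.lt_succ_of_le ((MvPolynomial.degreeOf_le_totalDegree _ _).trans hp)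
  rw [MvPolynomial.eval_eq_eval_mv_eval', Polynomial.eval_eq_sum_range' hdeg, eval_centeredPoly,
    map_sum]
  simp only [Polynomial.coeff_map, map_mul, MvPolynomial.eval_C]
  rw [Finset.sum_range_succ', Finset.sum_range_succ', ← Fin.sum_univ_eq_sum_range
    (fun k => MvPolynomial.eval y ((MvPolynomial.finSuccEquiv ℝ d p).coeff (k + 1)) * x ^ (k + 1)),
    ← Fin.sum_univ_eq_sum_range (fun k => gaussMoment (k + 1) *
      MvPolynomial.eval y ((MvPolynomial.finSuccEquiv ℝ d p).coeff (k + 1)))]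
  have h0 : gaussMoment 0 = 1 := by simp [gaussMoment]
  rw [h0]
  simp only [mul_sub, Finset.sum_sub_distrib]
  simp only [mul_comm (gaussMoment _)]
  simp
  ring

/-- Fubini's theorem for polynomials, with the first variable integrated first. -/
lemma integral_gaussPi_succ {d : ℕ} (F : MvPolynomial (Fin (d + 1)) ℝ) :
    Integrable (fun y => ∫ x, MvPolynomial.eval (Fin.cons x y : Fin (d + 1) → ℝ) F ∂stdGaussianReal)
      (gaussPi d) ∧
    ∫ z, MvPolynomial.eval z F ∂gaussPi (d + 1) =
      ∫ y, ∫ x, MvPolynomial.eval (Fin.cons x y : Fin (d + 1) → ℝ) F ∂stdGaussianReal ∂gaussPi d := by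
  have hmp := (measurePreserving_piFinSuccAbove (n := d) (fun _ : Fin (d + 1) => stdGaussianReal) 0)
  have hs := hmp.symm
  have e1 : ∀ z : ℝ × (Fin d → ℝ),
      (MeasurableEquiv.piFinSuccAbove (fun _ : Fin (d + 1) => ℝ) 0).symm z
        = (Fin.cons z.1 z.2 : Fin (d + 1) → ℝ) := by
    intro z
    simp [MeasurableEquiv.piFinSuccAbove, Fin.insertNthEquiv]
  have hi : Integrable (fun z : ℝ × (Fin d → ℝ) =>
      MvPolynomial.eval (Fin.cons z.1 z.2 : Fin (d + 1) → ℝ) F)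
      (stdGaussianReal.prod (gaussPi d)) := by
    have := (hs.integrable_comp_emb (MeasurableEquiv.measurableEmbedding _)).2
      (integrable_eval_gaussPi F)
    refine this.congr (ae_of_all _ fun z => ?_)
    simp only [Function.comp, e1]
  refine ⟨hi.integral_prod_right, ?_⟩
  rw [← integral_prod_symm _ hi, ← hs.integral_comp (MeasurableEquiv.measurableEmbedding _)]
  exact integral_congr_ae (ae_of_all _ fun z => by simp only [e1])

lemma pow_add_le_pow_add_mul {q : ℕ} (hq : 2 ≤ q) {a y : ℝ} (ha : 0 ≤ a) (hy : 0 ≤ y) :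
    a ^ q + a ^ (q - 1) * y + y ^ q ≤ (a + y) ^ q := by
  obtain ⟨r, rfl⟩ : ∃ r, q = r + 1 := ⟨q - 1, by omega⟩
  have h1 : a ^ r + y ^ r ≤ (a + y) ^ r := pow_add_pow_le ha hy (by omega)
  have h2 : a ^ r ≤ (a + y) ^ r := by gcongr; linarith
  rw [pow_succ (a + y), Nat.add_sub_cancel]
  calc _ = a ^ r * a + (a ^ r + y ^ r) * y := by ring
    _ ≤ (a + y) ^ r * a + (a + y) ^ r * y := by gcongr
    _ = _ := by ring

lemma finset_sum_pow_le {ι : Type*} (s : Finset ι) {f : ι → ℝ} (hf : ∀ i, 0 ≤ f i) {q : ℕ}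
    (hq : q ≠ 0) : ∑ i ∈ s, f i ^ q ≤ (∑ i ∈ s, f i) ^ q := by
  classical
  induction s using Finset.induction_on with
  | empty => simp [hq]
  | insert i s hi ih =>
    rw [Finset.sum_insert hi, Finset.sum_insert hi]
    refine (add_le_add_right ih _).trans
      (pow_add_pow_le (hf i) (Finset.sum_nonneg fun i _ => hf i) hq)

/-- The numerical inequality that closes the induction of `exists_integral_eval_pow_le`, for `K` large
in terms of `c`, `M`, `m` and `q`. -/
lemma add_mul_pow_le_add_mul_pow {m q : ℕ} (hq : 2 ≤ q) {c K M u w : ℝ} (hM : 0 ≤ M)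
    (hcK : 1 + M * (m + 1) ^ q ≤ c * K) (hcK1 : 1 ≤ c * K) (hu0 : 0 ≤ u) (hw0 : 0 ≤ w) :
    u ^ q + M * (u ^ (q - 1) * w + (m + 1) ^ q * w ^ q) ≤ (u + c * K * w) ^ q := by
  refine le_trans ?_ (pow_add_le_pow_add_mul hq hu0 (by positivity))
  have hm1 : (1:ℝ) ≤ ((m:ℝ) + 1) ^ q := one_le_pow₀ (by linarith [(Nat.cast_nonneg m : (0:ℝ) ≤ m)])
  have hML : M ≤ c * K := by nlinarith
  have hcq : M * (m + 1) ^ q ≤ (c * K) ^ q := by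
    calc _ ≤ c * K := by linarith
      _ ≤ _ := le_self_pow₀ hcK1 (by omega)
  have h1 : M * (u ^ (q - 1) * w) ≤ u ^ (q - 1) * (c * K * w) := by
    have : 0 ≤ u ^ (q - 1) * w := by positivity
    nlinarith
  have h2 : M * ((m + 1) ^ q * w ^ q) ≤ (c * K * w) ^ q := by
    rw [mul_pow, ← mul_assoc]; gcongr
  linarith

set_option maxHeartbeats 400000 in
/-- Equivalence of moments for polynomials in any number `d` of independent standard Gaussian
variables, with a constant that depends on the degree but not on `d`. The proof is by induction
on `d`; to close it, the constant has to be `K ^ m'` for polynomials of degree `m'`: a coefficient of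
`x^{j+1}` in the first variable has a smaller degree, so that it gains a factor `K⁻¹`, which pays
for the cross terms. -/
lemma exists_integral_eval_pow_le (m q : ℕ) (hq : 2 ≤ q) : ∃ K : ℝ, 1 ≤ K ∧
    ∀ (d m' : ℕ), m' ≤ m → ∀ p : MvPolynomial (Fin d) ℝ, p.totalDegree ≤ m' →
      ∫ z, MvPolynomial.eval z p ^ (2 * q) ∂gaussPi d ≤
        (K ^ m' * ∫ z, MvPolynomial.eval z p ^ 2 ∂gaussPi d) ^ q := by
  obtain ⟨c, hc, hlow⟩ := exists_le_integral_centeredPoly_sq m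
  obtain ⟨M, hM, hup⟩ := exists_integral_add_centeredPoly_pow_le m q (by omega)
  set K : ℝ := max 1 ((1 + M * (m + 1) ^ q) / c) with hK
  have hK1 : 1 ≤ K := le_max_left _ _
  have hK0 : 0 < K := by linarith
  have hcK : 1 + M * (m + 1) ^ q ≤ c * K := by
    have : (1 + M * (m + 1) ^ q) / c ≤ K := le_max_right _ _
    rw [div_le_iff₀ hc] at this; linarith
  have hcK1 : 1 ≤ c * K := le_trans (by have : 0 ≤ M * ((m:ℝ) + 1) ^ q := by positivity
                                        linarith) hcK
  refine ⟨K, hK1, fun d => ?_⟩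
  induction d with
  | zero =>
    intro m' _ p _
    have : ∀ z : Fin 0 → ℝ, MvPolynomial.eval z p = MvPolynomial.eval default p := fun z => by
      rw [Subsingleton.elim z default]
    simp only [this, integral_const, probReal_univ, one_smul]
    rw [pow_mul]
    gcongr
    exact le_mul_of_one_le_left (sq_nonneg _) (one_le_pow₀ hK1)
  | succ d ih =>
    intro m' hm' p hp
    set r : ℕ → MvPolynomial (Fin d) ℝ := (MvPolynomial.finSuccEquiv ℝ d p).coeff with hr
    set Q : MvPolynomial (Fin d) ℝ := ∑ j ∈ Finset.range (m + 1),
      MvPolynomial.C (gaussMoment j) * r j with hQ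
    have hrd : ∀ j, r j ≠ 0 → (r j).totalDegree + j ≤ m' := fun j hj =>
      (MvPolynomial.totalDegree_coeff_finSuccEquiv_add_le p j hj).trans hp
    have hQd : Q.totalDegree ≤ m' := by
      refine MvPolynomial.totalDegree_finsetSum_le fun j _ => ?_
      by_cases hj : r j = 0
      · simp [hj]
      · refine (MvPolynomial.totalDegree_mul _ _).trans ?_
        have := hrd j hj
        simp only [MvPolynomial.totalDegree_C]; omega
    have hdec : ∀ x y, MvPolynomial.eval (Fin.cons x y : Fin (d + 1) → ℝ) p =
        MvPolynomial.eval y Q + (centeredPoly fun j : Fin m =>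
          MvPolynomial.eval y (r (j.1 + 1))).eval x := fun x y =>
      eval_cons_eq_add_centeredPoly (hp.trans hm') x y
    have ie : ∀ f : MvPolynomial (Fin d) ℝ, Integrable (fun y => MvPolynomial.eval y f) (gaussPi d) :=
      integrable_eval_gaussPi
    have ipow : ∀ (f : MvPolynomial (Fin d) ℝ) (k : ℕ),
        Integrable (fun y => MvPolynomial.eval y f ^ k) (gaussPi d) := fun f k =>
      (ie (f ^ k)).congr (ae_of_all _ fun y => map_pow _ _ _)
    -- second moment from below: the two parts of the decomposition are orthogonal in `L²`
    set a : ℝ := ∫ y, MvPolynomial.eval y Q ^ 2 ∂gaussPi d with ha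
    set ρ : Fin m → ℝ := fun j => ∫ y, MvPolynomial.eval y (r (j.1 + 1)) ^ 2 ∂gaussPi d with hρ
    have ha0 : 0 ≤ a := integral_nonneg fun y => sq_nonneg _
    have hρ0 : ∀ j, 0 ≤ ρ j := fun j => integral_nonneg fun y => sq_nonneg _
    obtain ⟨j2, e2⟩ := integral_gaussPi_succ (p ^ 2)
    obtain ⟨jq, eq'⟩ := integral_gaussPi_succ (p ^ (2 * q))
    simp only [map_pow] at j2 e2 jq eq'
    have hsecond : a + c * ∑ j, ρ j ≤ ∫ z, MvPolynomial.eval z p ^ 2 ∂gaussPi (d + 1) := by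
      rw [e2]
      have hs : ∑ j, ρ j = ∫ y, ∑ j : Fin m, MvPolynomial.eval y (r (j.1 + 1)) ^ 2 ∂gaussPi d := by
        rw [integral_finsetSum _ fun j _ => ipow _ 2]
      have is : Integrable (fun y => ∑ j : Fin m, MvPolynomial.eval y (r (j.1 + 1)) ^ 2)
        (gaussPi d) := integrable_finsetSum _ fun j _ => ipow _ 2
      rw [hs, ha, ← integral_const_mul, ← integral_add (ipow _ 2) (is.const_mul c)]
      refine integral_mono ((ipow _ 2).add (is.const_mul c)) j2 fun y => ?_
      simp only [hdec]
      set s := centeredPoly fun j : Fin m => MvPolynomial.eval y (r (j.1 + 1)) with hs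
      have i1 : Integrable (fun x => s.eval x) stdGaussianReal := integrable_polynomial_gaussian s
      have i2 : Integrable (fun x => s.eval x ^ 2) stdGaussianReal :=
        (integrable_polynomial_gaussian (s ^ 2)).congr (ae_of_all _ fun x => Polynomial.eval_pow 2)
      have : ∫ x, (MvPolynomial.eval y Q + s.eval x) ^ 2 ∂stdGaussianReal =
          MvPolynomial.eval y Q ^ 2 + ∫ x, s.eval x ^ 2 ∂stdGaussianReal := by
        simp only [add_sq]
        have i3 : Integrable (fun x => MvPolynomial.eval y Q ^ 2 +
          2 * MvPolynomial.eval y Q * s.eval x) stdGaussianReal :=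
          (integrable_const _).add (i1.const_mul _)
        rw [integral_add i3 i2,
          integral_add (integrable_const _) (i1.const_mul _), integral_const_mul, hs,
          integral_centeredPoly]
        simp
      rw [this]
      gcongr
      exact hlow _
    -- the induction hypothesis for the coefficients; those of `x ^ (j + 1)` have degree at most
    -- `m' - 1`, hence the constant `K ^ m' / K`
    set u : ℝ := K ^ m' * a with hu
    set v : Fin m → ℝ := fun j => K ^ m' / K * ρ j with hv
    have hu0 : 0 ≤ u := by positivity
    have hv0 : ∀ j, 0 ≤ v j := fun j => mul_nonneg (by positivity) (hρ0 j)
    have hQ2 : ∫ y, (MvPolynomial.eval y Q ^ 2) ^ q ∂gaussPi d ≤ u ^ q := by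
      simp only [← pow_mul]; exact ih m' hm' Q hQd
    have hR2 : ∀ j : Fin m, ∫ y, (MvPolynomial.eval y (r (j.1 + 1)) ^ 2) ^ q ∂gaussPi d ≤ v j ^ q := by
      intro j
      by_cases hj : r (j.1 + 1) = 0
      · simp only [hj, map_zero]
        have := pow_nonneg (hv0 j) q
        rw [zero_pow two_ne_zero, zero_pow (by omega)]
        simpa using this
      · have hd := hrd _ hj
        obtain ⟨n, rfl⟩ : ∃ n, m' = n + 1 := ⟨m' - 1, by omega⟩
        have := ih n (by omega) (r (j.1 + 1)) (by omega)
        simp only [← pow_mul]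
        refine this.trans (le_of_eq ?_)
        simp only [hv, hρ]
        rw [pow_succ, mul_div_cancel_right₀ _ hK0.ne']
    have i2q : ∀ f : MvPolynomial (Fin d) ℝ,
        Integrable (fun y => (MvPolynomial.eval y f ^ 2) ^ q) (gaussPi d) := fun f => by
      simpa only [← pow_mul] using ipow f (2 * q)
    have imix : ∀ f g : MvPolynomial (Fin d) ℝ, Integrable (fun y =>
        (MvPolynomial.eval y f ^ 2) ^ (q - 1) * MvPolynomial.eval y g ^ 2) (gaussPi d) := fun f g =>
      (ie ((f ^ 2) ^ (q - 1) * g ^ 2)).congr (ae_of_all _ fun y => by simp)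
    have hsm : ∀ f : MvPolynomial (Fin d) ℝ,
        AEStronglyMeasurable (fun y => MvPolynomial.eval y f ^ 2) (gaussPi d) := fun f =>
      (ipow f 2).aestronglyMeasurable
    have hmix : ∀ j : Fin m, ∫ y, (MvPolynomial.eval y Q ^ 2) ^ (q - 1) *
        MvPolynomial.eval y (r (j.1 + 1)) ^ 2 ∂gaussPi d ≤ u ^ (q - 1) * v j := fun j =>
      integral_pow_mul_le hq (fun y => sq_nonneg _) (fun y => sq_nonneg _) (hsm _) (hsm _)
        (i2q _) (i2q _) hu0 (hv0 j) hQ2 (hR2 j)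
    set w := ∑ j, v j with hw
    have hw0 : 0 ≤ w := Finset.sum_nonneg fun j _ => hv0 j
    have hKw : K * w = K ^ m' * ∑ j, ρ j := by
      simp only [hw, hv, ← Finset.mul_sum]
      field_simp
    -- upper bound for the `2q`th moment
    have hsumpow : ∀ y, (∑ j : Fin m, MvPolynomial.eval y (r (j.1 + 1)) ^ 2) ^ q ≤
        (m + 1) ^ q * ∑ j : Fin m, (MvPolynomial.eval y (r (j.1 + 1)) ^ 2) ^ q := by
      intro y
      obtain ⟨k, rfl⟩ : ∃ k, q = k + 1 := ⟨q - 1, by omega⟩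
      have h := pow_sum_le_card_mul_sum_pow (s := Finset.univ)
        (f := fun j : Fin m => MvPolynomial.eval y (r (j.1 + 1)) ^ 2) (fun j _ => sq_nonneg _) k
      refine h.trans ?_
      rw [Finset.card_univ, Fintype.card_fin]
      have hS : 0 ≤ ∑ j : Fin m, (MvPolynomial.eval y (r (j.1 + 1)) ^ 2) ^ (k + 1) :=
        Finset.sum_nonneg fun j _ => by positivity
      refine mul_le_mul_of_nonneg_right ?_ hS
      calc (m : ℝ) ^ k ≤ ((m : ℝ) + 1) ^ k := by gcongr; linarith
        _ ≤ _ := pow_le_pow_right₀ (by linarith [(Nat.cast_nonneg m : (0:ℝ) ≤ m)]) (by omega)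
    have hupper : ∫ z, MvPolynomial.eval z p ^ (2 * q) ∂gaussPi (d + 1) ≤
        u ^ q + M * (u ^ (q - 1) * w + (m + 1) ^ q * w ^ q) := by
      rw [eq']
      have iS : Integrable (fun y => ∑ j : Fin m, (MvPolynomial.eval y Q ^ 2) ^ (q - 1) *
        MvPolynomial.eval y (r (j.1 + 1)) ^ 2) (gaussPi d) :=
        integrable_finsetSum _ fun j _ => imix _ _
      have iT : Integrable (fun y => (m + 1 : ℝ) ^ q * ∑ j : Fin m,
          (MvPolynomial.eval y (r (j.1 + 1)) ^ 2) ^ q) (gaussPi d) :=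
        (integrable_finsetSum _ fun j _ => i2q _).const_mul _
      have step : ∀ y, ∫ x, MvPolynomial.eval (Fin.cons x y : Fin (d + 1) → ℝ) p ^ (2 * q)
          ∂stdGaussianReal ≤ (MvPolynomial.eval y Q ^ 2) ^ q +
            M * (∑ j : Fin m, (MvPolynomial.eval y Q ^ 2) ^ (q - 1) *
              MvPolynomial.eval y (r (j.1 + 1)) ^ 2 + (m + 1 : ℝ) ^ q * ∑ j : Fin m,
          (MvPolynomial.eval y (r (j.1 + 1)) ^ 2) ^ q) := by
        intro y
        simp only [hdec]
        refine (hup _ _).trans ?_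
        rw [pow_mul, ← Finset.mul_sum]
        gcongr
        exact hsumpow y
      have iST : Integrable (fun y => ∑ j : Fin m, (MvPolynomial.eval y Q ^ 2) ^ (q - 1) *
              MvPolynomial.eval y (r (j.1 + 1)) ^ 2 + (m + 1 : ℝ) ^ q * ∑ j : Fin m,
          (MvPolynomial.eval y (r (j.1 + 1)) ^ 2) ^ q) (gaussPi d) := iS.add iT
      refine (integral_mono jq ((i2q Q).add (iST.const_mul M)) step).trans ?_
      simp only [Pi.add_apply]
      rw [integral_add (i2q Q) (iST.const_mul M), integral_const_mul, integral_add iS iT,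
        integral_const_mul, integral_finsetSum _ fun j _ => imix _ _,
        integral_finsetSum _ fun j _ => i2q _]
      have t1 : ∑ j : Fin m, ∫ y, (MvPolynomial.eval y Q ^ 2) ^ (q - 1) *
        MvPolynomial.eval y (r (j.1 + 1)) ^ 2 ∂gaussPi d ≤ u ^ (q - 1) * w := by
        rw [hw, Finset.mul_sum]
        exact Finset.sum_le_sum fun j _ => hmix j
      have t2 : ∑ j : Fin m, ∫ y, (MvPolynomial.eval y (r (j.1 + 1)) ^ 2) ^ q ∂gaussPi d ≤ w ^ q :=
        (Finset.sum_le_sum fun j _ => hR2 j).trans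
          (finset_sum_pow_le _ hv0 (by omega))
      gcongr
    have hfin : u + c * K * w ≤ K ^ m' * ∫ z, MvPolynomial.eval z p ^ 2 ∂gaussPi (d + 1) := by
      calc u + c * K * w = K ^ m' * (a + c * ∑ j, ρ j) := by
            rw [mul_assoc c, hKw, hu]; ring
        _ ≤ _ := mul_le_mul_of_nonneg_left hsecond (by positivity)
    clear_value u w K
    have h1 := add_mul_pow_le_add_mul_pow hq hM hcK hcK1 hu0 hw0
    exact hupper.trans (h1.trans (pow_le_pow_left₀ (by positivity) hfin q))

/-! ### Moments on Wiener chaoses -/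

/-- A substitution of polynomials of degree at most one does not raise the degree. -/
lemma totalDegree_eval₂_C_le {σ τ : Type*} {p : MvPolynomial σ ℝ} {g : σ → MvPolynomial τ ℝ}
    {m : ℕ} (hp : p.totalDegree ≤ m) (hg : ∀ i, (g i).totalDegree ≤ 1) :
    (p.eval₂ MvPolynomial.C g).totalDegree ≤ m := by
  rw [MvPolynomial.eval₂_eq]
  refine MvPolynomial.totalDegree_finsetSum_le fun s hs => ?_
  refine (MvPolynomial.totalDegree_mul _ _).trans ?_
  rw [MvPolynomial.totalDegree_C, zero_add]
  refine (MvPolynomial.totalDegree_finsetProd _ _).trans ?_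
  refine (Finset.sum_le_sum fun i _ => (MvPolynomial.totalDegree_pow _ _).trans
    (Nat.mul_le_mul_left (s i) (hg i))).trans ?_
  simp only [mul_one]
  exact (MvPolynomial.le_totalDegree hs).trans hp

lemma eval_eval₂_C_eq {σ τ : Type*} {p : MvPolynomial σ ℝ} {g : σ → MvPolynomial τ ℝ}
    {x : σ → ℝ} {z : τ → ℝ} (h : ∀ i ∈ p.vars, MvPolynomial.eval z (g i) = x i) :
    MvPolynomial.eval z (p.eval₂ MvPolynomial.C g) = MvPolynomial.eval x p := by
  rw [MvPolynomial.eval₂_eq, map_sum, MvPolynomial.eval_eq]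
  refine Finset.sum_congr rfl fun s hs => ?_
  rw [map_mul, MvPolynomial.eval_C, map_prod]
  congr 1
  refine Finset.prod_congr rfl fun i hi => ?_
  rw [map_pow, h i ((MvPolynomial.mem_vars_iff_mem_support i).2 ⟨s, hs, hi⟩)]

section
variable {Ω : Type*} [MeasurableSpace Ω] {P : Measure Ω}

lemma coeFn_finset_sum_smul {ι : Type*} (s : Finset ι) (c : ι → ℝ) (e : ι → Lp ℝ 2 P) :
    ((∑ j ∈ s, c j • e j : Lp ℝ 2 P) : Ω → ℝ) =ᵐ[P] fun ω => ∑ j ∈ s, c j * e j ω := by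
  classical
  induction s using Finset.induction_on with
  | empty =>
    filter_upwards [Lp.coeFn_zero ℝ 2 P] with ω h
    exact h
  | insert i s hi ih =>
    rw [Finset.sum_insert hi]
    filter_upwards [Lp.coeFn_add (c i • e i) (∑ j ∈ s, c j • e j), Lp.coeFn_smul (c i) (e i), ih]
      with ω h1 h2 h3
    rw [h1, Pi.add_apply, h2, h3, Finset.sum_insert hi]
    rfl

/-- The variance of an element of a Gaussian space is the square of its norm. -/
lemma map_eq_gaussianReal_norm {G : Submodule ℝ (Lp ℝ 2 P)} (hG : IsGaussianSpace G)
    {ξ : Lp ℝ 2 P} (hξ : ξ ∈ G) :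
    P.map (ξ : Ω → ℝ) = gaussianReal 0 (‖ξ‖₊ ^ 2) := by
  obtain ⟨v, hv⟩ := hG ξ hξ
  rw [hv]
  congr 1
  have h1 : ∫ x, x ^ 2 ∂(gaussianReal 0 v) = v := by
    have := variance_id_gaussianReal (μ := 0) (v := v)
    rw [variance_of_integral_eq_zero aemeasurable_id (by simp [integral_id_gaussianReal])] at this
    simpa using this
  have h2 : ∫ x, x ^ 2 ∂(gaussianReal 0 v) = ‖ξ‖ ^ 2 := by
    rw [← hv, integral_map (Lp.aestronglyMeasurable ξ).aemeasurable (by fun_prop),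
      ← real_inner_self_eq_norm_sq, L2.inner_def]
    congr 1; funext ω
    simp [sq]
  rw [← NNReal.coe_inj, ← h1, h2]
  simp

/-- Orthonormal elements of a Gaussian space are independent standard Gaussian variables: all linear
combinations being Gaussian, the joint characteristic function is the standard one. -/
lemma map_orthonormal_eq_gaussPi [IsProbabilityMeasure P] {G : Submodule ℝ (Lp ℝ 2 P)}
    (hG : IsGaussianSpace G) {d : ℕ} {e : Fin d → Lp ℝ 2 P} (he : Orthonormal ℝ e) (heG : ∀ i, e i ∈ G) :
    P.map (fun ω i => e i ω) = gaussPi d := by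
  have hm : AEMeasurable (fun ω i => e i ω) P :=
    aemeasurable_pi_lambda _ fun i => (Lp.aestronglyMeasurable (e i)).aemeasurable
  have : IsProbabilityMeasure (P.map (fun ω i => e i ω)) := Measure.isProbabilityMeasure_map hm
  refine charFun_eq_pi_iff.1 fun t => ?_
  set ξ : Lp ℝ 2 P := ∑ j, t j • e j with hξ
  have hξG : ξ ∈ G := Submodule.sum_mem _ fun j _ => G.smul_mem _ (heG j)
  have hnorm : ‖ξ‖ ^ 2 = ∑ j, t j ^ 2 := by
    rw [← real_inner_self_eq_norm_sq, hξ, he.inner_sum]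
    simp [sq]
  have e1 : charFun ((P.map (fun ω i => e i ω)).map (WithLp.toLp 2)) t
      = charFun (P.map (ξ : Ω → ℝ)) 1 := by
    rw [charFun_apply, charFun_apply, integral_map (by fun_prop) (by fun_prop),
      integral_map hm (by fun_prop), integral_map (Lp.aestronglyMeasurable ξ).aemeasurable
      (by fun_prop)]
    refine integral_congr_ae ?_
    filter_upwards [coeFn_finset_sum_smul Finset.univ t e] with ω hω
    simp only [PiLp.inner_apply]
    rw [hω]
    simp [mul_comm]
  rw [e1, map_eq_gaussianReal_norm hG hξG, charFun_gaussianReal]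
  simp only [charFun_gaussianReal, ← Complex.exp_sum]
  congr 1
  have hn : ((‖ξ‖₊ ^ 2 : ℝ≥0) : ℂ) = ∑ j, (t j : ℂ) ^ 2 := by
    have : ((‖ξ‖₊ ^ 2 : ℝ≥0) : ℝ) = ∑ j, t j ^ 2 := by simpa using hnorm
    have h2 := congrArg (fun r : ℝ => (r : ℂ)) this
    push_cast at h2 ⊢
    exact h2
  rw [hn]
  simp [Finset.sum_div]

/-- Polynomials of degree at most `m` in elements of the Gaussian space `G`, as random variables.
The indeterminates are indexed by all of `G`. -/
def IsPolynomialIn (G : Submodule ℝ (Lp ℝ 2 P)) (m : ℕ) (f : Lp ℝ 2 P) : Prop :=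
  ∃ p : MvPolynomial G ℝ, p.totalDegree ≤ m ∧
    (f : Ω → ℝ) =ᵐ[P] fun ω => MvPolynomial.eval (fun ξ : G => (ξ : Lp ℝ 2 P) ω) p

/-- A polynomial in finitely many elements of `G` is a polynomial of no larger degree in an
orthonormal basis of their span. -/
lemma IsPolynomialIn.exists_orthonormal {G : Submodule ℝ (Lp ℝ 2 P)} {m : ℕ} {f : Lp ℝ 2 P}
    (hf : IsPolynomialIn G m f) : ∃ (d : ℕ) (e : Fin d → Lp ℝ 2 P) (p : MvPolynomial (Fin d) ℝ),
      Orthonormal ℝ e ∧ (∀ i, e i ∈ G) ∧ p.totalDegree ≤ m ∧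
      (f : Ω → ℝ) =ᵐ[P] fun ω => MvPolynomial.eval (fun i => e i ω) p := by
  obtain ⟨p, hp, hfp⟩ := hf
  set S : Set (Lp ℝ 2 P) := (fun ξ : G => (ξ : Lp ℝ 2 P)) '' (p.vars : Set G) with hS
  have hSf : S.Finite := p.vars.finite_toSet.image _
  set V := Submodule.span ℝ S with hV
  have hVG : V ≤ G := Submodule.span_le.2 (by rintro _ ⟨ξ, _, rfl⟩; exact ξ.2)
  have : FiniteDimensional ℝ V := FiniteDimensional.span_of_finite ℝ hSf
  set b := stdOrthonormalBasis ℝ V with hb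
  set e : Fin (Module.finrank ℝ V) → Lp ℝ 2 P := fun i => (b i : Lp ℝ 2 P) with he
  have heo : Orthonormal ℝ e := b.orthonormal.comp_linearIsometry V.subtypeₗᵢ
  set g : G → MvPolynomial (Fin (Module.finrank ℝ V)) ℝ := fun ξ =>
    ∑ j, MvPolynomial.C (inner ℝ (e j) (ξ : Lp ℝ 2 P)) * MvPolynomial.X j with hg
  refine ⟨_, e, p.eval₂ MvPolynomial.C g, heo, fun i => hVG (b i).2,
    totalDegree_eval₂_C_le hp fun ξ => ?_, ?_⟩
  · refine MvPolynomial.totalDegree_finsetSum_le fun j _ => ?_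
    refine (MvPolynomial.totalDegree_mul _ _).trans ?_
    simp
  · have hall : ∀ᵐ ω ∂P, ∀ ξ ∈ p.vars, (ξ : Lp ℝ 2 P) ω = ∑ j, inner ℝ (e j) (ξ : Lp ℝ 2 P) * e j ω := by
      refine (ae_ball_iff p.vars.countable_toSet).2 fun ξ hξ => ?_
      have hmem : (ξ : Lp ℝ 2 P) ∈ V := Submodule.subset_span ⟨ξ, hξ, rfl⟩
      have hrep : (ξ : Lp ℝ 2 P) = ∑ j, (inner ℝ (e j) (ξ : Lp ℝ 2 P) : ℝ) • e j := by
        have := congrArg (fun v : V => (v : Lp ℝ 2 P)) (b.sum_repr' ⟨ξ, hmem⟩)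
        simp only [Submodule.coe_sum, Submodule.coe_smul, Submodule.coe_inner] at this
        exact this.symm
      have := coeFn_finset_sum_smul (P := P) Finset.univ
        (fun j => (inner ℝ (e j) (ξ : Lp ℝ 2 P) : ℝ)) e
      rw [← hrep] at this
      exact this
    filter_upwards [hfp, hall] with ω h1 h2
    rw [h1, eval_eval₂_C_eq]
    intro ξ hξ
    simp [hg, h2 ξ hξ]

lemma enorm_lp_two_sq (f : Lp ℝ 2 P) : ‖f‖ₑ ^ 2 = ∫⁻ ω, ‖f ω‖ₑ ^ 2 ∂P := by
  rw [Lp.enorm_def, eLpNorm_eq_lintegral_rpow_enorm_toReal (by simp) (by simp)]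
  simp only [ENNReal.toReal_ofNat, ENNReal.rpow_ofNat]
  rw [← ENNReal.rpow_ofNat, ← ENNReal.rpow_mul]
  simp

lemma IsPolynomialIn.lintegral_pow_le [IsProbabilityMeasure P] {G : Submodule ℝ (Lp ℝ 2 P)}
    (hG : IsGaussianSpace G) {m q : ℕ} {K : ℝ} (hK : 1 ≤ K)
    (h : ∀ (d m' : ℕ), m' ≤ m → ∀ p : MvPolynomial (Fin d) ℝ, p.totalDegree ≤ m' →
      ∫ z, MvPolynomial.eval z p ^ (2 * q) ∂gaussPi d ≤
        (K ^ m' * ∫ z, MvPolynomial.eval z p ^ 2 ∂gaussPi d) ^ q)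
    {f : Lp ℝ 2 P} (hf : IsPolynomialIn G m f) :
    ∫⁻ ω, ‖f ω‖ₑ ^ (2 * q) ∂P ≤ ENNReal.ofReal ((K ^ m) ^ q) * ‖f‖ₑ ^ (2 * q) := by
  obtain ⟨d, e, p, heo, heG, hp, hfp⟩ := hf.exists_orthonormal
  have hm : AEMeasurable (fun ω i => e i ω) P :=
    aemeasurable_pi_lambda _ fun i => (Lp.aestronglyMeasurable (e i)).aemeasurable
  have hlaw := map_orthonormal_eq_gaussPi hG heo heG
  have key : ∀ k : ℕ, ∫⁻ ω, ‖f ω‖ₑ ^ (2 * k) ∂P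
      = ENNReal.ofReal (∫ z, MvPolynomial.eval z p ^ (2 * k) ∂gaussPi d) := by
    intro k
    have i1 : Integrable (fun z => MvPolynomial.eval z p ^ (2 * k)) (gaussPi d) :=
      (integrable_eval_gaussPi (p ^ (2 * k))).congr (ae_of_all _ fun z => map_pow _ _ _)
    have hnn : ∀ r : ℝ, 0 ≤ r ^ (2 * k) := fun r => by rw [pow_mul]; positivity
    rw [ofReal_integral_eq_lintegral_ofReal i1 (ae_of_all _ fun z => hnn _), ← hlaw,
      lintegral_map' (by rw [hlaw]; exact i1.aemeasurable.ennreal_ofReal) hm]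
    refine lintegral_congr_ae ?_
    filter_upwards [hfp] with ω hω
    rw [hω, ← enorm_pow, Real.enorm_of_nonneg (hnn _)]
  have k2 := key 1
  rw [mul_one, ← enorm_lp_two_sq] at k2
  rw [key q, pow_mul ‖f‖ₑ, k2, ← ENNReal.ofReal_pow (integral_nonneg fun z => sq_nonneg _),
    ← ENNReal.ofReal_mul (by positivity), ← mul_pow]
  exact ENNReal.ofReal_le_ofReal (h d m le_rfl p hp)

/-- The random variables that are polynomials of degree at most `m` in `G`, as a subspace. -/
def polynomialSubmodule (G : Submodule ℝ (Lp ℝ 2 P)) (m : ℕ) : Submodule ℝ (Lp ℝ 2 P) where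
  carrier := {f | IsPolynomialIn G m f}
  add_mem' := by
    rintro f g ⟨p, hp, hfp⟩ ⟨r, hr, hgr⟩
    refine ⟨p + r, (MvPolynomial.totalDegree_add _ _).trans (max_le hp hr), ?_⟩
    filter_upwards [Lp.coeFn_add f g, hfp, hgr] with ω h1 h2 h3
    rw [h1, Pi.add_apply, h2, h3, map_add]
  zero_mem' := by
    refine ⟨0, by simp, ?_⟩
    filter_upwards [Lp.coeFn_zero ℝ 2 P] with ω h
    rw [map_zero]; exact h
  smul_mem' := by
    rintro c f ⟨p, hp, hfp⟩
    refine ⟨c • p, (MvPolynomial.totalDegree_smul_le _ _).trans hp, ?_⟩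
    filter_upwards [Lp.coeFn_smul c f, hfp] with ω h1 h2
    rw [h1, Pi.smul_apply, h2, MvPolynomial.smul_eval, smul_eq_mul]

/-- Hermite polynomials of order at most `m` are polynomials of degree at most `m`, and nothing more
about them is needed. -/
lemma wienerChaosLE_le_topologicalClosure (G : Submodule ℝ (Lp ℝ 2 P)) (m : ℕ) :
    wienerChaosLE G m ≤ (polynomialSubmodule G m).topologicalClosure := by
  refine iSup₂_le fun k hk => Submodule.topologicalClosure_mono (Submodule.span_le.2 ?_)
  rintro f ⟨ξ, hξ, -, hf⟩
  set H : Polynomial ℝ := (Polynomial.hermite k).map (algebraMap ℤ ℝ) with hH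
  refine ⟨Polynomial.aeval (MvPolynomial.X (⟨ξ, hξ⟩ : G)) H, ?_, ?_⟩
  · rw [Polynomial.aeval_eq_sum_range]
    refine MvPolynomial.totalDegree_finsetSum_le fun j hj => ?_
    refine (MvPolynomial.totalDegree_smul_le _ _).trans ?_
    rw [MvPolynomial.totalDegree_X_pow]
    have h1 : j ≤ H.natDegree := Nat.lt_succ_iff.1 (Finset.mem_range.1 hj)
    have h2 : H.natDegree ≤ k := Polynomial.natDegree_map_le.trans (by simp)
    omega
  · filter_upwards [hf] with ω hω
    rw [hω, ← MvPolynomial.coe_aeval_eq_eval, RingHom.coe_coe, ← Polynomial.aeval_algHom_apply,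
      MvPolynomial.aeval_X, hH, Polynomial.aeval_map_algebraMap]
end

/-- Equivalence of moments on the Wiener chaoses of bounded order. It passes from polynomials to
their `L²` limits by Fatou's lemma along a subsequence that converges almost surely. -/
lemma exists_lintegral_chaos_pow_le (m q : ℕ) (hq : 2 ≤ q) : ∃ C : ℝ, 0 ≤ C ∧
    ∀ {Ω : Type*} [MeasurableSpace Ω] (P : Measure Ω) [IsProbabilityMeasure P]
      (G : Submodule ℝ (Lp ℝ 2 P)), IsGaussianSpace G → ∀ f ∈ wienerChaosLE G m,
        ∫⁻ ω, ‖f ω‖ₑ ^ (2 * q) ∂P ≤ ENNReal.ofReal C * ‖f‖ₑ ^ (2 * q) := by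
  obtain ⟨K, hK, h⟩ := exists_integral_eval_pow_le m q hq
  refine ⟨(K ^ m) ^ q, by positivity, fun {Ω} _ P _ G hG f hf => ?_⟩
  have hcl := wienerChaosLE_le_topologicalClosure G m hf
  obtain ⟨F, hF, hFf⟩ := mem_closure_iff_seq_limit.1 hcl
  obtain ⟨ns, hns, hae⟩ := (tendstoInMeasure_of_tendsto_Lp hFf).exists_seq_tendsto_ae
  have hlim : Filter.Tendsto (fun n => ENNReal.ofReal ((K ^ m) ^ q) * ‖F (ns n)‖ₑ ^ (2 * q))
      Filter.atTop (nhds (ENNReal.ofReal ((K ^ m) ^ q) * ‖f‖ₑ ^ (2 * q))) := by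
    refine ENNReal.Tendsto.const_mul ?_ (Or.inr ENNReal.ofReal_ne_top)
    exact ((ENNReal.continuous_pow (2 * q)).tendsto _).comp
      ((continuous_enorm.tendsto f).comp (hFf.comp hns.tendsto_atTop))
  calc ∫⁻ ω, ‖f ω‖ₑ ^ (2 * q) ∂P
      ≤ ∫⁻ ω, Filter.liminf (fun n => ‖F (ns n) ω‖ₑ ^ (2 * q)) Filter.atTop ∂P := by
        refine lintegral_mono_ae ?_
        filter_upwards [hae] with ω hω
        refine le_of_eq (Filter.Tendsto.liminf_eq ?_).symm
        exact ((ENNReal.continuous_pow (2 * q)).tendsto _).comp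
          ((continuous_enorm.tendsto _).comp hω)
    _ ≤ Filter.liminf (fun n => ∫⁻ ω, ‖F (ns n) ω‖ₑ ^ (2 * q) ∂P) Filter.atTop :=
        lintegral_liminf_le' fun n =>
          ((Lp.aestronglyMeasurable (F (ns n))).enorm).pow_const _
    _ ≤ Filter.liminf (fun n => ENNReal.ofReal ((K ^ m) ^ q) * ‖F (ns n)‖ₑ ^ (2 * q))
          Filter.atTop :=
        Filter.liminf_le_liminf (Filter.Eventually.of_forall fun n =>
          IsPolynomialIn.lintegral_pow_le hG hK h (hF _))
    _ = _ := hlim.liminf_eq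

/-! ### Fourier series of test functions and distributions -/

/-- The `k`th Fourier coefficient `(2π)⁻¹ ∫ f(x) e^{-ikx} dx` of a function on the circle. -/
def circleFourier (f : ℝ → ℂ) (k : ℤ) : ℂ :=
  (2 * Real.pi : ℂ)⁻¹ * ∫ x in (0 : ℝ)..(2 * Real.pi), f x * Complex.exp (-(Complex.I * k * x))

lemma norm_exp_I_mul (k : ℤ) (x : ℝ) : ‖Complex.exp (Complex.I * k * x)‖ = 1 := by
  have : Complex.I * k * x = ((k * x : ℝ) : ℂ) * Complex.I := by push_cast; ring
  rw [this, Complex.norm_exp_ofReal_mul_I]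

lemma norm_exp_neg_I_mul (k : ℤ) (x : ℝ) : ‖Complex.exp (-(Complex.I * k * x))‖ = 1 := by
  have : -(Complex.I * k * x) = ((-(k * x) : ℝ) : ℂ) * Complex.I := by push_cast; ring
  rw [this, Complex.norm_exp_ofReal_mul_I]

lemma norm_circleFourier_le {f : ℝ → ℂ} {M : ℝ} (hf : ∀ x, ‖f x‖ ≤ M) (k : ℤ) :
    ‖circleFourier f k‖ ≤ M := by
  have hpi := Real.two_pi_pos
  have h := intervalIntegral.norm_integral_le_of_norm_le_const (a := 0) (b := 2 * Real.pi) (C := M)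
    (f := fun x : ℝ => f x * Complex.exp (-(Complex.I * k * x))) (fun x _ => by
      rw [norm_mul, norm_exp_neg_I_mul, mul_one]; exact hf x)
  rw [circleFourier, norm_mul, norm_inv]
  have h2 : ‖(2 * Real.pi : ℂ)‖ = 2 * Real.pi := by
    rw [show (2 * Real.pi : ℂ) = ((2 * Real.pi : ℝ) : ℂ) by push_cast; rfl, Complex.norm_real,
      Real.norm_of_nonneg hpi.le]
  rw [h2, inv_mul_le_iff₀ hpi]
  rw [sub_zero, abs_of_pos hpi] at h
  linarith

namespace CircleTest

protected lemma contDiff (φ : CircleTest) : ContDiff ℝ ((⊤ : ℕ∞) : WithTop ℕ∞) (φ : ℝ → ℂ) := φ.2.1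

protected lemma periodic (φ : CircleTest) : Function.Periodic (φ : ℝ → ℂ) (2 * Real.pi) := φ.2.2

/-- The derivative of a test function. -/
protected def deriv (φ : CircleTest) : CircleTest :=
  ⟨_root_.deriv (φ : ℝ → ℂ), by
    refine ⟨(contDiff_infty_iff_deriv.1 (CircleTest.contDiff φ)).2, fun x => ?_⟩
    have := deriv_comp_add_const (φ : ℝ → ℂ) (2 * Real.pi) x
    rw [← this]
    congr 1
    exact funext fun y => (CircleTest.periodic φ) y⟩

lemma coe_iterate_deriv (φ : CircleTest) (j : ℕ) :
    ((CircleTest.deriv^[j] φ : CircleTest) : ℝ → ℂ) = iteratedDeriv j (φ : ℝ → ℂ) := by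
  induction j with
  | zero => simp
  | succ j ih =>
    rw [Function.iterate_succ_apply', iteratedDeriv_succ, ← ih]
    rfl

/-- Integration by parts; the boundary terms cancel by periodicity. -/
lemma circleFourier_deriv (φ : CircleTest) (k : ℤ) :
    circleFourier (CircleTest.deriv φ) k = Complex.I * k * circleFourier φ k := by
  have h1 : ∀ x : ℝ, HasDerivAt (φ : ℝ → ℂ) (((CircleTest.deriv φ) : ℝ → ℂ) x) x := fun x =>
    (((CircleTest.contDiff φ).differentiable (by simp)) x).hasDerivAt
  have h2 : ∀ x : ℝ, HasDerivAt (fun x : ℝ => Complex.exp (-(Complex.I * k * x)))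
      (-(Complex.I * k) * Complex.exp (-(Complex.I * k * x))) x := fun x => by
    have : HasDerivAt (fun x : ℝ => -(Complex.I * k * x)) (-(Complex.I * k)) x := by
      have := ((Complex.ofRealCLM.hasDerivAt (x := x)).const_mul (Complex.I * k)).fun_neg
      simpa using this
    convert! this.cexp using 1
    ring
  have c1 : Continuous ((CircleTest.deriv φ) : ℝ → ℂ) := (CircleTest.contDiff (CircleTest.deriv φ)).continuous
  have := intervalIntegral.integral_deriv_mul_eq_sub (a := 0) (b := 2 * Real.pi)
    (fun x _ => h1 x) (fun x _ => h2 x) (c1.intervalIntegrable _ _)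
    (Continuous.intervalIntegrable (by fun_prop) _ _)
  have e0 : (φ : ℝ → ℂ) (2 * Real.pi) = (φ : ℝ → ℂ) 0 := by simpa using (CircleTest.periodic φ) 0
  have e1 : Complex.exp (-(Complex.I * k * ((2 * Real.pi : ℝ) : ℂ))) = 1 := by
    have : -(Complex.I * k * ((2 * Real.pi : ℝ) : ℂ)) = ((-k : ℤ) : ℂ) * (2 * Real.pi * Complex.I) := by
      push_cast; ring
    rw [this, Complex.exp_int_mul_two_pi_mul_I]
  rw [e0, e1] at this
  have c0 : Continuous (φ : ℝ → ℂ) := (CircleTest.contDiff φ).continuous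
  rw [intervalIntegral.integral_add (Continuous.intervalIntegrable (by fun_prop) _ _)
    (Continuous.intervalIntegrable (by fun_prop) _ _)] at this
  have e2 : ∫ x in (0:ℝ)..(2 * Real.pi), (φ : ℝ → ℂ) x *
      (-(Complex.I * k) * Complex.exp (-(Complex.I * k * x))) = -(Complex.I * k) *
      ∫ x in (0:ℝ)..(2 * Real.pi), (φ : ℝ → ℂ) x * Complex.exp (-(Complex.I * k * x)) := by
    rw [← intervalIntegral.integral_const_mul]
    congr 1; funext x; ring
  rw [e2] at this
  simp only [Complex.ofReal_zero, mul_zero, neg_zero, Complex.exp_zero, sub_self] at this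
  rw [circleFourier, circleFourier]
  linear_combination (2 * Real.pi : ℂ)⁻¹ * this

lemma circleFourier_iteratedDeriv (φ : CircleTest) (j : ℕ) (k : ℤ) :
    circleFourier (iteratedDeriv j (φ : ℝ → ℂ)) k = (Complex.I * k) ^ j * circleFourier φ k := by
  rw [← coe_iterate_deriv]
  induction j with
  | zero => simp
  | succ j ih => rw [Function.iterate_succ_apply', circleFourier_deriv, ih]; ring

lemma abs_pow_mul_norm_circleFourier_le (φ : CircleTest) {j : ℕ} {M : ℝ}
    (h : ∀ x, ‖iteratedDeriv j (φ : ℝ → ℂ) x‖ ≤ M) (k : ℤ) :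
    |(k : ℝ)| ^ j * ‖circleFourier φ k‖ ≤ M := by
  have := norm_circleFourier_le h k
  rw [circleFourier_iteratedDeriv, norm_mul, norm_pow, norm_mul, Complex.norm_I, one_mul,
    Complex.norm_intCast] at this
  exact this

lemma exists_bound_iteratedDeriv (φ : CircleTest) (j : ℕ) :
    ∃ M, ∀ x, ‖iteratedDeriv j (φ : ℝ → ℂ) x‖ ≤ M := by
  rw [← coe_iterate_deriv]
  set f := CircleTest.deriv^[j] φ
  obtain ⟨M, hM⟩ := (isCompact_Icc (a := (0:ℝ)) (b := 2 * Real.pi)).exists_bound_of_continuousOn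
    (CircleTest.contDiff f).continuous.continuousOn
  refine ⟨M, fun x => ?_⟩
  obtain ⟨y, hy, hxy⟩ := (CircleTest.periodic f).exists_mem_Ico₀ Real.two_pi_pos x
  rw [hxy]; exact hM y ⟨hy.1, hy.2.le⟩

/-- Rapid decay of the Fourier coefficients of a test function. -/
lemma one_add_abs_pow_mul_norm_circleFourier_le (φ : CircleTest) {L : ℕ} {M : ℝ}
    (h : ∀ j ≤ L, ∀ x, ‖iteratedDeriv j (φ : ℝ → ℂ) x‖ ≤ M) (k : ℤ) :
    (1 + |(k : ℝ)|) ^ L * ‖circleFourier φ k‖ ≤ 2 ^ L * M := by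
  rcases le_total |(k : ℝ)| 1 with hk | hk
  · have h0 := abs_pow_mul_norm_circleFourier_le φ (h 0 (Nat.zero_le _)) k
    rw [pow_zero, one_mul] at h0
    calc _ ≤ 2 ^ L * ‖circleFourier φ k‖ := by gcongr; linarith
      _ ≤ _ := by gcongr
  · have h0 := abs_pow_mul_norm_circleFourier_le φ (h L le_rfl) k
    calc _ ≤ (2 * |(k:ℝ)|) ^ L * ‖circleFourier φ k‖ := by gcongr; linarith
      _ = 2 ^ L * (|(k:ℝ)| ^ L * ‖circleFourier φ k‖) := by rw [mul_pow]; ring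
      _ ≤ _ := by gcongr

lemma summable_one_add_abs_inv_sq : Summable fun k : ℤ => ((1 + |(k : ℝ)|) ^ 2)⁻¹ := by
  have h1 : Summable fun k : ℤ => 1 / |(k : ℝ)| ^ 2 := by
    simpa using Real.summable_one_div_int_pow.2 (by norm_num : 1 < 2)
  have h2 : Summable fun k : ℤ => if k = 0 then (1:ℝ) else 0 :=
    summable_of_ne_finset_zero (s := {0}) fun k hk => if_neg (by simpa using hk)
  refine Summable.of_nonneg_of_le (fun k => by positivity) (fun k => ?_) (h1.add h2)
  by_cases hk : k = 0
  · simp [hk]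
  · have : 0 < |(k:ℝ)| := by positivity
    rw [if_neg hk, add_zero, one_div]
    gcongr
    linarith

lemma summable_one_add_abs_pow_mul_norm_circleFourier (φ : CircleTest) (L : ℕ) :
    Summable fun k : ℤ => (1 + |(k : ℝ)|) ^ L * ‖circleFourier φ k‖ := by
  choose B hB using (CircleTest.exists_bound_iteratedDeriv φ)
  set M := ∑ j ∈ Finset.range (L + 3), |B j| with hM
  have h : ∀ j ≤ L + 2, ∀ x, ‖iteratedDeriv j (φ : ℝ → ℂ) x‖ ≤ M := fun j hj x =>
    (hB j x).trans ((le_abs_self _).trans (Finset.single_le_sum (f := fun j => |B j|)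
      (fun j _ => abs_nonneg _) (Finset.mem_range.2 (by omega))))
  refine Summable.of_nonneg_of_le (fun k => by positivity) (fun k => ?_)
    (summable_one_add_abs_inv_sq.mul_left (2 ^ (L + 2) * M))
  have := (CircleTest.one_add_abs_pow_mul_norm_circleFourier_le φ) h k
  rw [pow_add] at this
  have hp : 0 < (1 + |(k:ℝ)|) ^ 2 := by positivity
  rw [← div_eq_mul_inv, le_div_iff₀ hp]
  linarith

lemma summable_circleFourier (φ : CircleTest) : Summable (circleFourier φ) :=
  Summable.of_norm (by simpa using (CircleTest.summable_one_add_abs_pow_mul_norm_circleFourier φ) 0)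

end CircleTest

/-- A continuous function on the circle with summable Fourier coefficients is the sum of its
Fourier series. -/
lemma hasSum_circleFourier {f : ℝ → ℂ} (hc : Continuous f)
    (hp : Function.Periodic f (2 * Real.pi)) (hs : Summable (circleFourier f)) (x : ℝ) :
    HasSum (fun k : ℤ => circleFourier f k * Complex.exp (Complex.I * k * x)) (f x) := by
  have : Fact (0 < 2 * Real.pi) := ⟨Real.two_pi_pos⟩
  set F : C(AddCircle (2 * Real.pi), ℂ) :=
    ⟨hp.lift, continuous_coinduced_dom.mpr hc⟩ with hF
  have hcoe : ∀ y : ℝ, F (y : AddCircle (2 * Real.pi)) = f y := fun y => hp.lift_coe y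
  have hcoeff : ∀ k, fourierCoeff F k = circleFourier f k := by
    intro k
    rw [fourierCoeff_eq_intervalIntegral _ _ 0, circleFourier, zero_add]
    simp only [hcoe, smul_eq_mul, fourier_coe_apply]
    rw [Complex.real_smul]
    congr 1
    · push_cast; simp
    · congr 1; funext y
      rw [mul_comm]
      congr 2
      have : (Real.pi : ℂ) ≠ 0 := by exact_mod_cast Real.pi_ne_zero
      push_cast; field_simp
  have := has_pointwise_sum_fourier_series_of_summable (f := F) (by
    simpa only [funext hcoeff] using hs) (x : AddCircle (2 * Real.pi))
  rw [hcoe] at this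
  convert! this using 1
  funext k
  rw [hcoeff, fourier_coe_apply]
  simp only [smul_eq_mul]
  congr 2
  have : (Real.pi : ℂ) ≠ 0 := by exact_mod_cast Real.pi_ne_zero
  push_cast; field_simp

lemma eq_of_circleFourier_eq {f g : ℝ → ℂ} (hf : Continuous f) (hg : Continuous g)
    (hfp : Function.Periodic f (2 * Real.pi)) (hgp : Function.Periodic g (2 * Real.pi))
    (h : ∀ k, circleFourier f k = circleFourier g k) : f = g := by
  have hz : circleFourier (fun x => f x - g x) = fun _ => 0 := by
    funext k
    have := h k
    simp only [circleFourier, sub_mul] at this ⊢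
    rw [intervalIntegral.integral_sub (Continuous.intervalIntegrable (by fun_prop) _ _)
      (Continuous.intervalIntegrable (by fun_prop) _ _), mul_sub, this, sub_self]
  funext x
  have hs := hasSum_circleFourier (hf.sub hg) (hfp.sub hgp) (by
    change Summable (circleFourier fun x => f x - g x)
    rw [hz]; exact summable_zero) x
  change HasSum (fun k => circleFourier (fun x => f x - g x) k * _) _ at hs
  simp only [hz, zero_mul] at hs
  exact sub_eq_zero.1 (hs.unique hasSum_zero)

namespace CircleDistribution

lemma iteratedDeriv_expTest (k : ℤ) (j : ℕ) (x : ℝ) :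
    iteratedDeriv j (expTest k : ℝ → ℂ) x = (Complex.I * k) ^ j * Complex.exp (Complex.I * k * x) := by
  induction j generalizing x with
  | zero => simp [expTest]
  | succ j ih =>
    rw [iteratedDeriv_succ]
    have : iteratedDeriv j (expTest k : ℝ → ℂ) =
      fun x : ℝ => (Complex.I * k) ^ j * Complex.exp (Complex.I * k * x) := funext ih
    rw [this]
    have h : HasDerivAt (fun x : ℝ => (Complex.I * k * x : ℂ)) (Complex.I * k) x := by
      simpa using (Complex.ofRealCLM.hasDerivAt (x := x)).const_mul (Complex.I * k)
    rw [(h.cexp.const_mul _).deriv]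
    ring

/-- Fourier expansion of the pairing of a distribution with a test function. -/
lemma hasSum_toLin (u : CircleDistribution) (φ : CircleTest) :
    HasSum (fun k : ℤ => circleFourier φ k * u.toLin (expTest k)) (u.toLin φ) := by
  obtain ⟨N, K, hK⟩ := u.bounded
  set a : ℤ → ℝ := fun k => (1 + |(k : ℝ)|) ^ N * ‖circleFourier φ k‖ with ha
  have hsum : Summable a := (CircleTest.summable_one_add_abs_pow_mul_norm_circleFourier φ) N
  rw [HasSum, SummationFilter.unconditional_filter, tendsto_iff_norm_sub_tendsto_zero]
  have hbound : ∀ s : Finset ℤ,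
      ‖∑ k ∈ s, circleFourier φ k * u.toLin (expTest k) - u.toLin φ‖ ≤
        K * ∑' k : {k // k ∉ s}, a k := by
    intro s
    set r : CircleTest := ∑ k ∈ s, circleFourier φ k • expTest k - φ with hr
    have e : ∑ k ∈ s, circleFourier φ k * u.toLin (expTest k) - u.toLin φ = u.toLin r := by
      rw [hr, map_sub, map_sum]; simp
    rw [e]
    refine hK r _ fun j hj x => ?_
    have hder : iteratedDeriv j (r : ℝ → ℂ) x = ∑ k ∈ s, circleFourier φ k *
        ((Complex.I * k) ^ j * Complex.exp (Complex.I * k * x)) - iteratedDeriv j (φ : ℝ → ℂ) x := by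
      have : (r : ℝ → ℂ) = (∑ k ∈ s, circleFourier φ k • (expTest k : ℝ → ℂ)) - (φ : ℝ → ℂ) := by
        rw [hr]; simp
      have cd : ∀ ψ : CircleTest, ContDiffAt ℝ j (ψ : ℝ → ℂ) x := fun ψ =>
        ((CircleTest.contDiff ψ).of_le (by exact_mod_cast le_top)).contDiffAt
      have cds : ∀ k ∈ s, ContDiffAt ℝ j (circleFourier φ k • (expTest k : ℝ → ℂ)) x := fun k _ =>
        contDiffAt_const.smul (cd _)
      rw [this, iteratedDeriv_sub _ (cd φ), iteratedDeriv_sum cds]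
      · congr 1
        refine Finset.sum_congr rfl fun k _ => ?_
        rw [iteratedDeriv_const_smul_field, iteratedDeriv_expTest, smul_eq_mul]
      · have := ContDiffAt.sum (n := (j : WithTop ℕ∞)) (s := s) (x := x) cds
        convert! this using 1
        ext y; simp
    have hS : HasSum (fun k : ℤ => circleFourier φ k *
        ((Complex.I * k) ^ j * Complex.exp (Complex.I * k * x))) (iteratedDeriv j (φ : ℝ → ℂ) x) := by
      have := hasSum_circleFourier (CircleTest.contDiff (CircleTest.deriv^[j] φ)).continuous
        (CircleTest.periodic (CircleTest.deriv^[j] φ)) (CircleTest.summable_circleFourier _) x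
      rw [CircleTest.coe_iterate_deriv] at this
      convert! this using 1
      funext k
      rw [CircleTest.circleFourier_iteratedDeriv]; ring
    rw [hder, ← norm_neg, neg_sub, ← hS.tsum_eq, ← hS.summable.sum_add_tsum_subtype_compl s,
      add_sub_cancel_left]
    refine tsum_of_norm_bounded (hsum.subtype _).hasSum fun k => ?_
    rw [norm_mul, norm_mul, norm_exp_I_mul, mul_one, norm_pow, norm_mul, Complex.norm_I, one_mul,
      Complex.norm_intCast, mul_comm]
    simp only [ha, Function.comp]
    gcongr
    calc |((k : ℤ) : ℝ)| ^ j ≤ (1 + |((k : ℤ) : ℝ)|) ^ j := by gcongr; linarith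
      _ ≤ _ := pow_le_pow_right₀ (by linarith [abs_nonneg ((k : ℤ) : ℝ)]) hj
  refine squeeze_zero (fun s => norm_nonneg _) hbound ?_
  simpa using (tendsto_tsum_compl_atTop_zero a).const_mul K

lemma sqrt_two_pi_ne_zero : ((Real.sqrt (2 * Real.pi) : ℝ) : ℂ) ≠ 0 := by
  have : 0 < Real.sqrt (2 * Real.pi) := Real.sqrt_pos.2 Real.two_pi_pos
  exact_mod_cast this.ne'

lemma toLin_expTest (u : CircleDistribution) (k : ℤ) :
    u.toLin (expTest k) = ((Real.sqrt (2 * Real.pi) : ℝ) : ℂ) * u.coeff (-k) := by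
  rw [coeff, neg_neg, mul_inv_cancel_left₀ sqrt_two_pi_ne_zero]

/-- A distribution is determined by its Fourier coefficients. -/
lemma ext_of_coeff {u v : CircleDistribution} (h : ∀ k, u.coeff k = v.coeff k) : u = v := by
  have : u.toLin = v.toLin := by
    refine LinearMap.ext fun φ => ?_
    refine (u.hasSum_toLin φ).unique ?_
    simp only [toLin_expTest, h]
    simpa only [toLin_expTest] using v.hasSum_toLin φ
  cases u; cases v; cases this; rfl

end CircleDistribution

lemma continuous_exp_I_mul (k : ℤ) : Continuous fun x : ℝ => Complex.exp (Complex.I * k * x) := by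
  fun_prop

lemma circleFourier_const_mul (c : ℂ) (f : ℝ → ℂ) (k : ℤ) :
    circleFourier (fun x => c * f x) k = c * circleFourier f k := by
  simp only [circleFourier, mul_assoc]
  rw [intervalIntegral.integral_const_mul]
  ring

lemma circleFourier_sum {ι : Type*} (s : Finset ι) {f : ι → ℝ → ℂ} (hf : ∀ i, Continuous (f i))
    (k : ℤ) : circleFourier (fun x => ∑ i ∈ s, f i x) k = ∑ i ∈ s, circleFourier (f i) k := by
  simp only [circleFourier, Finset.sum_mul, ← Finset.mul_sum]
  rw [intervalIntegral.integral_finsetSum fun i _ =>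
    Continuous.intervalIntegrable (by have := hf i; fun_prop) _ _]

lemma circleFourier_sub {f g : ℝ → ℂ} (hf : Continuous f) (hg : Continuous g) (k : ℤ) :
    circleFourier (fun x => f x - g x) k = circleFourier f k - circleFourier g k := by
  simp only [circleFourier, sub_mul]
  rw [intervalIntegral.integral_sub (Continuous.intervalIntegrable (by fun_prop) _ _)
      (Continuous.intervalIntegrable (by fun_prop) _ _), mul_sub]

lemma circleFourier_exp (n k : ℤ) :
    circleFourier (fun x : ℝ => Complex.exp (Complex.I * n * x)) k = if n = k then 1 else 0 := by
  have hpi : (2 * Real.pi : ℂ) ≠ 0 := by exact_mod_cast Real.two_pi_pos.ne'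
  simp only [circleFourier, ← Complex.exp_add]
  split_ifs with h
  · subst h
    simp only [add_neg_cancel, Complex.exp_zero, intervalIntegral.integral_const, sub_zero]
    rw [Complex.real_smul, mul_one]
    push_cast
    exact inv_mul_cancel₀ hpi
  · have hc : Complex.I * ((n - k : ℤ) : ℂ) ≠ 0 :=
      mul_ne_zero Complex.I_ne_zero (by exact_mod_cast sub_ne_zero.2 h)
    have e : ∀ x : ℝ, Complex.I * n * x + -(Complex.I * k * x) = Complex.I * ((n - k : ℤ) : ℂ) * x :=
      fun x => by push_cast; ring
    simp only [e]
    rw [integral_exp_mul_complex hc]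
    have : Complex.I * ((n - k : ℤ) : ℂ) * ((2 * Real.pi : ℝ) : ℂ)
        = ((n - k : ℤ) : ℂ) * (2 * Real.pi * Complex.I) := by push_cast; ring
    rw [this, Complex.exp_int_mul_two_pi_mul_I]
    simp

/-! ### Bernstein's inequality and the maximum over a grid -/

/-- Trigonometric polynomials of degree at most `N`. -/
def IsTrigPoly (N : ℕ) (f : ℝ → ℂ) : Prop :=
  ∃ c : ℤ → ℂ, ∀ x : ℝ, f x = ∑ k ∈ Finset.Icc (-(N : ℤ)) N, c k * Complex.exp (Complex.I * k * x)

/-- The kernel `F_N(t) (e^{iNt} - e^{-iNt})`, with `F_N` the Fejér kernel: its Fourier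
coefficients are `k / N` for `|k| ≤ N`, so that convolution with it is `(iN)⁻¹ d/dx` on the
trigonometric polynomials of degree at most `N`. -/
def bernsteinKernel (N : ℕ) (t : ℝ) : ℂ :=
  (N : ℂ)⁻¹ * ((∑ j ∈ Finset.range N, ∑ l ∈ Finset.range N,
    Complex.exp (Complex.I * ((j - l + N : ℤ) : ℂ) * t)) -
    ∑ j ∈ Finset.range N, ∑ l ∈ Finset.range N,
    Complex.exp (Complex.I * ((j - l - N : ℤ) : ℂ) * t))

/-- The number of pairs `(j, l)` with `j, l < N` and `j - l = k - N` is `k`, for `0 ≤ k ≤ N`. -/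
lemma sum_range_sum_range_ite {N : ℕ} (k : ℕ) (hk : k ≤ N) :
    ∑ j ∈ Finset.range N, ∑ l ∈ Finset.range N,
      (if (j - l + N : ℤ) = (k : ℤ) then (1 : ℂ) else 0) = k := by
  have h1 : ∀ j ∈ Finset.range N, ∑ l ∈ Finset.range N,
      (if (j - l + N : ℤ) = (k : ℤ) then (1 : ℂ) else 0) = if j < k then 1 else 0 := by
    intro j hj
    have hj := Finset.mem_range.1 hj
    split_ifs with h
    · rw [Finset.sum_eq_single (j + N - k)]
      · rw [if_pos (by omega)]
      · intro l hl hne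
        rw [if_neg (by omega)]
      · intro hl
        exact absurd (Finset.mem_range.2 (by omega)) hl
    · refine Finset.sum_eq_zero fun l hl => if_neg ?_
      have := Finset.mem_range.1 hl
      omega
  rw [Finset.sum_congr rfl h1, Finset.sum_ite, Finset.sum_const_zero, add_zero]
  have : (Finset.range N).filter (· < k) = Finset.range k := by
    ext j; simp only [Finset.mem_filter, Finset.mem_range]; omega
  rw [this]; simp

lemma sum_range_sum_range_ite_neg {N : ℕ} (k : ℕ) :
    ∑ j ∈ Finset.range N, ∑ l ∈ Finset.range N,
      (if (j - l + N : ℤ) = -(k : ℤ) then (1 : ℂ) else 0) = 0 := by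
  refine Finset.sum_eq_zero fun j hj => Finset.sum_eq_zero fun l hl => if_neg ?_
  have := Finset.mem_range.1 hl
  omega

lemma circleFourier_bernsteinKernel {N : ℕ} {k : ℤ} (hk : k ∈ Finset.Icc (-(N : ℤ)) N) :
    circleFourier (bernsteinKernel N) k = (N : ℂ)⁻¹ * k := by
  obtain ⟨h1, h2⟩ := Finset.mem_Icc.1 hk
  have hswap : ∑ j ∈ Finset.range N, ∑ l ∈ Finset.range N,
      (if (j - l - N : ℤ) = k then (1 : ℂ) else 0) =
      ∑ j ∈ Finset.range N, ∑ l ∈ Finset.range N,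
      (if (j - l + N : ℤ) = -k then (1 : ℂ) else 0) := by
    rw [Finset.sum_comm]
    refine Finset.sum_congr rfl fun j _ => Finset.sum_congr rfl fun l _ => ?_
    congr 1
    simp only [eq_iff_iff]
    omega
  have hF : circleFourier (bernsteinKernel N) k = (N : ℂ)⁻¹ *
      ((∑ j ∈ Finset.range N, ∑ l ∈ Finset.range N,
      (if (j - l + N : ℤ) = k then (1 : ℂ) else 0)) - ∑ j ∈ Finset.range N, ∑ l ∈ Finset.range N,
      (if (j - l - N : ℤ) = k then (1 : ℂ) else 0)) := by
    have e : bernsteinKernel N = fun t => _ := funext fun t => rfl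
    rw [e]
    simp only [bernsteinKernel]
    have c : ∀ n : ℤ, Continuous fun x : ℝ => Complex.exp (Complex.I * n * x) :=
      continuous_exp_I_mul
    rw [circleFourier_const_mul, circleFourier_sub
      (continuous_finsetSum _ fun j _ => continuous_finsetSum _ fun l _ => c _)
      (continuous_finsetSum _ fun j _ => continuous_finsetSum _ fun l _ => c _),
      circleFourier_sum _ fun j => continuous_finsetSum _ fun l _ => c _,
      circleFourier_sum _ fun j => continuous_finsetSum _ fun l _ => c _]
    simp only [circleFourier_sum _ fun l => c _, circleFourier_exp]
  rw [hF, hswap]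
  rcases Int.eq_nat_or_neg k with ⟨n, rfl | rfl⟩
  · rw [sum_range_sum_range_ite n (by omega), sum_range_sum_range_ite_neg]
    simp
  · rw [neg_neg, sum_range_sum_range_ite n (by omega), sum_range_sum_range_ite_neg]
    simp

/-- The sum `∑_{j < N} e^{ijt}`, whose squared modulus is `N` times the Fejér kernel. -/
def expSum (N : ℕ) (t : ℝ) : ℂ := ∑ j ∈ Finset.range N, Complex.exp (Complex.I * (j : ℤ) * t)

lemma expSum_mul_conj (N : ℕ) (t : ℝ) :
    ((‖expSum N t‖ ^ 2 : ℝ) : ℂ) = ∑ j ∈ Finset.range N, ∑ l ∈ Finset.range N,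
      Complex.exp (Complex.I * ((j - l : ℤ) : ℂ) * t) := by
  rw [← Complex.normSq_eq_norm_sq, ← Complex.mul_conj, expSum, map_sum, Finset.sum_mul_sum]
  refine Finset.sum_congr rfl fun j _ => Finset.sum_congr rfl fun l _ => ?_
  rw [← Complex.exp_conj, ← Complex.exp_add]
  congr 1
  simp only [map_mul, Complex.conj_I, Complex.conj_ofReal, map_intCast]
  push_cast; ring

lemma continuous_expSum (N : ℕ) : Continuous (expSum N) := by
  unfold expSum; fun_prop

lemma integral_norm_expSum_sq (N : ℕ) :
    ∫ t in (0 : ℝ)..(2 * Real.pi), ‖expSum N t‖ ^ 2 = 2 * Real.pi * N := by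
  have h : circleFourier (fun t => ((‖expSum N t‖ ^ 2 : ℝ) : ℂ)) 0 = N := by
    simp only [expSum_mul_conj]
    have c : ∀ n : ℤ, Continuous fun x : ℝ => Complex.exp (Complex.I * n * x) :=
      continuous_exp_I_mul
    rw [circleFourier_sum _ fun j => continuous_finsetSum _ fun l _ => c _]
    simp only [circleFourier_sum _ fun l => c _, circleFourier_exp, sub_eq_zero, Nat.cast_inj]
    simp only [Finset.sum_ite_eq, Finset.sum_ite_mem, Finset.inter_self]
    simp
  simp only [circleFourier, Int.cast_zero, mul_zero, zero_mul, neg_zero, Complex.exp_zero,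
    mul_one] at h
  rw [intervalIntegral.integral_ofReal] at h
  have hpi : (2 * Real.pi : ℂ) ≠ 0 := by exact_mod_cast Real.two_pi_pos.ne'
  rw [inv_mul_eq_iff_eq_mul₀ hpi] at h
  exact_mod_cast h

lemma norm_bernsteinKernel_le {N : ℕ} (t : ℝ) :
    ‖bernsteinKernel N t‖ ≤ (N : ℝ)⁻¹ * (2 * ‖expSum N t‖ ^ 2) := by
  have e1 : ∀ s : ℤ, ∑ j ∈ Finset.range N, ∑ l ∈ Finset.range N,
      Complex.exp (Complex.I * ((j - l + s : ℤ) : ℂ) * t) =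
      ((‖expSum N t‖ ^ 2 : ℝ) : ℂ) * Complex.exp (Complex.I * (s : ℂ) * t) := by
    intro s
    rw [expSum_mul_conj, Finset.sum_mul]
    refine Finset.sum_congr rfl fun j _ => ?_
    rw [Finset.sum_mul]
    refine Finset.sum_congr rfl fun l _ => ?_
    rw [← Complex.exp_add]
    congr 1; push_cast; ring
  rw [bernsteinKernel, norm_mul, norm_inv, Complex.norm_natCast]
  refine mul_le_mul_of_nonneg_left ?_ (by positivity)
  refine (norm_sub_le _ _).trans ?_
  simp only [sub_eq_add_neg _ (N : ℤ)]
  have hs : ∀ s : ℤ, ‖∑ j ∈ Finset.range N, ∑ l ∈ Finset.range N,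
      Complex.exp (Complex.I * ((j - l + s : ℤ) : ℂ) * t)‖ = ‖expSum N t‖ ^ 2 := fun s => by
    rw [e1, norm_mul, norm_exp_I_mul, mul_one, Complex.norm_real, Real.norm_of_nonneg (by positivity)]
  rw [hs, hs]
  linarith

lemma continuous_bernsteinKernel (N : ℕ) : Continuous (bernsteinKernel N) := by
  unfold bernsteinKernel; fun_prop

/-- **Bernstein's inequality**, up to a factor `2`: the derivative is a convolution with
`iN * bernsteinKernel N`, and the kernel has `L¹` norm at most `2` because the Fejér kernel is
positive with mean one. -/
lemma norm_sum_mul_exp_le {N : ℕ} (hN : 0 < N) {c : ℤ → ℂ} {M : ℝ}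
    (h : ∀ x : ℝ, ‖∑ k ∈ Finset.Icc (-(N : ℤ)) N, c k * Complex.exp (Complex.I * k * x)‖ ≤ M)
    (x : ℝ) :
    ‖∑ k ∈ Finset.Icc (-(N : ℤ)) N, c k * (Complex.I * k * Complex.exp (Complex.I * k * x))‖
      ≤ 2 * N * M := by
  have hN0 : (N : ℂ) ≠ 0 := by exact_mod_cast hN.ne'
  have hN1 : (0 : ℝ) < N := by exact_mod_cast hN
  set f : ℝ → ℂ := fun x => ∑ k ∈ Finset.Icc (-(N : ℤ)) N, c k * Complex.exp (Complex.I * k * x) with hf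
  have hfc : Continuous f := by simp only [hf]; fun_prop
  have hconv : ∑ k ∈ Finset.Icc (-(N : ℤ)) N, c k * (Complex.I * k * Complex.exp (Complex.I * k * x))
      = Complex.I * N * ((2 * Real.pi : ℂ)⁻¹ *
        ∫ t in (0 : ℝ)..(2 * Real.pi), f (x - t) * bernsteinKernel N t) := by
    have e : ∀ t : ℝ, f (x - t) * bernsteinKernel N t = ∑ k ∈ Finset.Icc (-(N : ℤ)) N,
        (c k * Complex.exp (Complex.I * k * x)) *
          (bernsteinKernel N t * Complex.exp (-(Complex.I * k * t))) := by
      intro t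
      simp only [hf, Finset.sum_mul]
      refine Finset.sum_congr rfl fun k _ => ?_
      have : Complex.I * k * ((x - t : ℝ) : ℂ) = Complex.I * k * x + -(Complex.I * k * t) := by
        push_cast; ring
      rw [this, Complex.exp_add]; ring
    have cB := continuous_bernsteinKernel N
    simp only [e]
    rw [intervalIntegral.integral_finsetSum fun i _ =>
      Continuous.intervalIntegrable (by fun_prop) _ _]
    simp only [intervalIntegral.integral_const_mul, Finset.mul_sum]
    refine Finset.sum_congr rfl fun k hk => ?_
    have := circleFourier_bernsteinKernel hk
    rw [circleFourier] at this
    have h2 : Complex.I * N * ((2 * Real.pi : ℂ)⁻¹ * (c k * Complex.exp (Complex.I * k * x) *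
      ∫ t in (0 : ℝ)..(2 * Real.pi), bernsteinKernel N t * Complex.exp (-(Complex.I * k * t))))
      = Complex.I * N * (c k * Complex.exp (Complex.I * k * x)) * ((2 * Real.pi : ℂ)⁻¹ *
      ∫ t in (0 : ℝ)..(2 * Real.pi), bernsteinKernel N t * Complex.exp (-(Complex.I * k * t))) := by
      ring
    rw [h2, this]
    field_simp
  have hM : 0 ≤ M := (norm_nonneg _).trans (h 0)
  have hint : ‖∫ t in (0 : ℝ)..(2 * Real.pi), f (x - t) * bernsteinKernel N t‖ ≤
      M * (2 * (2 * Real.pi)) := by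
    have cE := continuous_expSum N
    have hb : ∀ t ∈ Set.Ioc (0:ℝ) (2 * Real.pi), ‖f (x - t) * bernsteinKernel N t‖ ≤
        M * ((N : ℝ)⁻¹ * (2 * ‖expSum N t‖ ^ 2)) := fun t _ => by
      rw [norm_mul]
      exact mul_le_mul (h _) (norm_bernsteinKernel_le t) (norm_nonneg _) hM
    refine (intervalIntegral.norm_integral_le_of_norm_le Real.two_pi_pos.le
      (ae_of_all _ fun t ht => hb t ht)
      (Continuous.intervalIntegrable (by fun_prop) _ _)).trans (le_of_eq ?_)
    rw [intervalIntegral.integral_const_mul, intervalIntegral.integral_const_mul,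
      intervalIntegral.integral_const_mul, integral_norm_expSum_sq]
    field_simp
  rw [hconv, norm_mul, norm_mul, norm_mul, norm_inv, Complex.norm_I, one_mul, Complex.norm_natCast]
  have h2 : ‖(2 * Real.pi : ℂ)‖ = 2 * Real.pi := by
    rw [show (2 * Real.pi : ℂ) = ((2 * Real.pi : ℝ) : ℂ) by push_cast; rfl, Complex.norm_real,
      Real.norm_of_nonneg Real.two_pi_pos.le]
  rw [h2]
  have hpi := Real.two_pi_pos
  calc (N : ℝ) * ((2 * Real.pi)⁻¹ * _) ≤ N * ((2 * Real.pi)⁻¹ * (M * (2 * (2 * Real.pi)))) := by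
        gcongr
    _ = _ := by field_simp

namespace IsTrigPoly

lemma sub {N : ℕ} {f g : ℝ → ℂ} (hf : IsTrigPoly N f) (hg : IsTrigPoly N g) :
    IsTrigPoly N (fun x => f x - g x) := by
  obtain ⟨c, hc⟩ := hf
  obtain ⟨d, hd⟩ := hg
  exact ⟨fun k => c k - d k, fun x => by simp only [hc, hd, sub_mul, Finset.sum_sub_distrib]⟩

lemma continuous {N : ℕ} {f : ℝ → ℂ} (hf : IsTrigPoly N f) : Continuous f := by
  obtain ⟨c, hc⟩ := hf
  rw [funext hc]; fun_prop

lemma periodic {N : ℕ} {f : ℝ → ℂ} (hf : IsTrigPoly N f) : Function.Periodic f (2 * Real.pi) := by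
  obtain ⟨c, hc⟩ := hf
  intro x
  rw [hc, hc]
  refine Finset.sum_congr rfl fun k _ => ?_
  congr 1
  exact CircleTest.periodic (CircleDistribution.expTest k) x

lemma supNorm_ne_top {N : ℕ} {f : ℝ → ℂ} (hf : IsTrigPoly N f) :
    CircleDistribution.supNorm f ≠ ⊤ := by
  obtain ⟨c, hc⟩ := hf
  refine ne_top_of_le_ne_top (b := ENNReal.ofReal (∑ k ∈ Finset.Icc (-(N : ℤ)) N, ‖c k‖))
    ENNReal.ofReal_ne_top (iSup_le fun x => ?_)
  rw [← ofReal_norm]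
  refine ENNReal.ofReal_le_ofReal ?_
  rw [hc]
  refine (norm_sum_le _ _).trans (Finset.sum_le_sum fun k _ => ?_)
  rw [norm_mul, norm_exp_I_mul, mul_one]

lemma norm_le {N : ℕ} {f : ℝ → ℂ} (hf : IsTrigPoly N f) (x : ℝ) :
    ‖f x‖ ≤ (CircleDistribution.supNorm f).toReal := by
  rw [← toReal_enorm]
  exact ENNReal.toReal_mono hf.supNorm_ne_top (le_iSup (fun x => ‖f x‖ₑ) x)

lemma norm_sub_le {N : ℕ} (hN : 0 < N) {f : ℝ → ℂ} (hf : IsTrigPoly N f) (x y : ℝ) :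
    ‖f x - f y‖ ≤ 2 * N * (CircleDistribution.supNorm f).toReal * |x - y| := by
  obtain ⟨c, hc⟩ := hf
  have hf : IsTrigPoly N f := ⟨c, hc⟩
  have hd : ∀ x : ℝ, HasDerivAt f (∑ k ∈ Finset.Icc (-(N : ℤ)) N,
      c k * (Complex.I * k * Complex.exp (Complex.I * k * x))) x := by
    intro x
    have e : f = fun x : ℝ => ∑ k ∈ Finset.Icc (-(N : ℤ)) N, c k * Complex.exp (Complex.I * k * x) :=
      funext hc
    rw [e]
    refine HasDerivAt.fun_sum fun k _ => ?_
    have h : HasDerivAt (fun x : ℝ => (Complex.I * k * x : ℂ)) (Complex.I * k) x := by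
      simpa using (Complex.ofRealCLM.hasDerivAt (x := x)).const_mul (Complex.I * k)
    convert! h.cexp.const_mul (c k) using 1
    ring
  have hb := fun x => norm_sum_mul_exp_le hN (c := c) (fun x => by rw [← hc]; exact hf.norm_le x) x
  have := Convex.norm_image_sub_le_of_norm_hasDerivWithin_le (s := Set.univ) (x := y) (y := x)
    (fun x _ => (hd x).hasDerivWithinAt) (fun x _ => hb x) convex_univ trivial trivial
  rwa [Real.norm_eq_abs] at this

/-- The supremum of a trigonometric polynomial of degree `N` is controlled by its values on a
grid of `32 N` points. The `ℓ^p` sum replaces the maximum over the grid; it is what the moments of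
order `p` control. -/
lemma supNorm_le_grid {N : ℕ} (hN : 0 < N) {f : ℝ → ℂ} (hf : IsTrigPoly N f) {p : ℕ} (hp : p ≠ 0) :
    CircleDistribution.supNorm f ≤ 2 * (∑ i ∈ Finset.range (32 * N),
      ‖f (2 * Real.pi * i / (32 * N))‖ₑ ^ p) ^ (1 / (p : ℝ)) := by
  set M := (CircleDistribution.supNorm f).toReal with hM
  set R : ℝ≥0∞ := (∑ i ∈ Finset.range (32 * N),
      ‖f (2 * Real.pi * i / (32 * N))‖ₑ ^ p) ^ (1 / (p : ℝ)) with hR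
  have hp0 : (0:ℝ) < p := by positivity
  have hN0 : (0 : ℝ) < N := by exact_mod_cast hN
  have hRtop : R ≠ ⊤ := by
    refine ENNReal.rpow_ne_top_of_nonneg (by positivity) ?_
    exact ENNReal.sum_ne_top.2 fun i _ => ENNReal.pow_ne_top enorm_ne_top
  have hgrid : ∀ i ∈ Finset.range (32 * N), ‖f (2 * Real.pi * i / (32 * N))‖ ≤ R.toReal := by
    intro i hi
    rw [← toReal_enorm]
    refine ENNReal.toReal_mono hRtop ?_
    rw [hR, one_div, ENNReal.le_rpow_inv_iff hp0, ENNReal.rpow_natCast]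
    exact Finset.single_le_sum (f := fun i : ℕ => ‖f (2 * Real.pi * i / (32 * N))‖ₑ ^ p)
      (fun _ _ => zero_le) hi
  have hx : ∀ x, ‖f x‖ ≤ R.toReal + M / 2 := by
    intro x
    obtain ⟨y, hy, hxy⟩ := hf.periodic.exists_mem_Ico₀ Real.two_pi_pos x
    rw [hxy]
    have hpi := Real.two_pi_pos
    set i := ⌊y * (32 * N) / (2 * Real.pi)⌋₊ with hi
    have hy0 : 0 ≤ y * (32 * N) / (2 * Real.pi) := by
      have := hy.1; positivity
    have h1 := Nat.floor_le hy0
    have h2 := Nat.lt_floor_add_one (y * (32 * N) / (2 * Real.pi))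
    rw [← hi] at h1 h2
    have himem : i ∈ Finset.range (32 * N) := by
      rw [Finset.mem_range, hi, Nat.floor_lt hy0, div_lt_iff₀ hpi]
      push_cast
      have := hy.2
      nlinarith
    rw [le_div_iff₀ hpi] at h1
    rw [div_lt_iff₀ hpi] at h2
    -- the mesh is `2π / (32 N) ≤ 1 / (4 N)`, on which `f` varies by at most `M / 2` by Bernstein's
    -- inequality; this half is absorbed on the left at the end
    have hdist : |y - 2 * Real.pi * i / (32 * N)| ≤ 1 / (4 * N) := by
      have hn : (0:ℝ) < 32 * N := by positivity
      have e : y - 2 * Real.pi * i / (32 * N) = (y * (32 * N) - 2 * Real.pi * i) / (32 * N) := by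
        field_simp
      have h8 : 2 * Real.pi ≤ 8 := by linarith [Real.pi_le_four]
      rw [e, abs_of_nonneg (div_nonneg (by nlinarith) hn.le), div_le_div_iff₀ hn (by positivity)]
      have : y * (32 * N) - 2 * Real.pi * i ≤ 8 := by nlinarith
      nlinarith
    have h3 := hf.norm_sub_le hN y (2 * Real.pi * i / (32 * N))
    have hM0 : 0 ≤ M := ENNReal.toReal_nonneg
    have h4 : 2 * N * M * |y - 2 * Real.pi * i / (32 * N)| ≤ M / 2 := by
      calc _ ≤ 2 * N * M * (1 / (4 * N)) := by gcongr
        _ = _ := by field_simp; ring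
    have h5 := norm_sub_norm_le (f y) (f (2 * Real.pi * i / (32 * N)))
    have h6 := hgrid i himem
    linarith
  have hM2 : M ≤ R.toReal + M / 2 := by
    have h0 : 0 ≤ R.toReal + M / 2 := (norm_nonneg _).trans (hx 0)
    refine ENNReal.toReal_le_of_le_ofReal h0 (iSup_le fun x => ?_)
    rw [← ofReal_norm]
    exact ENNReal.ofReal_le_ofReal (hx x)
  have : M ≤ (2 * R).toReal := by
    rw [ENNReal.toReal_mul, ENNReal.toReal_ofNat]; linarith
  exact (ENNReal.toReal_le_toReal hf.supNorm_ne_top (ENNReal.mul_ne_top (by simp) hRtop)).1 this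

end IsTrigPoly

/-! ### Dyadic blocks -/

namespace CircleDistribution

/-- The block of the frequency `k` is the number of binary digits of `|k|`; in particular every
frequency belongs to exactly one block. -/
lemma mem_dyadicFreq {n : ℕ} {k : ℤ} : k ∈ dyadicFreq n ↔ Nat.size k.natAbs = n := by
  rw [dyadicFreq]
  split_ifs with h
  · subst h
    simp [Nat.size_eq_zero]
  · obtain ⟨m, rfl⟩ : ∃ m, n = m + 1 := ⟨n - 1, by omega⟩
    have h2 : ∀ j : ℕ, ((2 : ℤ) ^ j) = ((2 ^ j : ℕ) : ℤ) := fun j => by push_cast; rfl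
    have habs : |k| = (k.natAbs : ℤ) := Int.abs_eq_natAbs k
    rw [Finset.mem_filter, Finset.mem_Icc, Nat.add_sub_cancel, ← abs_le, habs, h2, h2]
    have h3 : m < Nat.size k.natAbs ↔ 2 ^ m ≤ k.natAbs := Nat.lt_size
    have h4 : Nat.size k.natAbs ≤ m + 1 ↔ k.natAbs < 2 ^ (m + 1) := Nat.size_le
    constructor
    · rintro ⟨-, h5, h6⟩
      have := h3.2 (by exact_mod_cast h5)
      have := h4.2 (by exact_mod_cast h6)
      omega
    · intro h5
      have h6 := h3.1 (by omega)
      have h7 := h4.1 (by omega)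
      exact ⟨by exact_mod_cast h7.le, by exact_mod_cast h6, by exact_mod_cast h7⟩

lemma neg_mem_dyadicFreq {n : ℕ} {k : ℤ} : -k ∈ dyadicFreq n ↔ k ∈ dyadicFreq n := by
  rw [mem_dyadicFreq, mem_dyadicFreq, Int.natAbs_neg]

lemma dyadicFreq_subset (n : ℕ) : dyadicFreq n ⊆ Finset.Icc (-((2 ^ n : ℕ) : ℤ)) (2 ^ n : ℕ) := by
  intro k hk
  have h1 : k.natAbs < 2 ^ n := Nat.size_le.1 (mem_dyadicFreq.1 hk).le
  rw [Finset.mem_Icc]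
  omega

lemma isTrigPoly_block (n : ℕ) (u : CircleDistribution) : IsTrigPoly (2 ^ n) (block n u) := by
  refine ⟨fun k => if k ∈ dyadicFreq n then
    ((Real.sqrt (2 * Real.pi) : ℝ) : ℂ)⁻¹ * u.coeff k else 0, fun x => ?_⟩
  simp only [ite_mul, zero_mul]
  rw [Finset.sum_ite_mem, Finset.inter_eq_right.2 (dyadicFreq_subset n), block, Finset.mul_sum]
  exact Finset.sum_congr rfl fun k _ => by ring

/-- The test function `φ` with `⟨u, φ⟩ = δ_n u(x)`. -/
def blockTest (n : ℕ) (x : ℝ) : CircleTest :=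
  ((Real.sqrt (2 * Real.pi) : ℝ) : ℂ)⁻¹ • ∑ k ∈ dyadicFreq n,
    (((Real.sqrt (2 * Real.pi) : ℝ) : ℂ)⁻¹ * Complex.exp (Complex.I * k * x)) • expTest (-k)

lemma block_eq_toLin (n : ℕ) (u : CircleDistribution) (x : ℝ) :
    block n u x = u.toLin (blockTest n x) := by
  rw [blockTest, map_smul, map_sum, block, smul_eq_mul]
  congr 1
  refine Finset.sum_congr rfl fun k _ => ?_
  rw [map_smul, smul_eq_mul, coeff]; ring

lemma circleFourier_block {n : ℕ} {k : ℤ} (hk : k ∈ dyadicFreq n) (u : CircleDistribution) :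
    circleFourier (block n u) k = ((Real.sqrt (2 * Real.pi) : ℝ) : ℂ)⁻¹ * u.coeff k := by
  have e : block n u = fun x : ℝ => ((Real.sqrt (2 * Real.pi) : ℝ) : ℂ)⁻¹ *
    ∑ k ∈ dyadicFreq n, u.coeff k * Complex.exp (Complex.I * k * x) := rfl
  rw [e, circleFourier_const_mul, circleFourier_sum _ fun k => by fun_prop]
  simp only [circleFourier_const_mul, circleFourier_exp]
  simp [hk]

/-- The supremum of a block controls the Fourier coefficients in its range of frequencies. -/
lemma norm_coeff_sub_le {n : ℕ} {k : ℤ} (hk : k ∈ dyadicFreq n) (u v : CircleDistribution) :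
    ‖u.coeff k - v.coeff k‖ ≤ Real.sqrt (2 * Real.pi) *
      (supNorm fun x => block n u x - block n v x).toReal := by
  have ht := (isTrigPoly_block n u).sub (isTrigPoly_block n v)
  have h := norm_circleFourier_le ht.norm_le k
  have h0 : 0 < Real.sqrt (2 * Real.pi) := Real.sqrt_pos.2 Real.two_pi_pos
  rw [circleFourier_sub (isTrigPoly_block n u).continuous (isTrigPoly_block n v).continuous,
    circleFourier_block hk, circleFourier_block hk, ← mul_sub, norm_mul, norm_inv,
    Complex.norm_real, Real.norm_of_nonneg h0.le, inv_mul_le_iff₀ h0] at h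
  exact h

lemma norm_coeff_le {n : ℕ} {k : ℤ} (hk : k ∈ dyadicFreq n) (u : CircleDistribution) :
    ‖u.coeff k‖ ≤ Real.sqrt (2 * Real.pi) * (supNorm (block n u)).toReal := by
  have h := norm_circleFourier_le (isTrigPoly_block n u).norm_le k
  have h0 : 0 < Real.sqrt (2 * Real.pi) := Real.sqrt_pos.2 Real.two_pi_pos
  rw [circleFourier_block hk, norm_mul, norm_inv,
    Complex.norm_real, Real.norm_of_nonneg h0.le, inv_mul_le_iff₀ h0] at h
  exact h

/-! ### Distributions with given Fourier coefficients -/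

lemma norm_sqrt_two_pi : ‖((Real.sqrt (2 * Real.pi) : ℝ) : ℂ)‖ = Real.sqrt (2 * Real.pi) := by
  rw [Complex.norm_real, Real.norm_of_nonneg (Real.sqrt_nonneg _)]

lemma norm_circleFourier_mul_le {c : ℤ → ℂ} {K : ℝ} {L : ℕ}
    (hc : ∀ k, ‖c k‖ ≤ K * (1 + |(k : ℝ)|) ^ L) (φ : CircleTest) (k : ℤ) :
    ‖circleFourier φ k * (((Real.sqrt (2 * Real.pi) : ℝ) : ℂ) * c (-k))‖ ≤
      Real.sqrt (2 * Real.pi) * K * ((1 + |(k : ℝ)|) ^ L * ‖circleFourier φ k‖) := by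
  have := hc (-k)
  rw [Int.cast_neg, abs_neg] at this
  rw [norm_mul, norm_mul, norm_sqrt_two_pi]
  calc _ ≤ ‖circleFourier φ k‖ * (Real.sqrt (2 * Real.pi) * (K * (1 + |(k : ℝ)|) ^ L)) := by gcongr
    _ = _ := by ring

lemma summable_circleFourier_mul {c : ℤ → ℂ} {K : ℝ} {L : ℕ}
    (hc : ∀ k, ‖c k‖ ≤ K * (1 + |(k : ℝ)|) ^ L) (φ : CircleTest) :
    Summable fun k : ℤ => circleFourier φ k * (((Real.sqrt (2 * Real.pi) : ℝ) : ℂ) * c (-k)) :=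
  Summable.of_norm_bounded ((CircleTest.summable_one_add_abs_pow_mul_norm_circleFourier φ L).mul_left _)
    (norm_circleFourier_mul_le hc φ)

lemma circleFourier_add_smul (φ ψ : CircleTest) (a : ℂ) (k : ℤ) :
    circleFourier (a • φ + ψ : CircleTest) k = a * circleFourier φ k + circleFourier ψ k := by
  have e : ((a • φ + ψ : CircleTest) : ℝ → ℂ) = fun x => a * (φ : ℝ → ℂ) x + (ψ : ℝ → ℂ) x := by
    funext x; simp
  have c1 := (CircleTest.contDiff φ).continuous
  have c2 := (CircleTest.contDiff ψ).continuous
  rw [e]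
  simp only [circleFourier, add_mul, mul_assoc]
  rw [intervalIntegral.integral_add (Continuous.intervalIntegrable (by fun_prop) _ _)
      (Continuous.intervalIntegrable (by fun_prop) _ _), intervalIntegral.integral_const_mul]
  ring

/-- The distribution with Fourier coefficients `c`, for `c` of at most polynomial growth. The index
`-k` appears because the pairing is bilinear: `⟨u, e^{ik·}⟩ = (2π)^{1/2} û(-k)`. -/
def ofCoeff (c : ℤ → ℂ) (hc : ∃ (K : ℝ) (L : ℕ), ∀ k, ‖c k‖ ≤ K * (1 + |(k : ℝ)|) ^ L) :
    CircleDistribution where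
  toLin :=
    { toFun := fun φ => ∑' k : ℤ, circleFourier φ k * (((Real.sqrt (2 * Real.pi) : ℝ) : ℂ) * c (-k))
      map_add' := fun φ ψ => by
        obtain ⟨K, L, h⟩ := hc
        rw [← (summable_circleFourier_mul h φ).tsum_add (summable_circleFourier_mul h ψ)]
        congr 1; funext k
        have := circleFourier_add_smul φ ψ 1 k
        rw [one_smul, one_mul] at this
        rw [this, add_mul]
      map_smul' := fun a φ => by
        rw [RingHom.id_apply, smul_eq_mul, ← tsum_mul_left]
        congr 1; funext k
        have := circleFourier_add_smul φ 0 a k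
        rw [add_zero] at this
        have h0 : circleFourier ((0 : CircleTest) : ℝ → ℂ) k = 0 := by simp [circleFourier]
        rw [this, h0]; ring }
  bounded := by
    obtain ⟨K, L, h⟩ := hc
    refine ⟨L + 2, Real.sqrt (2 * Real.pi) * |K| * (2 ^ (L + 2) *
      ∑' k : ℤ, ((1 + |(k : ℝ)|) ^ 2)⁻¹), fun φ M hM => ?_⟩
    have h' : ∀ k, ‖c k‖ ≤ |K| * (1 + |(k : ℝ)|) ^ L := fun k => (h k).trans (by
      gcongr; exact le_abs_self K)
    have hs := CircleTest.summable_one_add_abs_inv_sq.hasSum.mul_left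
      (Real.sqrt (2 * Real.pi) * |K| * (2 ^ (L + 2) * M))
    refine (tsum_of_norm_bounded hs fun k => ?_).trans (le_of_eq (by ring))
    refine (norm_circleFourier_mul_le h' φ k).trans ?_
    have h1 := CircleTest.one_add_abs_pow_mul_norm_circleFourier_le φ hM k
    have hp : 0 < (1 + |(k:ℝ)|) ^ 2 := by positivity
    rw [mul_assoc _ (2 ^ (L + 2) * M)]
    refine mul_le_mul_of_nonneg_left ?_ (by positivity)
    rw [← div_eq_mul_inv, le_div_iff₀ hp]
    rw [pow_add] at h1
    linarith

lemma coeff_ofCoeff (c : ℤ → ℂ) (hc : ∃ (K : ℝ) (L : ℕ), ∀ k, ‖c k‖ ≤ K * (1 + |(k : ℝ)|) ^ L)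
    (k : ℤ) : (ofCoeff c hc).coeff k = c k := by
  have e : (expTest (-k) : ℝ → ℂ) = fun x : ℝ => Complex.exp (Complex.I * ((-k : ℤ) : ℂ) * x) := rfl
  have : (ofCoeff c hc).toLin (expTest (-k)) = ((Real.sqrt (2 * Real.pi) : ℝ) : ℂ) * c k := by
    change ∑' j : ℤ, circleFourier (expTest (-k)) j * _ = _
    rw [tsum_eq_single (-k)]
    · rw [e, circleFourier_exp, if_pos rfl, one_mul, neg_neg]
    · intro j hj
      rw [e, circleFourier_exp, if_neg (Ne.symm hj), zero_mul]
  rw [coeff, this, inv_mul_cancel_left₀ sqrt_two_pi_ne_zero]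

/-! ### Continuous functions as distributions -/

lemma circleFourier_of_isRepresentedBy {u : CircleDistribution} {f : ℝ → ℂ}
    (h : u.IsRepresentedBy f) (k : ℤ) :
    circleFourier f k = (2 * Real.pi : ℂ)⁻¹ * u.toLin (expTest (-k)) := by
  rw [h.2.2, circleFourier]
  congr 1
  refine intervalIntegral.integral_congr fun x _ => ?_
  simp [expTest]

lemma IsRepresentedBy.unique {u : CircleDistribution} {f g : ℝ → ℂ}
    (hf : u.IsRepresentedBy f) (hg : u.IsRepresentedBy g) : f = g :=
  eq_of_circleFourier_eq hf.1 hg.1 hf.2.1 hg.2.1 fun k => by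
    rw [circleFourier_of_isRepresentedBy hf, circleFourier_of_isRepresentedBy hg]

lemma holderNorm_of_isRepresentedBy {u : CircleDistribution} {f : ℝ → ℂ}
    (h : u.IsRepresentedBy f) (γ : ℝ) : holderNorm γ u = supNorm f + holderSeminorm γ f := by
  refine le_antisymm (iInf₂_le f h) (le_iInf₂ fun g hg => ?_)
  rw [h.unique hg]

/-- The sum of the Paley-Littlewood series; the junk value `0` of a divergent series is never used. -/
def blockSum (u : CircleDistribution) (x : ℝ) : ℂ := ∑' n, block n u x

/-- The Paley-Littlewood series of a distribution converges to it weakly. -/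
lemma tendsto_sum_dyadicFreq (u : CircleDistribution) (φ : CircleTest) :
    Filter.Tendsto (fun N => ∑ n ∈ Finset.range N, ∑ k ∈ dyadicFreq n,
      circleFourier φ k * u.toLin (expTest k)) Filter.atTop (nhds (u.toLin φ)) := by
  have h := u.hasSum_toLin φ
  rw [HasSum, SummationFilter.unconditional_filter] at h
  have hS : Filter.Tendsto (fun N => (Finset.range N).biUnion dyadicFreq)
      Filter.atTop Filter.atTop := by
    refine Filter.tendsto_atTop_finset_of_monotone
      (fun a b hab => Finset.biUnion_subset_biUnion_of_subset_left _
        (Finset.range_subset_range.2 hab)) fun k => ?_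
    exact ⟨Nat.size k.natAbs + 1, Finset.mem_biUnion.2 ⟨Nat.size k.natAbs,
      Finset.mem_range.2 (Nat.lt_succ_self _), mem_dyadicFreq.2 rfl⟩⟩
  refine (h.comp hS).congr fun N => ?_
  rw [Function.comp, Finset.sum_biUnion]
  intro i _ j _ hij
  rw [Function.onFun, Finset.disjoint_left]
  intro k hi hj
  exact hij ((mem_dyadicFreq.1 hi).symm.trans (mem_dyadicFreq.1 hj))

lemma integral_block_mul (n : ℕ) (u : CircleDistribution) (φ : CircleTest) :
    ∫ x in (0 : ℝ)..(2 * Real.pi), block n u x * (φ : ℝ → ℂ) x =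
      ∑ k ∈ dyadicFreq n, circleFourier φ k * u.toLin (expTest k) := by
  have c1 := (CircleTest.contDiff φ).continuous
  have hpi : (2 * Real.pi : ℂ) ≠ 0 := by exact_mod_cast Real.two_pi_pos.ne'
  have hsq : ((Real.sqrt (2 * Real.pi) : ℝ) : ℂ) * ((Real.sqrt (2 * Real.pi) : ℝ) : ℂ)
      = 2 * Real.pi := by
    rw [← Complex.ofReal_mul, Real.mul_self_sqrt Real.two_pi_pos.le]; push_cast; rfl
  have e : ∀ x : ℝ, block n u x * (φ : ℝ → ℂ) x = ∑ k ∈ dyadicFreq n,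
      (((Real.sqrt (2 * Real.pi) : ℝ) : ℂ)⁻¹ * u.coeff k) *
        ((φ : ℝ → ℂ) x * Complex.exp (Complex.I * k * x)) := fun x => by
    rw [block, Finset.mul_sum, Finset.sum_mul]
    exact Finset.sum_congr rfl fun k _ => by ring
  simp only [e]
  rw [intervalIntegral.integral_finsetSum fun i _ =>
      Continuous.intervalIntegrable (by fun_prop) _ _]
  simp only [intervalIntegral.integral_const_mul]
  refine Finset.sum_bij' (fun k _ => -k) (fun k _ => -k) (fun k hk => neg_mem_dyadicFreq.2 hk)
    (fun k hk => neg_mem_dyadicFreq.2 hk) (by simp) (by simp) fun k _ => ?_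
  rw [toLin_expTest, neg_neg, circleFourier]
  have : ∀ x : ℝ, -(Complex.I * ((-k : ℤ) : ℂ) * x) = Complex.I * k * x := fun x => by
    push_cast; ring
  simp only [this]
  have h0 := sqrt_two_pi_ne_zero
  rw [← hsq]
  field_simp

section
variable {u : CircleDistribution} (hu : ∑' n, supNorm (block n u) ≠ ⊤)
include hu

lemma summable_supNorm_block : Summable fun n => (supNorm (block n u)).toReal :=
  ENNReal.summable_toReal hu

lemma continuous_blockSum : Continuous (blockSum u) :=
  continuous_tsum (fun n => (isTrigPoly_block n u).continuous) (summable_supNorm_block hu)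
    fun n x => (isTrigPoly_block n u).norm_le x

lemma hasSum_block (x : ℝ) : HasSum (fun n => block n u x) (blockSum u x) :=
  (Summable.of_norm_bounded (summable_supNorm_block hu)
    fun n => (isTrigPoly_block n u).norm_le x).hasSum

/-- If the suprema of the blocks are summable, the Paley-Littlewood series converges uniformly, and
its sum is the continuous function that represents the distribution. -/
lemma isRepresentedBy_blockSum : u.IsRepresentedBy (blockSum u) := by
  refine ⟨continuous_blockSum hu, fun x => ?_, fun φ => ?_⟩
  · simp only [blockSum, (isTrigPoly_block _ u).periodic x]
  · obtain ⟨M, hM⟩ := CircleTest.exists_bound_iteratedDeriv φ 0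
    simp only [iteratedDeriv_zero] at hM
    have hM0 : 0 ≤ M := (norm_nonneg _).trans (hM 0)
    have c1 := (CircleTest.contDiff φ).continuous
    have h1 : HasSum (fun n => ∫ x in (0 : ℝ)..(2 * Real.pi), block n u x * (φ : ℝ → ℂ) x)
        (∫ x in (0 : ℝ)..(2 * Real.pi), blockSum u x * (φ : ℝ → ℂ) x) := by
      refine intervalIntegral.hasSum_integral_of_dominated_convergence
        (fun n _ => (supNorm (block n u)).toReal * M) (fun n => ?_) (fun n => ?_) ?_ ?_ ?_
      · have := (isTrigPoly_block n u).continuous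
        exact (by fun_prop : Continuous fun x => block n u x * (φ : ℝ → ℂ) x).aestronglyMeasurable
      · refine ae_of_all _ fun x _ => ?_
        rw [norm_mul]
        exact mul_le_mul ((isTrigPoly_block n u).norm_le x) (hM x) (norm_nonneg _)
          ENNReal.toReal_nonneg
      · exact ae_of_all _ fun x _ => (summable_supNorm_block hu).mul_right M
      · exact Continuous.intervalIntegrable continuous_const _ _
      · exact ae_of_all _ fun x _ => (hasSum_block hu x).mul_right _
    have h2 := h1.tendsto_sum_nat
    simp only [integral_block_mul] at h2
    exact tendsto_nhds_unique (tendsto_sum_dyadicFreq u φ) h2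

lemma enorm_blockSum_le (x : ℝ) : ‖blockSum u x‖ₑ ≤ ∑' n, supNorm (block n u) := by
  have h := tsum_of_norm_bounded (summable_supNorm_block hu).hasSum
    (f := fun n => block n u x) fun n => (isTrigPoly_block n u).norm_le x
  rw [← ofReal_norm]
  refine (ENNReal.ofReal_le_ofReal h).trans (le_of_eq ?_)
  rw [ENNReal.ofReal_tsum_of_nonneg (fun _ => ENNReal.toReal_nonneg) (summable_supNorm_block hu)]
  exact tsum_congr fun n => ENNReal.ofReal_toReal (isTrigPoly_block n u).supNorm_ne_top
end

/-- Interpolation between the bound `2 ‖δ_n u‖` and Bernstein's inequality. -/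
lemma norm_block_sub_le {γ : ℝ} (hγ : 0 < γ) (hγ1 : γ < 1) (n : ℕ) (u : CircleDistribution)
    (x y : ℝ) : ‖block n u x - block n u y‖ ≤
      2 * ((2 : ℝ) ^ (γ * n) * (supNorm (block n u)).toReal) * |x - y| ^ γ := by
  set S := (supNorm (block n u)).toReal with hS
  have hS0 : 0 ≤ S := ENNReal.toReal_nonneg
  have ht := isTrigPoly_block n u
  have h1 := ht.norm_sub_le (by positivity) x y
  have h2 : ‖block n u x - block n u y‖ ≤ 2 * S := by
    refine (_root_.norm_sub_le _ _).trans ?_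
    have := ht.norm_le x
    have := ht.norm_le y
    linarith
  have e : (2 : ℝ) ^ (γ * n) * |x - y| ^ γ = (2 ^ n * |x - y|) ^ γ := by
    rw [Real.mul_rpow (by positivity) (abs_nonneg _), mul_comm γ, Real.rpow_mul (by norm_num),
      Real.rpow_natCast]
  have e2 : 2 * ((2 : ℝ) ^ (γ * n) * S) * |x - y| ^ γ = 2 * S * (2 ^ n * |x - y|) ^ γ := by
    rw [← e]; ring
  rw [e2]
  set a := 2 ^ n * |x - y| with ha
  have ha0 : 0 ≤ a := by positivity
  rcases le_total a 1 with h | h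
  · have h3 : a ≤ a ^ γ := by
      have := Real.rpow_le_rpow_of_exponent_ge' ha0 h hγ.le hγ1.le
      rwa [Real.rpow_one] at this
    calc _ ≤ 2 * S * a := by refine h1.trans (le_of_eq ?_); push_cast; ring
      _ ≤ _ := by gcongr
  · have h3 : 1 ≤ a ^ γ := Real.one_le_rpow h hγ.le
    exact h2.trans (le_mul_of_one_le_right (by positivity) h3)

/-- The `C^γ` norm is bounded by the norm of the Besov space `B^γ_{∞,1}`, both for negative and for
positive `γ`. -/
lemma cNorm_le_tsum {γ : ℝ} (hγ0 : γ ≠ 0) (hγ1 : γ < 1) (u : CircleDistribution) :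
    cNorm γ u ≤ 3 * ∑' n : ℕ, ENNReal.ofReal ((2 : ℝ) ^ (γ * (n : ℝ))) * supNorm (block n u) := by
  set B := ∑' n : ℕ, ENNReal.ofReal ((2 : ℝ) ^ (γ * (n : ℝ))) * supNorm (block n u) with hB
  rw [cNorm]
  split_ifs with hneg
  · have h3 : B ≤ 3 * B := le_mul_of_one_le_left zero_le (by norm_num)
    exact (iSup_le fun n => ENNReal.le_tsum n).trans h3
  · have hpos : 0 < γ := lt_of_le_of_ne (not_lt.1 hneg) (Ne.symm hγ0)
    by_cases htop : B = ⊤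
    · rw [htop]; simp
    have hle : ∑' n, supNorm (block n u) ≤ B := by
      refine ENNReal.tsum_le_tsum fun n => le_mul_of_one_le_left zero_le ?_
      rw [ENNReal.one_le_ofReal]
      exact Real.one_le_rpow (by norm_num) (by positivity)
    have hu : ∑' n, supNorm (block n u) ≠ ⊤ := ne_top_of_le_ne_top htop hle
    rw [holderNorm_of_isRepresentedBy (isRepresentedBy_blockSum hu)]
    have h1 : supNorm (blockSum u) ≤ B := iSup_le fun x => (enorm_blockSum_le hu x).trans hle
    have hsum : Summable fun n : ℕ => (2 : ℝ) ^ (γ * (n : ℝ)) * (supNorm (block n u)).toReal := by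
      have := ENNReal.summable_toReal htop
      refine this.congr fun n => ?_
      rw [ENNReal.toReal_mul, ENNReal.toReal_ofReal (by positivity)]
    have h2 : holderSeminorm γ (blockSum u) ≤ 2 * B := by
      refine iSup_le fun x => iSup_le fun y => iSup_le fun hxy => ?_
      have hxy0 : 0 < |x - y| := abs_pos.2 (sub_ne_zero.2 hxy)
      refine ENNReal.div_le_of_le_mul ?_
      have hd := ((hasSum_block hu x).sub (hasSum_block hu y)).tsum_eq
      have hb := tsum_of_norm_bounded ((hsum.mul_left 2).mul_right (|x - y| ^ γ)).hasSum
        (f := fun n => block n u x - block n u y) fun n => norm_block_sub_le hpos hγ1 n u x y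
      rw [hd, tsum_mul_right, tsum_mul_left] at hb
      rw [← ofReal_norm]
      refine (ENNReal.ofReal_le_ofReal hb).trans (le_of_eq ?_)
      have hs0 : 0 ≤ ∑' n : ℕ, (2 : ℝ) ^ (γ * (n : ℝ)) * (supNorm (block n u)).toReal :=
        tsum_nonneg fun n => by positivity
      rw [ENNReal.ofReal_mul (by positivity), ENNReal.ofReal_mul (by norm_num)]
      congr 2
      · simp
      · rw [ENNReal.ofReal_tsum_of_nonneg (fun n => by positivity) hsum]
        refine tsum_congr fun n => ?_
        rw [ENNReal.ofReal_mul (by positivity),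
          ENNReal.ofReal_toReal (isTrigPoly_block n u).supNorm_ne_top]
    calc _ ≤ B + 2 * B := add_le_add h1 h2
      _ = _ := by ring

end CircleDistribution

/-! ### Dyadic chaining -/

/-- The `j`th dyadic time of level `k` in `[0,T]`. -/
def dyadicTime (T : ℝ) (k j : ℕ) : ℝ := T * j / 2 ^ k

/-- The last dyadic time of level `k` not after `t ∈ [0,T]`. -/
def dyadicFloor (T : ℝ) (k : ℕ) (t : ℝ) : ℝ := dyadicTime T k ⌊2 ^ k * t / T⌋₊

section
variable {T : ℝ} (hT : 0 < T)
include hT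

lemma dyadicTime_mem {k j : ℕ} (hj : j ≤ 2 ^ k) : dyadicTime T k j ∈ Set.Icc (0 : ℝ) T := by
  have h2 : (0 : ℝ) < 2 ^ k := by positivity
  have hj' : (j : ℝ) ≤ 2 ^ k := by exact_mod_cast hj
  refine ⟨by unfold dyadicTime; positivity, ?_⟩
  rw [dyadicTime, div_le_iff₀ h2]
  gcongr

lemma floor_le_two_pow {t : ℝ} (ht : t ∈ Set.Icc (0 : ℝ) T) (k : ℕ) :
    ⌊2 ^ k * t / T⌋₊ ≤ 2 ^ k := by
  refine Nat.floor_le_of_le ?_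
  rw [div_le_iff₀ hT]
  push_cast
  have := ht.2
  gcongr

lemma dyadicFloor_mem {t : ℝ} (ht : t ∈ Set.Icc (0 : ℝ) T) (k : ℕ) :
    dyadicFloor T k t ∈ Set.Icc (0 : ℝ) T := dyadicTime_mem hT (floor_le_two_pow hT ht k)

lemma abs_dyadicFloor_sub_le {t : ℝ} (ht : t ∈ Set.Icc (0 : ℝ) T) (k : ℕ) :
    |dyadicFloor T k t - t| ≤ T / 2 ^ k := by
  have h2 : (0 : ℝ) < 2 ^ k := by positivity
  have h0 : 0 ≤ 2 ^ k * t / T := by have := ht.1; positivity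
  have h1 := Nat.floor_le h0
  have h3 := Nat.lt_floor_add_one (2 ^ k * t / T)
  rw [le_div_iff₀ hT] at h1
  rw [div_lt_iff₀ hT] at h3
  have e : dyadicFloor T k t - t = (T * ⌊2 ^ k * t / T⌋₊ - 2 ^ k * t) / 2 ^ k := by
    rw [dyadicFloor, dyadicTime]; field_simp
  rw [e, abs_div, abs_of_pos h2]
  gcongr
  rw [abs_le]
  constructor <;> nlinarith

lemma tendsto_dyadicFloor {t : ℝ} (ht : t ∈ Set.Icc (0 : ℝ) T) :
    Filter.Tendsto (fun k => dyadicFloor T k t) Filter.atTop (nhds t) := by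
  rw [tendsto_iff_dist_tendsto_zero]
  refine squeeze_zero (fun k => dist_nonneg) (fun k => abs_dyadicFloor_sub_le hT ht k) ?_
  have := (tendsto_pow_atTop_nhds_zero_of_lt_one (r := (1 / 2 : ℝ)) (by norm_num)
    (by norm_num)).const_mul T
  simpa [div_eq_mul_inv] using this

variable {E : Type*} [PseudoEMetricSpace E] {F : ℝ → E} {V : ℕ → ℝ≥0∞}
  (hV : ∀ i, ∀ j < 2 ^ i, edist (F (dyadicTime T i (j + 1))) (F (dyadicTime T i j)) ≤ V i)
include hV

/-- Consecutive dyadic approximations of `t` are equal or adjacent dyadic times of the finer level. -/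
lemma edist_dyadicFloor_succ_le {t : ℝ} (ht : t ∈ Set.Icc (0 : ℝ) T) (k : ℕ) :
    edist (F (dyadicFloor T k t)) (F (dyadicFloor T (k + 1) t)) ≤ V (k + 1) := by
  set j := ⌊2 ^ k * t / T⌋₊ with hj
  set j' := ⌊2 ^ (k + 1) * t / T⌋₊ with hj'
  have h0 : 0 ≤ 2 ^ k * t / T := by have := ht.1; positivity
  have e2 : 2 ^ (k + 1) * t / T = 2 * (2 ^ k * t / T) := by rw [pow_succ]; ring
  have h1 := Nat.floor_le h0
  have h3 := Nat.lt_floor_add_one (2 ^ k * t / T)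
  rw [← hj] at h1 h3
  have hlow : 2 * j ≤ j' := by
    rw [hj', e2]; refine Nat.le_floor ?_; push_cast; linarith
  have hupp : j' < 2 * j + 2 := by
    rw [hj', e2, Nat.floor_lt (by positivity)]; push_cast; linarith
  have he : dyadicTime T k j = dyadicTime T (k + 1) (2 * j) := by
    simp only [dyadicTime]; push_cast; rw [pow_succ]; field_simp
  rw [dyadicFloor, dyadicFloor, ← hj, ← hj', he]
  have hle := floor_le_two_pow hT ht (k + 1)
  rw [← hj'] at hle
  rcases (by omega : j' = 2 * j ∨ j' = 2 * j + 1) with h | h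
  · rw [h, edist_self]; exact zero_le
  · rw [h, edist_comm]
    exact hV _ _ (by omega)

lemma edist_dyadicFloor_le {s t : ℝ} (hs : s ∈ Set.Icc (0 : ℝ) T) (ht : t ∈ Set.Icc (0 : ℝ) T)
    {k : ℕ} (hst : |s - t| ≤ T / 2 ^ k) :
    edist (F (dyadicFloor T k s)) (F (dyadicFloor T k t)) ≤ V k := by
  wlog h : s ≤ t generalizing s t
  · rw [edist_comm]
    exact this ht hs (by rwa [abs_sub_comm]) (le_of_not_ge h)
  have h2 : (0 : ℝ) < 2 ^ k := by positivity
  have h1 : ⌊2 ^ k * s / T⌋₊ ≤ ⌊2 ^ k * t / T⌋₊ := Nat.floor_le_floor (by gcongr)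
  have h3 : ⌊2 ^ k * t / T⌋₊ ≤ ⌊2 ^ k * s / T⌋₊ + 1 := by
    rw [← Nat.floor_add_one (by have := hs.1; positivity)]
    refine Nat.floor_le_floor ?_
    rw [abs_sub_comm, abs_of_nonneg (by linarith), le_div_iff₀ h2] at hst
    rw [div_add_one hT.ne']
    gcongr
    linarith
  have h4 := floor_le_two_pow hT ht k
  rw [dyadicFloor, dyadicFloor]
  rcases (by omega : ⌊2 ^ k * t / T⌋₊ = ⌊2 ^ k * s / T⌋₊ ∨
    ⌊2 ^ k * t / T⌋₊ = ⌊2 ^ k * s / T⌋₊ + 1) with h | h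
  · rw [h, edist_self]; exact zero_le
  · rw [h, edist_comm]
    exact hV _ _ (by omega)

/-- Chaining along the dyadic approximations of `t`, starting from the level `0` interval. -/
lemma edist_dyadicFloor_zero_le {t : ℝ} (ht : t ∈ Set.Icc (0 : ℝ) T) (k : ℕ) :
    edist (F (dyadicFloor T k t)) (F 0) ≤ ∑' i, V i := by
  have h : edist (F (dyadicFloor T k t)) (F 0) ≤ ∑ i ∈ Finset.range (k + 1), V i := by
    induction k with
    | zero =>
      have h0 : dyadicFloor T 0 0 = 0 := by simp [dyadicFloor, dyadicTime]
      have := edist_dyadicFloor_le hT hV ht (s := t) (t := 0) ⟨le_rfl, hT.le⟩ (k := 0)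
        (by rw [sub_zero, abs_of_nonneg ht.1, pow_zero, div_one]; exact ht.2)
      rw [h0] at this
      simpa using this
    | succ k ih =>
      rw [Finset.sum_range_succ]
      refine (edist_triangle _ (F (dyadicFloor T k t)) _).trans ?_
      rw [add_comm, edist_comm (F (dyadicFloor T (k + 1) t))]
      exact add_le_add ih (edist_dyadicFloor_succ_le hT hV ht k)
  exact h.trans (ENNReal.sum_le_tsum _)

lemma exists_tendsto_dyadicFloor [CompleteSpace E] (hVs : ∑' i, V i ≠ ⊤) {t : ℝ}
    (ht : t ∈ Set.Icc (0 : ℝ) T) :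
    ∃ a, Filter.Tendsto (fun k => F (dyadicFloor T k t)) Filter.atTop (nhds a) := by
  refine cauchySeq_tendsto_of_complete (cauchySeq_of_edist_le_of_tsum_ne_top (fun k => V (k + 1))
    (fun k => edist_dyadicFloor_succ_le hT hV ht k) ?_)
  exact ne_top_of_le_ne_top hVs (ENNReal.tsum_comp_le_tsum_of_injective (add_left_injective 1) V)

/-- The limit along dyadic times of a function with summable dyadic increments is continuous. -/
lemma continuousOn_of_tendsto_dyadicFloor (hVs : ∑' i, V i ≠ ⊤) {g : ℝ → E}
    (hg : ∀ t ∈ Set.Icc (0 : ℝ) T,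
      Filter.Tendsto (fun k => F (dyadicFloor T k t)) Filter.atTop (nhds (g t))) :
    ContinuousOn g (Set.Icc (0 : ℝ) T) := by
  set R : ℕ → ℝ≥0∞ := fun k => ∑' i, V (i + k) with hR
  have hR0 : Filter.Tendsto R Filter.atTop (nhds 0) := ENNReal.tendsto_sum_nat_add V hVs
  have htail : ∀ t ∈ Set.Icc (0 : ℝ) T, ∀ k, edist (F (dyadicFloor T k t)) (g t) ≤ R k := by
    intro t ht k
    refine (edist_le_tsum_of_edist_le_of_tendsto (fun k => V (k + 1))
      (fun k => edist_dyadicFloor_succ_le hT hV ht k) (hg t ht) k).trans ?_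
    have := ENNReal.tsum_comp_le_tsum_of_injective (add_left_injective 1) (fun i => V (i + k))
    refine le_trans (le_of_eq ?_) this
    refine tsum_congr fun i => ?_
    congr 1; omega
  have hVR : ∀ k, V k ≤ R k := fun k => by
    have := ENNReal.le_tsum (f := fun i => V (i + k)) 0
    simpa using this
  have h3 : Filter.Tendsto (fun k => 3 * R k) Filter.atTop (nhds 0) := by
    have := ENNReal.Tendsto.const_mul (a := 3) hR0 (Or.inr (by simp))
    simpa using this
  intro t ht
  rw [ContinuousWithinAt, EMetric.tendsto_nhds]
  intro ε hε
  obtain ⟨k, hk⟩ := (h3.eventually (gt_mem_nhds hε)).exists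
  have hnear : ∀ᶠ s in nhdsWithin t (Set.Icc (0 : ℝ) T), |s - t| ≤ T / 2 ^ k := by
    refine nhdsWithin_le_nhds ?_
    have := Metric.closedBall_mem_nhds t (ε := T / 2 ^ k) (by positivity)
    filter_upwards [this] with s hs
    rwa [Metric.mem_closedBall, Real.dist_eq] at hs
  filter_upwards [hnear, self_mem_nhdsWithin] with s hst hs
  refine lt_of_le_of_lt ?_ hk
  calc edist (g s) (g t) ≤ edist (g s) (F (dyadicFloor T k s)) +
        edist (F (dyadicFloor T k s)) (F (dyadicFloor T k t)) +
        edist (F (dyadicFloor T k t)) (g t) := edist_triangle4 _ _ _ _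
    _ ≤ R k + R k + R k := by
        gcongr
        · rw [edist_comm]; exact htail s hs k
        · exact (edist_dyadicFloor_le hT hV hs ht hst).trans (hVR k)
        · exact htail t ht k
    _ = _ := by ring
end

/-! ### Moments of complex random variables -/

section
variable {Ω : Type*} [MeasurableSpace Ω] {P : Measure Ω}

lemma aemeasurable_of_re_im_eq_Lp {Y : Ω → ℂ} {f g : Lp ℝ 2 P} (hf : (fun ω => (Y ω).re) =ᵐ[P] f)
    (hg : (fun ω => (Y ω).im) =ᵐ[P] g) : AEMeasurable Y P := by
  have h : AEMeasurable (fun ω => ((f ω : ℝ) : ℂ) + ((g ω : ℝ) : ℂ) * Complex.I) P := by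
    have h1 := (Lp.aestronglyMeasurable f).aemeasurable
    have h2 := (Lp.aestronglyMeasurable g).aemeasurable
    fun_prop
  refine h.congr ?_
  filter_upwards [hf, hg] with ω h1 h2
  rw [← h1, ← h2, Complex.re_add_im]

lemma enorm_sq_eq_re_im (z : ℂ) : ‖z‖ₑ ^ 2 = ‖z.re‖ₑ ^ 2 + ‖z.im‖ₑ ^ 2 := by
  rw [← ofReal_norm, ← ofReal_norm, ← ofReal_norm, ← ENNReal.ofReal_pow (norm_nonneg _),
    ← ENNReal.ofReal_pow (norm_nonneg _), ← ENNReal.ofReal_pow (norm_nonneg _),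
    ← ENNReal.ofReal_add (by positivity) (by positivity), Complex.sq_norm, Complex.normSq_apply]
  simp [sq]

lemma ennreal_add_pow_le (x y : ℝ≥0∞) (q : ℕ) : (x + y) ^ q ≤ 2 ^ q * (x ^ q + y ^ q) := by
  calc (x + y) ^ q ≤ (2 * max x y) ^ q := by
        gcongr; rw [two_mul]; exact add_le_add (le_max_left _ _) (le_max_right _ _)
    _ = 2 ^ q * (max x y) ^ q := mul_pow _ _ _
    _ ≤ _ := by
        gcongr
        rcases le_total x y with h | h
        · rw [max_eq_right h]; exact le_add_self
        · rw [max_eq_left h]; exact le_self_add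

/-- Bounds for the moments of a complex random variable whose real and imaginary parts lie in
a space of real random variables with comparable moments. Because these parts are in `L²`, the
Bochner integral of `‖Y‖ ^ 2` in the hypothesis is not a junk value. -/
lemma lintegral_enorm_pow_le_of_re_im {H : Submodule ℝ (Lp ℝ 2 P)} {q : ℕ} {C : ℝ≥0∞}
    (hC : ∀ f ∈ H, ∫⁻ ω, ‖f ω‖ₑ ^ (2 * q) ∂P ≤ C * ‖f‖ₑ ^ (2 * q)) {Y : Ω → ℂ}
    (hY : ∃ f ∈ H, ∃ g ∈ H, (fun ω => (Y ω).re) =ᵐ[P] (f : Ω → ℝ) ∧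
      (fun ω => (Y ω).im) =ᵐ[P] (g : Ω → ℝ)) {a : ℝ} (ha : ∫ ω, ‖Y ω‖ ^ 2 ∂P ≤ a) :
    ∫⁻ ω, ‖Y ω‖ₑ ^ (2 * q) ∂P ≤ 2 ^ q * (2 * C) * ENNReal.ofReal a ^ q := by
  obtain ⟨f, hf, g, hg, hfY, hgY⟩ := hY
  have hYm := aemeasurable_of_re_im_eq_Lp hfY hgY
  have hsq : ∫⁻ ω, ‖Y ω‖ₑ ^ 2 ∂P = ‖f‖ₑ ^ 2 + ‖g‖ₑ ^ 2 := by
    rw [enorm_lp_two_sq, enorm_lp_two_sq, ← lintegral_add_left' (by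
      exact ((Lp.aestronglyMeasurable f).enorm).pow_const _)]
    refine lintegral_congr_ae ?_
    filter_upwards [hfY, hgY] with ω h1 h2
    rw [← h1, ← h2, enorm_sq_eq_re_im]
  have hle : ‖f‖ₑ ^ 2 + ‖g‖ₑ ^ 2 ≤ ENNReal.ofReal a := by
    rw [← hsq]
    have htop : ∫⁻ ω, ‖Y ω‖ₑ ^ 2 ∂P ≠ ⊤ := by
      rw [hsq]; simp [ENNReal.add_eq_top, ENNReal.pow_eq_top_iff]
    have : ∫ ω, ‖Y ω‖ ^ 2 ∂P = (∫⁻ ω, ‖Y ω‖ₑ ^ 2 ∂P).toReal := by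
      rw [integral_eq_lintegral_of_nonneg_ae (ae_of_all _ fun ω => by positivity)
        (by exact (hYm.norm.pow_const 2).aestronglyMeasurable)]
      congr 1
      refine lintegral_congr fun ω => ?_
      rw [ENNReal.ofReal_pow (norm_nonneg _), ofReal_norm]
    rw [this] at ha
    exact (ENNReal.le_ofReal_iff_toReal_le htop (ENNReal.toReal_nonneg.trans ha)).2 ha
  have hpt : ∀ f' ∈ H, ‖f'‖ₑ ^ 2 ≤ ENNReal.ofReal a →
      ∫⁻ ω, ‖f' ω‖ₑ ^ (2 * q) ∂P ≤ C * ENNReal.ofReal a ^ q := fun f' hf' h => by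
    refine (hC f' hf').trans ?_
    rw [pow_mul]; gcongr
  calc ∫⁻ ω, ‖Y ω‖ₑ ^ (2 * q) ∂P
      ≤ ∫⁻ ω, 2 ^ q * (‖f ω‖ₑ ^ (2 * q) + ‖g ω‖ₑ ^ (2 * q)) ∂P := by
        refine lintegral_mono_ae ?_
        filter_upwards [hfY, hgY] with ω h1 h2
        rw [← h1, ← h2, pow_mul, pow_mul, pow_mul, enorm_sq_eq_re_im]
        exact ennreal_add_pow_le _ _ _
    _ = 2 ^ q * (∫⁻ ω, ‖f ω‖ₑ ^ (2 * q) ∂P + ∫⁻ ω, ‖g ω‖ₑ ^ (2 * q) ∂P) := by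
        rw [lintegral_const_mul' _ _ (by simp), lintegral_add_left' (by
          exact ((Lp.aestronglyMeasurable f).enorm).pow_const _)]
    _ ≤ 2 ^ q * (C * ENNReal.ofReal a ^ q + C * ENNReal.ofReal a ^ q) := by
        gcongr
        · exact hpt f hf (le_self_add.trans hle)
        · exact hpt g hg (le_add_self.trans hle)
    _ = _ := by ring

/-- Jensen's inequality for the concave function `x ↦ x ^ (1 / p)`. -/
lemma lintegral_rpow_inv_le [IsProbabilityMeasure P] {f : Ω → ℝ≥0∞} (hf : AEMeasurable f P)
    {p : ℕ} (hp : p ≠ 0) : ∫⁻ ω, f ω ^ (1 / (p : ℝ)) ∂P ≤ (∫⁻ ω, f ω ∂P) ^ (1 / (p : ℝ)) := by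
  have h1p : (1 : ℝ≥0∞) ≤ (p : ℝ≥0∞) := by exact_mod_cast Nat.one_le_iff_ne_zero.2 hp
  have hp0 : (p : ℝ) ≠ 0 := by exact_mod_cast hp
  have := eLpNorm_le_eLpNorm_of_exponent_le (μ := P) (f := fun ω => f ω ^ (1 / (p : ℝ))) h1p
    (hf.pow_const _).aestronglyMeasurable
  rw [eLpNorm_one_eq_lintegral_enorm, eLpNorm_eq_lintegral_rpow_enorm_toReal (by simpa using hp)
    (by simp)] at this
  simp only [enorm_eq_self, ENNReal.toReal_natCast, ← ENNReal.rpow_mul, one_div,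
    inv_mul_cancel₀ hp0, ENNReal.rpow_one] at this
  simpa only [one_div] using this

/-- Maximal inequality for finitely many variables with bounded moments of order `p`: the `ℓ^p` sum
costs the factor `card ^ (1 / p)`. -/
lemma lintegral_sum_rpow_le [IsProbabilityMeasure P] {ι : Type*} (s : Finset ι) {Y : ι → Ω → ℂ}
    (hY : ∀ i ∈ s, AEMeasurable (Y i) P) {p : ℕ} (hp : p ≠ 0) {a : ℝ≥0∞}
    (ha : ∀ i ∈ s, ∫⁻ ω, ‖Y i ω‖ₑ ^ p ∂P ≤ a ^ p) :
    ∫⁻ ω, 2 * (∑ i ∈ s, ‖Y i ω‖ₑ ^ p) ^ (1 / (p : ℝ)) ∂P ≤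
      2 * ((s.card : ℝ≥0∞) ^ (1 / (p : ℝ)) * a) := by
  have hm : ∀ i ∈ s, AEMeasurable (fun ω => ‖Y i ω‖ₑ ^ p) P := fun i hi =>
    (hY i hi).enorm.pow_const _
  have hp0 : (p : ℝ) ≠ 0 := by exact_mod_cast hp
  rw [lintegral_const_mul' _ _ (by simp)]
  refine mul_le_mul_right ((lintegral_rpow_inv_le (Finset.aemeasurable_fun_sum s hm) hp).trans ?_) 2
  rw [lintegral_finsetSum' s hm]
  calc (∑ i ∈ s, ∫⁻ ω, ‖Y i ω‖ₑ ^ p ∂P) ^ (1 / (p : ℝ)) ≤ (∑ i ∈ s, a ^ p) ^ (1 / (p : ℝ)) := by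
        gcongr with i hi
        exact ha i hi
    _ = _ := by
        rw [Finset.sum_const, nsmul_eq_mul, ENNReal.mul_rpow_of_nonneg _ _ (by positivity),
          ← ENNReal.rpow_natCast a, ← ENNReal.rpow_mul, mul_one_div_cancel hp0, ENNReal.rpow_one]
end

/-! ### Moments of the blocks of a random distribution -/

open CircleDistribution

section
variable {Ω : Type*} [MeasurableSpace Ω] {P : Measure Ω}

/-- The moments of order `2q` of the complex variables with real and imaginary parts in `H` are
controlled by their second moments, with constant `D`. -/
def MomentBound (H : Submodule ℝ (Lp ℝ 2 P)) (q : ℕ) (D : ℝ) : Prop :=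
  ∀ (Y : Ω → ℂ) (a : ℝ), 0 ≤ a →
    (∃ f ∈ H, ∃ g ∈ H, (fun ω => (Y ω).re) =ᵐ[P] (f : Ω → ℝ) ∧
      (fun ω => (Y ω).im) =ᵐ[P] (g : Ω → ℝ)) →
    ∫ ω, ‖Y ω‖ ^ 2 ∂P ≤ a →
    ∫⁻ ω, ‖Y ω‖ₑ ^ (2 * q) ∂P ≤ ENNReal.ofReal (D * Real.sqrt a) ^ (2 * q)

lemma exists_momentBound (m q : ℕ) (hq : 2 ≤ q) : ∃ D : ℝ, 1 ≤ D ∧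
    ∀ {Ω : Type*} [MeasurableSpace Ω] (P : Measure Ω) [IsProbabilityMeasure P]
      (G : Submodule ℝ (Lp ℝ 2 P)), IsGaussianSpace G → MomentBound (wienerChaosLE G m) q D := by
  obtain ⟨C, hC0, hC⟩ := exists_lintegral_chaos_pow_le m q hq
  have h1 : 1 ≤ max 1 (2 ^ q * (2 * C)) := le_max_left _ _
  refine ⟨max 1 (2 ^ q * (2 * C)), h1, fun {Ω} _ P _ G hG Y a ha hY hYa => ?_⟩
  refine (lintegral_enorm_pow_le_of_re_im (hC P G hG) hY hYa).trans ?_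
  have e1 : ENNReal.ofReal a ^ q = ENNReal.ofReal (Real.sqrt a) ^ (2 * q) := by
    rw [pow_mul, ← ENNReal.ofReal_pow (Real.sqrt_nonneg _), Real.sq_sqrt ha]
  rw [e1, ENNReal.ofReal_mul (by linarith), mul_pow]
  gcongr
  calc (2 : ℝ≥0∞) ^ q * (2 * ENNReal.ofReal C) = ENNReal.ofReal (2 ^ q * (2 * C)) := by
        rw [ENNReal.ofReal_mul (by positivity), ENNReal.ofReal_mul (by positivity),
          ENNReal.ofReal_pow (by positivity)]
        simp
    _ ≤ ENNReal.ofReal (max 1 (2 ^ q * (2 * C))) := ENNReal.ofReal_le_ofReal (le_max_right _ _)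
    _ ≤ _ := le_self_pow (by rwa [ENNReal.one_le_ofReal]) (by omega)

/-- A process of random distributions with values in `H` that satisfies the second moment
bounds on its Paley-Littlewood blocks. -/
structure HasBlockBounds (T : ℝ) (H : Submodule ℝ (Lp ℝ 2 P)) (α δ A B : ℝ)
    (ψ : ℝ → Ω → CircleDistribution) : Prop where
  values : ∀ t ∈ Set.Icc (0 : ℝ) T, TakesValuesIn H (ψ t)
  sq_le : ∀ (n : ℕ) (x : ℝ), ∀ t ∈ Set.Icc (0 : ℝ) T,
    ∫ ω, ‖block n (ψ t ω) x‖ ^ 2 ∂P ≤ A * (2 : ℝ) ^ (-2 * (n : ℝ) * α)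
  sub_sq_le : ∀ (n : ℕ) (x : ℝ), ∀ t ∈ Set.Icc (0 : ℝ) T, ∀ s ∈ Set.Icc (0 : ℝ) T,
    ∫ ω, ‖block n (ψ t ω) x - block n (ψ s ω) x‖ ^ 2 ∂P
      ≤ B * (2 : ℝ) ^ (-2 * (n : ℝ) * α) * |t - s| ^ δ

/-- The hypotheses on a process are inherited by its modifications. -/
lemma HasBlockBounds.congr {T : ℝ} {H : Submodule ℝ (Lp ℝ 2 P)} {α δ A B : ℝ}
    {ψ ψ' : ℝ → Ω → CircleDistribution} (h : HasBlockBounds T H α δ A B ψ)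
    (hψ : IsModificationOn P T ψ' ψ) : HasBlockBounds T H α δ A B ψ' where
  values t ht φ := by
    obtain ⟨f, hf, g, hg, h1, h2⟩ := h.values t ht φ
    refine ⟨f, hf, g, hg, ?_, ?_⟩
    · filter_upwards [h1, hψ t ht] with ω h3 h4
      rw [h4, h3]
    · filter_upwards [h2, hψ t ht] with ω h3 h4
      rw [h4, h3]
  sq_le n x t ht := by
    refine le_trans (le_of_eq (integral_congr_ae ?_)) (h.sq_le n x t ht)
    filter_upwards [hψ t ht] with ω h4
    rw [h4]
  sub_sq_le n x t ht s hs := by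
    refine le_trans (le_of_eq (integral_congr_ae ?_)) (h.sub_sq_le n x t ht s hs)
    filter_upwards [hψ t ht, hψ s hs] with ω h4 h5
    rw [h4, h5]

/-- The grid bound of `IsTrigPoly.supNorm_le_grid` for the degree `2 ^ n`. -/
def gridBound (p n : ℕ) (f : ℝ → ℂ) : ℝ≥0∞ :=
  2 * (∑ i ∈ Finset.range (32 * 2 ^ n),
      ‖f (2 * Real.pi * i / (32 * (2 ^ n : ℕ)))‖ₑ ^ p) ^ (1 / (p : ℝ))

/-- A bound for the increments of the `n`th block over the dyadic intervals of level `i`: the grid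
bound, summed over the `2 ^ i` intervals as well. -/
def incrBound (p : ℕ) (T : ℝ) (ψ : ℝ → CircleDistribution) (n i : ℕ) : ℝ≥0∞ :=
  2 * (∑ x ∈ Finset.range (2 ^ i) ×ˢ Finset.range (32 * 2 ^ n),
      ‖block n (ψ (dyadicTime T i (x.1 + 1))) (2 * Real.pi * x.2 / (32 * (2 ^ n : ℕ))) -
        block n (ψ (dyadicTime T i x.1)) (2 * Real.pi * x.2 / (32 * (2 ^ n : ℕ)))‖ₑ ^ p)
          ^ (1 / (p : ℝ))

/-- A bound for the supremum over `[0,T]` of the `n`th block, from its value at time `0` and dyadic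
chaining. -/
def blockBound (p : ℕ) (T : ℝ) (ψ : ℝ → CircleDistribution) (n : ℕ) : ℝ≥0∞ :=
  gridBound p n (block n (ψ 0)) + ∑' i, incrBound p T ψ n i

/-- A bound for the supremum over `[0,T]` of the `C^γ` norm, up to a factor `3`. It involves only the
values of `ψ` at dyadic times, so that it is measurable. -/
def pathBound (p : ℕ) (T γ : ℝ) (ψ : ℝ → CircleDistribution) : ℝ≥0∞ :=
  ∑' n : ℕ, ENNReal.ofReal ((2 : ℝ) ^ (γ * (n : ℝ))) * blockBound p T ψ n

lemma supNorm_le_gridBound {p : ℕ} (hp : p ≠ 0) {n : ℕ} {f : ℝ → ℂ} (hf : IsTrigPoly (2 ^ n) f) :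
    supNorm f ≤ gridBound p n f := hf.supNorm_le_grid (by positivity) hp

lemma supNorm_sub_le_incrBound {p : ℕ} (hp : p ≠ 0) (T : ℝ) (ψ : ℝ → CircleDistribution)
    (n i j : ℕ) (hj : j < 2 ^ i) :
    supNorm (fun x => block n (ψ (dyadicTime T i (j + 1))) x -
      block n (ψ (dyadicTime T i j)) x) ≤ incrBound p T ψ n i := by
  refine (supNorm_le_gridBound hp ((isTrigPoly_block n _).sub (isTrigPoly_block n _))).trans ?_
  rw [gridBound, incrBound]
  gcongr
  rw [Finset.sum_product]
  exact Finset.single_le_sum (f := fun j : ℕ => ∑ i_1 ∈ Finset.range (32 * 2 ^ n),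
    ‖block n (ψ (dyadicTime T i (j + 1))) (2 * Real.pi * i_1 / (32 * (2 ^ n : ℕ))) -
      block n (ψ (dyadicTime T i j)) (2 * Real.pi * i_1 / (32 * (2 ^ n : ℕ)))‖ₑ ^ p)
    (fun _ _ => zero_le) (Finset.mem_range.2 hj)

variable {T : ℝ} {H : Submodule ℝ (Lp ℝ 2 P)} {α δ A B : ℝ} {ψ : ℝ → Ω → CircleDistribution}

namespace HasBlockBounds

lemma exists_re_im (h : HasBlockBounds T H α δ A B ψ) {t : ℝ} (ht : t ∈ Set.Icc (0 : ℝ) T)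
    (n : ℕ) (x : ℝ) : ∃ f ∈ H, ∃ g ∈ H,
      (fun ω => (block n (ψ t ω) x).re) =ᵐ[P] (f : Ω → ℝ) ∧
      (fun ω => (block n (ψ t ω) x).im) =ᵐ[P] (g : Ω → ℝ) := by
  simpa only [block_eq_toLin] using h.values t ht (blockTest n x)

lemma exists_re_im_sub (h : HasBlockBounds T H α δ A B ψ) {s t : ℝ} (ht : t ∈ Set.Icc (0 : ℝ) T)
    (hs : s ∈ Set.Icc (0 : ℝ) T) (n : ℕ) (x : ℝ) : ∃ f ∈ H, ∃ g ∈ H,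
      (fun ω => (block n (ψ t ω) x - block n (ψ s ω) x).re) =ᵐ[P] (f : Ω → ℝ) ∧
      (fun ω => (block n (ψ t ω) x - block n (ψ s ω) x).im) =ᵐ[P] (g : Ω → ℝ) := by
  obtain ⟨f, hf, g, hg, h1, h2⟩ := h.exists_re_im ht n x
  obtain ⟨f', hf', g', hg', h1', h2'⟩ := h.exists_re_im hs n x
  refine ⟨f - f', H.sub_mem hf hf', g - g', H.sub_mem hg hg', ?_, ?_⟩
  · filter_upwards [h1, h1', Lp.coeFn_sub f f'] with ω a b c
    rw [c, Pi.sub_apply, ← a, ← b, Complex.sub_re]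
  · filter_upwards [h2, h2', Lp.coeFn_sub g g'] with ω a b c
    rw [c, Pi.sub_apply, ← a, ← b, Complex.sub_im]

lemma aemeasurable_block (h : HasBlockBounds T H α δ A B ψ) {t : ℝ} (ht : t ∈ Set.Icc (0 : ℝ) T)
    (n : ℕ) (x : ℝ) : AEMeasurable (fun ω => block n (ψ t ω) x) P := by
  obtain ⟨f, hf, g, hg, h1, h2⟩ := h.exists_re_im ht n x
  exact aemeasurable_of_re_im_eq_Lp h1 h2

lemma aemeasurable_gridBound_sub (h : HasBlockBounds T H α δ A B ψ) {s t : ℝ}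
    (ht : t ∈ Set.Icc (0 : ℝ) T) (hs : s ∈ Set.Icc (0 : ℝ) T) (p n : ℕ) :
    AEMeasurable (fun ω => gridBound p n fun x => block n (ψ t ω) x - block n (ψ s ω) x) P := by
  refine AEMeasurable.const_mul (AEMeasurable.pow_const ?_ _) _
  exact Finset.aemeasurable_fun_sum _ fun i _ =>
    ((h.aemeasurable_block ht n _).sub (h.aemeasurable_block hs n _)).enorm.pow_const _

lemma aemeasurable_pathBound (hT : 0 < T) (h : HasBlockBounds T H α δ A B ψ) (p : ℕ) (γ : ℝ) :
    AEMeasurable (fun ω => pathBound p T γ fun t => ψ t ω) P := by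
  refine AEMeasurable.tsum fun n => AEMeasurable.const_mul (AEMeasurable.add ?_
    (AEMeasurable.tsum fun i => ?_)) _
  · refine AEMeasurable.const_mul (AEMeasurable.pow_const ?_ _) _
    exact Finset.aemeasurable_fun_sum _ fun i _ =>
      (h.aemeasurable_block ⟨le_rfl, hT.le⟩ n _).enorm.pow_const _
  · refine AEMeasurable.const_mul (AEMeasurable.pow_const ?_ _) _
    refine Finset.aemeasurable_fun_sum _ fun x hx => ?_
    have hx := Finset.mem_range.1 (Finset.mem_product.1 hx).1
    exact ((h.aemeasurable_block (dyadicTime_mem hT hx) n _).sub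
      (h.aemeasurable_block (dyadicTime_mem hT hx.le) n _)).enorm.pow_const _

end HasBlockBounds

/-- The cost of the maximum over `2 ^ k` dyadic intervals and `32 * 2 ^ n` grid points. -/
lemma natCast_rpow_le (n : ℕ) {ε : ℝ} (hε0 : 0 ≤ ε) (hε1 : ε ≤ 1) (k : ℕ) :
    ((2 ^ k * (32 * 2 ^ n) : ℕ) : ℝ≥0∞) ^ ε ≤
      ENNReal.ofReal (32 * ((2 : ℝ) ^ ε) ^ n * ((2 : ℝ) ^ ε) ^ k) := by
  have e : ((2 ^ k * (32 * 2 ^ n) : ℕ) : ℝ≥0∞) = ENNReal.ofReal (2 ^ k * (32 * 2 ^ n)) := by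
    rw [← ENNReal.ofReal_natCast]; push_cast; rfl
  rw [e, ENNReal.ofReal_rpow_of_nonneg (by positivity) hε0]
  refine ENNReal.ofReal_le_ofReal ?_
  rw [Real.mul_rpow (by positivity) (by positivity), Real.mul_rpow (by positivity) (by positivity)]
  have e2 : ∀ j : ℕ, ((2 : ℝ) ^ j) ^ ε = ((2 : ℝ) ^ ε) ^ j := fun j => by
    rw [← Real.rpow_natCast, ← Real.rpow_mul (by norm_num), mul_comm, Real.rpow_mul (by norm_num),
      Real.rpow_natCast]
  rw [e2, e2]
  have : (32 : ℝ) ^ ε ≤ 32 := by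
    simpa using Real.rpow_le_rpow_of_exponent_le (by norm_num : (1:ℝ) ≤ 32) hε1
  calc _ ≤ ((2:ℝ) ^ ε) ^ k * (32 * ((2:ℝ) ^ ε) ^ n) := by gcongr
    _ = _ := by ring

lemma sqrt_two_rpow (n : ℕ) (α : ℝ) :
    Real.sqrt ((2 : ℝ) ^ (-2 * (n : ℝ) * α)) = ((2 : ℝ) ^ (-α)) ^ n := by
  rw [Real.sqrt_eq_rpow, ← Real.rpow_mul (by norm_num), ← Real.rpow_natCast,
    ← Real.rpow_mul (by norm_num)]
  congr 1; ring

namespace HasBlockBounds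
variable [IsProbabilityMeasure P] {q : ℕ} {D : ℝ}

lemma lintegral_gridBound_le (hT : 0 < T) (hq : 1 ≤ q) (hD : MomentBound H q D)
    (hA : 0 ≤ A) (h : HasBlockBounds T H α δ A B ψ) (n : ℕ) :
    ∫⁻ ω, gridBound (2 * q) n (block n (ψ 0 ω)) ∂P ≤ ENNReal.ofReal
      (64 * D * Real.sqrt A * ((2 : ℝ) ^ (1 / ((2 * q : ℕ) : ℝ) - α)) ^ n) := by
  have h0 : (0 : ℝ) ∈ Set.Icc (0 : ℝ) T := ⟨le_rfl, hT.le⟩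
  set a := A * (2 : ℝ) ^ (-2 * (n : ℝ) * α) with ha
  have ha0 : 0 ≤ a := by positivity
  refine (lintegral_sum_rpow_le (Finset.range (32 * 2 ^ n))
    (Y := fun (i : ℕ) ω => block n (ψ 0 ω) (2 * Real.pi * i / (32 * (2 ^ n : ℕ))))
    (fun i _ => h.aemeasurable_block h0 n _) (by omega)
    (fun i _ => hD _ a ha0 (h.exists_re_im h0 n _) (h.sq_le n _ 0 h0))).trans ?_
  have hε1 : 1 / ((2 * q : ℕ) : ℝ) ≤ 1 := by
    rw [div_le_one (by positivity)]; exact_mod_cast (by omega : 1 ≤ 2 * q)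
  have hc := natCast_rpow_le n (by positivity : 0 ≤ 1 / ((2 * q : ℕ) : ℝ)) hε1 0
  rw [pow_zero, one_mul, pow_zero, mul_one] at hc
  rw [Finset.card_range]
  refine (mul_le_mul_right (mul_le_mul_left hc _) 2).trans (le_of_eq ?_)
  rw [← ENNReal.ofReal_mul (by positivity), ← ENNReal.ofReal_ofNat, ← ENNReal.ofReal_mul (by norm_num),
    ha, Real.sqrt_mul hA, sqrt_two_rpow, sub_eq_add_neg, Real.rpow_add (by norm_num), mul_pow]
  congr 1; ring

lemma lintegral_gridBound_sub_le (hq : 1 ≤ q) (hD : MomentBound H q D)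
    (hB : 0 ≤ B) (h : HasBlockBounds T H α δ A B ψ) {s t : ℝ} (ht : t ∈ Set.Icc (0 : ℝ) T)
    (hs : s ∈ Set.Icc (0 : ℝ) T) (n : ℕ) :
    ∫⁻ ω, gridBound (2 * q) n (fun x => block n (ψ t ω) x - block n (ψ s ω) x) ∂P ≤ ENNReal.ofReal
      (64 * D * Real.sqrt B * ((2 : ℝ) ^ (1 / ((2 * q : ℕ) : ℝ) - α)) ^ n * |t - s| ^ (δ / 2)) := by
  set a := B * (2 : ℝ) ^ (-2 * (n : ℝ) * α) * |t - s| ^ δ with ha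
  have ha0 : 0 ≤ a := by positivity
  refine (lintegral_sum_rpow_le (Finset.range (32 * 2 ^ n))
    (Y := fun (i : ℕ) ω => block n (ψ t ω) (2 * Real.pi * i / (32 * (2 ^ n : ℕ))) -
      block n (ψ s ω) (2 * Real.pi * i / (32 * (2 ^ n : ℕ))))
    (fun i _ => (h.aemeasurable_block ht n _).sub (h.aemeasurable_block hs n _)) (by omega)
    (fun i _ => hD _ a ha0 (h.exists_re_im_sub ht hs n _) (h.sub_sq_le n _ t ht s hs))).trans ?_
  have hε1 : 1 / ((2 * q : ℕ) : ℝ) ≤ 1 := by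
    rw [div_le_one (by positivity)]; exact_mod_cast (by omega : 1 ≤ 2 * q)
  have hc := natCast_rpow_le n (by positivity : 0 ≤ 1 / ((2 * q : ℕ) : ℝ)) hε1 0
  rw [pow_zero, one_mul, pow_zero, mul_one] at hc
  rw [Finset.card_range]
  refine (mul_le_mul_right (mul_le_mul_left hc _) 2).trans (le_of_eq ?_)
  have e : Real.sqrt (|t - s| ^ δ) = |t - s| ^ (δ / 2) := by
    rw [Real.sqrt_eq_rpow, ← Real.rpow_mul (abs_nonneg _)]; congr 1; ring
  rw [← ENNReal.ofReal_mul (by positivity), ← ENNReal.ofReal_ofNat, ← ENNReal.ofReal_mul (by norm_num),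
    ha, Real.sqrt_mul (by positivity), Real.sqrt_mul hB, sqrt_two_rpow, e, sub_eq_add_neg (1 / _),
    Real.rpow_add (by norm_num), mul_pow]
  congr 1; ring

lemma lintegral_incrBound_le (hT : 0 < T) (hq : 1 ≤ q) (hD : MomentBound H q D)
    (hB : 0 ≤ B) (h : HasBlockBounds T H α δ A B ψ) (n i : ℕ) :
    ∫⁻ ω, incrBound (2 * q) T (fun t => ψ t ω) n i ∂P ≤ ENNReal.ofReal
      (64 * D * Real.sqrt B * T ^ (δ / 2) * ((2 : ℝ) ^ (1 / ((2 * q : ℕ) : ℝ) - α)) ^ n *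
        ((2 : ℝ) ^ (1 / ((2 * q : ℕ) : ℝ) - δ / 2)) ^ i) := by
  have h2 : (0 : ℝ) < 2 ^ i := by positivity
  set a := B * (2 : ℝ) ^ (-2 * (n : ℝ) * α) * (T / 2 ^ i) ^ δ with ha
  have ha0 : 0 ≤ a := by positivity
  have hmem : ∀ x ∈ Finset.range (2 ^ i) ×ˢ Finset.range (32 * 2 ^ n),
      dyadicTime T i (x.1 + 1) ∈ Set.Icc (0 : ℝ) T ∧ dyadicTime T i x.1 ∈ Set.Icc (0 : ℝ) T :=
    fun x hx => by
      have hx := Finset.mem_range.1 (Finset.mem_product.1 hx).1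
      exact ⟨dyadicTime_mem hT hx, dyadicTime_mem hT hx.le⟩
  have hdist : ∀ j : ℕ, |dyadicTime T i (j + 1) - dyadicTime T i j| = T / 2 ^ i := fun j => by
    have : dyadicTime T i (j + 1) - dyadicTime T i j = T / 2 ^ i := by
      simp only [dyadicTime]; push_cast; field_simp; ring
    rw [this, abs_of_pos (by positivity)]
  refine (lintegral_sum_rpow_le (Finset.range (2 ^ i) ×ˢ Finset.range (32 * 2 ^ n))
    (Y := fun x ω =>
      block n (ψ (dyadicTime T i (x.1 + 1)) ω) (2 * Real.pi * x.2 / (32 * (2 ^ n : ℕ))) -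
        block n (ψ (dyadicTime T i x.1) ω) (2 * Real.pi * x.2 / (32 * (2 ^ n : ℕ))))
    (fun x hx => (h.aemeasurable_block (hmem x hx).1 n _).sub
      (h.aemeasurable_block (hmem x hx).2 n _)) (by omega)
    (fun x hx => hD _ a ha0 (h.exists_re_im_sub (hmem x hx).1 (hmem x hx).2 n _) (by
      have := h.sub_sq_le n (2 * Real.pi * x.2 / (32 * (2 ^ n : ℕ))) _ (hmem x hx).1 _ (hmem x hx).2
      rwa [hdist] at this))).trans ?_
  have hε1 : 1 / ((2 * q : ℕ) : ℝ) ≤ 1 := by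
    rw [div_le_one (by positivity)]; exact_mod_cast (by omega : 1 ≤ 2 * q)
  have hc := natCast_rpow_le n (by positivity : 0 ≤ 1 / ((2 * q : ℕ) : ℝ)) hε1 i
  rw [Finset.card_product, Finset.card_range, Finset.card_range]
  refine (mul_le_mul_right (mul_le_mul_left hc _) 2).trans (le_of_eq ?_)
  have e : Real.sqrt ((T / 2 ^ i) ^ δ) = T ^ (δ / 2) * ((2 : ℝ) ^ (-(δ / 2))) ^ i := by
    rw [Real.sqrt_eq_rpow, ← Real.rpow_mul (by positivity), Real.div_rpow hT.le h2.le,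
      ← Real.rpow_natCast, ← Real.rpow_natCast, ← Real.rpow_mul (by norm_num),
      ← Real.rpow_mul (by norm_num), div_eq_mul_inv, ← Real.rpow_neg (by norm_num)]
    congr 2 <;> ring
  rw [← ENNReal.ofReal_mul (by positivity), ← ENNReal.ofReal_ofNat, ← ENNReal.ofReal_mul (by norm_num),
    ha, Real.sqrt_mul (by positivity), Real.sqrt_mul hB, sqrt_two_rpow, e,
    sub_eq_add_neg, sub_eq_add_neg,
    Real.rpow_add (by norm_num), Real.rpow_add (by norm_num), mul_pow, mul_pow]
  congr 1; ring

lemma tsum_ofReal_mul_geometric {c r : ℝ} (hc : 0 ≤ c) (hr0 : 0 ≤ r) (hr1 : r < 1) :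
    ∑' n : ℕ, ENNReal.ofReal (c * r ^ n) = ENNReal.ofReal (c * (1 - r)⁻¹) := by
  rw [← ENNReal.ofReal_tsum_of_nonneg (fun n => by positivity)
    ((summable_geometric_of_lt_one hr0 hr1).mul_left c), tsum_mul_left,
    tsum_geometric_of_lt_one hr0 hr1]

/-- The expectation of the path bound: with `ε = 1 / (2q)`, the maxima over the grids cost the factors
`2^{εn}` and `2^{εi}`, and the geometric series in `n` and `i` converge for `ε < α - γ` and
`ε < δ / 2`. -/
lemma lintegral_pathBound_le (hT : 0 < T) (hq : 1 ≤ q) (hD : MomentBound H q D) (hD0 : 0 ≤ D)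
    (hA : 0 ≤ A) (hB : 0 ≤ B) (h : HasBlockBounds T H α δ A B ψ) {γ : ℝ}
    (hqγ : 1 / ((2 * q : ℕ) : ℝ) < α - γ) (hqδ : 1 / ((2 * q : ℕ) : ℝ) < δ / 2) :
    ∫⁻ ω, pathBound (2 * q) T γ (fun t => ψ t ω) ∂P ≤ ENNReal.ofReal
      (64 * D * (1 + T ^ (δ / 2) * (1 - (2 : ℝ) ^ (1 / ((2 * q : ℕ) : ℝ) - δ / 2))⁻¹) *
        (1 - (2 : ℝ) ^ (γ + (1 / ((2 * q : ℕ) : ℝ) - α)))⁻¹ * Real.sqrt (A + B)) := by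
  set ε := 1 / ((2 * q : ℕ) : ℝ) with hε
  set r₁ := (2 : ℝ) ^ (γ + (ε - α)) with hr₁
  set r₂ := (2 : ℝ) ^ (ε - δ / 2) with hr₂
  have hr₁0 : 0 ≤ r₁ := by positivity
  have hr₂0 : 0 ≤ r₂ := by positivity
  have hr₁1 : r₁ < 1 := Real.rpow_lt_one_of_one_lt_of_neg (by norm_num) (by linarith)
  have hr₂1 : r₂ < 1 := Real.rpow_lt_one_of_one_lt_of_neg (by norm_num) (by linarith)
  have hi₁ : 0 ≤ (1 - r₁)⁻¹ := inv_nonneg.2 (by linarith)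
  have hi₂ : 0 ≤ (1 - r₂)⁻¹ := inv_nonneg.2 (by linarith)
  set S := Real.sqrt (A + B) with hS
  have hAS : Real.sqrt A ≤ S := Real.sqrt_le_sqrt (by linarith)
  have hBS : Real.sqrt B ≤ S := Real.sqrt_le_sqrt (by linarith)
  set κ := (2 : ℝ) ^ (ε - α) with hκ
  have hκ0 : 0 ≤ κ := by positivity
  have hT0 : 0 ≤ T ^ (δ / 2) := by positivity
  have hS0 : 0 ≤ S := Real.sqrt_nonneg _
  have h0 : (0 : ℝ) ∈ Set.Icc (0 : ℝ) T := ⟨le_rfl, hT.le⟩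
  have hmg : ∀ n, AEMeasurable (fun ω => gridBound (2 * q) n (block n (ψ 0 ω))) P := fun n => by
    refine AEMeasurable.const_mul (AEMeasurable.pow_const ?_ _) _
    exact Finset.aemeasurable_fun_sum _ fun i _ =>
      (h.aemeasurable_block h0 n _).enorm.pow_const _
  have hmi : ∀ n i, AEMeasurable (fun ω => incrBound (2 * q) T (fun t => ψ t ω) n i) P := by
    intro n i
    refine AEMeasurable.const_mul (AEMeasurable.pow_const ?_ _) _
    refine Finset.aemeasurable_fun_sum _ fun x hx => ?_
    have hx := Finset.mem_range.1 (Finset.mem_product.1 hx).1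
    exact ((h.aemeasurable_block (dyadicTime_mem hT hx) n _).sub
      (h.aemeasurable_block (dyadicTime_mem hT hx.le) n _)).enorm.pow_const _
  have hblock : ∀ n, ∫⁻ ω, blockBound (2 * q) T (fun t => ψ t ω) n ∂P ≤
      ENNReal.ofReal (64 * D * S * (1 + T ^ (δ / 2) * (1 - r₂)⁻¹) * κ ^ n) := by
    intro n
    simp only [blockBound]
    rw [lintegral_add_left' (hmg n), lintegral_tsum fun i => hmi n i]
    calc _ ≤ ENNReal.ofReal (64 * D * S * κ ^ n) +
          ∑' i : ℕ, ENNReal.ofReal (64 * D * S * T ^ (δ / 2) * κ ^ n * r₂ ^ i) := by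
          refine add_le_add ((h.lintegral_gridBound_le hT hq hD hA n).trans
            (ENNReal.ofReal_le_ofReal ?_)) (ENNReal.tsum_le_tsum fun i =>
            (h.lintegral_incrBound_le hT hq hD hB n i).trans (ENNReal.ofReal_le_ofReal ?_))
          · gcongr
          · gcongr
      _ = _ := by
          rw [tsum_ofReal_mul_geometric (by positivity) hr₂0 hr₂1,
            ← ENNReal.ofReal_add (by positivity) (by positivity)]
          congr 1; ring
  have hmb : ∀ n, AEMeasurable (fun ω => blockBound (2 * q) T (fun t => ψ t ω) n) P := fun n =>
    (hmg n).add (AEMeasurable.tsum fun i => hmi n i)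
  simp only [pathBound]
  rw [lintegral_tsum fun n => (hmb n).const_mul _]
  calc _ ≤ ∑' n : ℕ, ENNReal.ofReal (64 * D * S * (1 + T ^ (δ / 2) * (1 - r₂)⁻¹) * r₁ ^ n) := by
        refine ENNReal.tsum_le_tsum fun n => ?_
        rw [lintegral_const_mul' _ _ ENNReal.ofReal_ne_top]
        refine (mul_le_mul_right (hblock n) _).trans (le_of_eq ?_)
        rw [← ENNReal.ofReal_mul (by positivity)]
        have : r₁ ^ n = (2 : ℝ) ^ (γ * n) * κ ^ n := by
          rw [hr₁, Real.rpow_add (by norm_num), mul_pow, Real.rpow_mul (by norm_num),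
            Real.rpow_natCast]
        rw [this]
        congr 1; ring
    _ = _ := by
        rw [tsum_ofReal_mul_geometric (by positivity) hr₁0 hr₁1]
        congr 1; ring

end HasBlockBounds
end

/-! ### Paths that are continuous in the sense of distributions -/

section
variable {T : ℝ} {p : ℕ} {ψ : ℝ → CircleDistribution}

lemma edist_block_le_incrBound (hp : p ≠ 0) (n : ℕ) (x : ℝ) (i j : ℕ) (hj : j < 2 ^ i) :
    edist (block n (ψ (dyadicTime T i (j + 1))) x) (block n (ψ (dyadicTime T i j)) x) ≤
      incrBound p T ψ n i := by
  rw [edist_eq_enorm_sub]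
  exact (le_iSup (fun x => ‖block n (ψ (dyadicTime T i (j + 1))) x -
    block n (ψ (dyadicTime T i j)) x‖ₑ) x).trans (supNorm_sub_le_incrBound hp T ψ n i j hj)

lemma tendsto_block_dyadicFloor (hT : 0 < T)
    (hψ : ∀ φ : CircleTest, ContinuousOn (fun t => (ψ t).toLin φ) (Set.Icc (0 : ℝ) T))
    {t : ℝ} (ht : t ∈ Set.Icc (0 : ℝ) T) (n : ℕ) (x : ℝ) :
    Filter.Tendsto (fun k => block n (ψ (dyadicFloor T k t)) x) Filter.atTop
      (nhds (block n (ψ t) x)) := by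
  simp only [block_eq_toLin]
  exact ((hψ (blockTest n x)) t ht).tendsto.comp (tendsto_nhdsWithin_iff.2
    ⟨tendsto_dyadicFloor hT ht, Filter.Eventually.of_forall fun k => dyadicFloor_mem hT ht k⟩)

lemma supNorm_block_le_blockBound (hT : 0 < T) (hp : p ≠ 0)
    (hψ : ∀ φ : CircleTest, ContinuousOn (fun t => (ψ t).toLin φ) (Set.Icc (0 : ℝ) T))
    {t : ℝ} (ht : t ∈ Set.Icc (0 : ℝ) T) (n : ℕ) :
    supNorm (block n (ψ t)) ≤ blockBound p T ψ n := by
  refine iSup_le fun x => ?_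
  refine le_of_tendsto ((continuous_enorm.tendsto _).comp
    (tendsto_block_dyadicFloor hT hψ ht n x)) (Filter.Eventually.of_forall fun k => ?_)
  have h1 := edist_dyadicFloor_zero_le hT (F := fun t => block n (ψ t) x)
    (fun i j hj => edist_block_le_incrBound hp n x i j hj) ht k
  have h2 : ‖block n (ψ 0) x‖ₑ ≤ gridBound p n (block n (ψ 0)) :=
    (le_iSup (fun x => ‖block n (ψ 0) x‖ₑ) x).trans
      (supNorm_le_gridBound hp (isTrigPoly_block n _))
  rw [edist_eq_enorm_sub] at h1
  calc ‖block n (ψ (dyadicFloor T k t)) x‖ₑ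
      = ‖block n (ψ 0) x + (block n (ψ (dyadicFloor T k t)) x - block n (ψ 0) x)‖ₑ := by
        rw [add_sub_cancel]
    _ ≤ ‖block n (ψ 0) x‖ₑ + ‖block n (ψ (dyadicFloor T k t)) x - block n (ψ 0) x‖ₑ :=
        enorm_add_le _ _
    _ ≤ _ := add_le_add h2 h1

/-- For a weakly continuous path, the norm at every time is controlled by the values at dyadic times. -/
lemma iSup_cNorm_le_pathBound (hT : 0 < T) (hp : p ≠ 0) {γ : ℝ} (hγ0 : γ ≠ 0) (hγ1 : γ < 1)
    (hψ : ∀ φ : CircleTest, ContinuousOn (fun t => (ψ t).toLin φ) (Set.Icc (0 : ℝ) T)) :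
    ⨆ t ∈ Set.Icc (0 : ℝ) T, cNorm γ (ψ t) ≤ 3 * pathBound p T γ ψ := by
  refine iSup₂_le fun t ht => (cNorm_le_tsum hγ0 hγ1 _).trans ?_
  refine mul_le_mul_right (ENNReal.tsum_le_tsum fun n => ?_) _
  exact mul_le_mul_right (supNorm_block_le_blockBound hT hp hψ ht n) _

end

/-! ### Semicontinuity and measurability of the norms -/

namespace CircleDistribution

/-- The Hölder norm as one supremum, of quantities that depend on finitely many values of `f`. -/
lemma add_holderSeminorm_le_iff {γ : ℝ} {f : ℝ → ℂ} {R : ℝ≥0∞} :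
    supNorm f + holderSeminorm γ f ≤ R ↔ ∀ x y z : ℝ, y ≠ z →
      ‖f x‖ₑ + ‖f y - f z‖ₑ / ENNReal.ofReal (|y - z| ^ γ) ≤ R := by
  constructor
  · intro h x y z hyz
    refine (add_le_add (le_iSup (fun x => ‖f x‖ₑ) x) ?_).trans h
    exact le_iSup_of_le y (le_iSup_of_le z (le_iSup_of_le hyz le_rfl))
  · intro h
    refine ENNReal.iSup_add_iSup_le fun x y => ?_
    rw [ENNReal.add_iSup]
    refine iSup_le fun z => ?_
    by_cases hyz : y = z
    · simp only [hyz, ne_eq, not_true_eq_false, iSup_false, bot_eq_zero, add_zero]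
      exact le_self_add.trans (h x 0 1 (by norm_num))
    · simp only [ne_eq, hyz, not_false_eq_true, iSup_true]
      exact h x y z hyz

/-- The `C^γ` norm is lower semicontinuous along weakly convergent sequences with summable
bounds for the blocks. For positive `γ` these bounds are what makes the representing continuous
functions converge pointwise. -/
lemma cNorm_le_of_tendsto {γ : ℝ} (hγ0 : γ ≠ 0) {u : ℕ → CircleDistribution}
    {v : CircleDistribution} {z : ℕ → ℝ≥0∞}
    (hz : ∑' n : ℕ, ENNReal.ofReal ((2 : ℝ) ^ (γ * (n : ℝ))) * z n ≠ ⊤)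
    (hu : ∀ k n, supNorm (block n (u k)) ≤ z n)
    (hv : ∀ n x, Filter.Tendsto (fun k => block n (u k) x) Filter.atTop (nhds (block n v x)))
    {R : ℝ≥0∞} (hR : ∀ k, cNorm γ (u k) ≤ R) : cNorm γ v ≤ R := by
  simp only [cNorm] at hR ⊢
  split_ifs at hR ⊢ with hneg
  · refine iSup_le fun n => ?_
    rw [supNorm, ENNReal.mul_iSup]
    refine iSup_le fun x => ?_
    refine le_of_tendsto (ENNReal.Tendsto.const_mul ((continuous_enorm.tendsto _).comp (hv n x))
      (Or.inr ENNReal.ofReal_ne_top)) (Filter.Eventually.of_forall fun k => ?_)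
    refine le_trans ?_ (hR k)
    refine le_iSup_of_le n ?_
    exact mul_le_mul_right (le_iSup (fun x => ‖block n (u k) x‖ₑ) x) _
  · have hpos : 0 < γ := lt_of_le_of_ne (not_lt.1 hneg) (Ne.symm hγ0)
    have hzs : ∑' n, z n ≠ ⊤ := by
      refine ne_top_of_le_ne_top hz (ENNReal.tsum_le_tsum fun n => le_mul_of_one_le_left zero_le ?_)
      rw [ENNReal.one_le_ofReal]
      exact Real.one_le_rpow (by norm_num) (by positivity)
    have hz1 : ∀ n, z n ≠ ⊤ := fun n => ENNReal.ne_top_of_tsum_ne_top hzs n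
    have hvz : ∀ n, supNorm (block n v) ≤ z n := fun n => iSup_le fun x =>
      le_of_tendsto ((continuous_enorm.tendsto _).comp (hv n x)) (Filter.Eventually.of_forall
        fun k => (le_iSup (fun x => ‖block n (u k) x‖ₑ) x).trans (hu k n))
    have hus : ∀ k, ∑' n, supNorm (block n (u k)) ≠ ⊤ := fun k =>
      ne_top_of_le_ne_top hzs (ENNReal.tsum_le_tsum fun n => hu k n)
    have hvs : ∑' n, supNorm (block n v) ≠ ⊤ :=
      ne_top_of_le_ne_top hzs (ENNReal.tsum_le_tsum hvz)
    have hlim : ∀ x, Filter.Tendsto (fun k => blockSum (u k) x) Filter.atTop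
        (nhds (blockSum v x)) := by
      intro x
      refine tendsto_tsum_of_dominated_convergence (bound := fun n => (z n).toReal)
        (ENNReal.summable_toReal hzs) (fun n => hv n x) (Filter.Eventually.of_forall fun k n => ?_)
      exact ((isTrigPoly_block n (u k)).norm_le x).trans (ENNReal.toReal_mono (hz1 n) (hu k n))
    rw [holderNorm_of_isRepresentedBy (isRepresentedBy_blockSum hvs), add_holderSeminorm_le_iff]
    intro x y w hyw
    have hden : ENNReal.ofReal (|y - w| ^ γ) ≠ 0 := by
      have : 0 < |y - w| := abs_pos.2 (sub_ne_zero.2 hyw)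
      simpa using Real.rpow_pos_of_pos this γ
    refine le_of_tendsto (((continuous_enorm.tendsto _).comp (hlim x)).add
      (ENNReal.Tendsto.div_const ((continuous_enorm.tendsto _).comp ((hlim y).sub (hlim w)))
        (Or.inr hden))) (Filter.Eventually.of_forall fun k => ?_)
    have := hR k
    rw [holderNorm_of_isRepresentedBy (isRepresentedBy_blockSum (hus k)),
      add_holderSeminorm_le_iff] at this
    exact this x y w hyw

lemma supNorm_eq_iSup_rat {f : ℝ → ℂ} (hf : Continuous f) :
    supNorm f = ⨆ r : ℚ, ‖f (r : ℝ)‖ₑ := by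
  refine le_antisymm (iSup_le fun x => ?_) (iSup_le fun r => le_iSup (fun x => ‖f x‖ₑ) (r : ℝ))
  refine Rat.denseRange_cast.induction_on (p := fun x : ℝ => ‖f x‖ₑ ≤ ⨆ r : ℚ, ‖f (r : ℝ)‖ₑ) x
    (isClosed_le hf.enorm continuous_const) fun r => ?_
  exact le_iSup (fun r : ℚ => ‖f (r : ℝ)‖ₑ) r

lemma holderSeminorm_eq_iSup_rat {γ : ℝ} (hγ : 0 < γ) {f : ℝ → ℂ} (hf : Continuous f) :
    holderSeminorm γ f = ⨆ (r : ℚ) (s : ℚ) (_ : r ≠ s),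
      ‖f (r : ℝ) - f (s : ℝ)‖ₑ / ENNReal.ofReal (|(r : ℝ) - s| ^ γ) := by
  set R := ⨆ (r : ℚ) (s : ℚ) (_ : r ≠ s),
      ‖f (r : ℝ) - f (s : ℝ)‖ₑ / ENNReal.ofReal (|(r : ℝ) - s| ^ γ) with hR
  have hden : ∀ x y : ℝ, x ≠ y → ENNReal.ofReal (|x - y| ^ γ) ≠ 0 := fun x y hxy => by
    have : 0 < |x - y| := abs_pos.2 (sub_ne_zero.2 hxy)
    simpa using Real.rpow_pos_of_pos this γ
  refine le_antisymm ?_ ?_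
  · by_cases hRt : R = ⊤
    · rw [hRt]; exact le_top
    refine iSup_le fun x => iSup_le fun y => iSup_le fun hxy => ?_
    rw [ENNReal.div_le_iff (hden x y hxy) ENNReal.ofReal_ne_top]
    have hd : DenseRange fun z : ℚ × ℚ => ((z.1 : ℝ), (z.2 : ℝ)) :=
      Rat.denseRange_cast.prodMap Rat.denseRange_cast
    refine hd.induction_on (p := fun z : ℝ × ℝ =>
      ‖f z.1 - f z.2‖ₑ ≤ R * ENNReal.ofReal (|z.1 - z.2| ^ γ)) (x, y) ?_ ?_
    · refine isClosed_le (by fun_prop) ((ENNReal.continuous_const_mul hRt).comp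
        (ENNReal.continuous_ofReal.comp ?_))
      exact (by fun_prop : Continuous fun z : ℝ × ℝ => |z.1 - z.2|).rpow_const
        fun _ => Or.inr hγ.le
    · rintro ⟨r, s⟩
      by_cases hrs : r = s
      · simp [hrs]
      · have hrs' : (r : ℝ) ≠ s := by exact_mod_cast hrs
        rw [← ENNReal.div_le_iff (hden _ _ hrs') ENNReal.ofReal_ne_top]
        exact le_iSup_of_le r (le_iSup_of_le s (le_iSup_of_le hrs le_rfl))
  · refine iSup_le fun r => iSup_le fun s => iSup_le fun hrs => ?_
    have hrs' : (r : ℝ) ≠ s := by exact_mod_cast hrs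
    exact le_iSup_of_le (r : ℝ) (le_iSup_of_le (s : ℝ) (le_iSup_of_le hrs' le_rfl))

/-- The norm is measurable, as a countable supremum; the summability of the blocks provides the
representing function as an almost sure limit. -/
lemma aemeasurable_cNorm {Ω : Type*} [MeasurableSpace Ω] {P : Measure Ω} {γ : ℝ} (hγ0 : γ ≠ 0)
    {u : Ω → CircleDistribution} (hu : ∀ n x, AEMeasurable (fun ω => block n (u ω) x) P)
    (hfin : ∀ᵐ ω ∂P, ∑' n : ℕ, ENNReal.ofReal ((2 : ℝ) ^ (γ * (n : ℝ))) *
      supNorm (block n (u ω)) ≠ ⊤) : AEMeasurable (fun ω => cNorm γ (u ω)) P := by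
  simp only [cNorm]
  split_ifs with hneg
  · simp only [besovNorm, supNorm_eq_iSup_rat (isTrigPoly_block _ _).continuous]
    exact AEMeasurable.iSup fun n => (AEMeasurable.iSup fun r : ℚ => (hu n r).enorm).const_mul _
  · have hpos : 0 < γ := lt_of_le_of_ne (not_lt.1 hneg) (Ne.symm hγ0)
    have hfin' : ∀ᵐ ω ∂P, ∑' n, supNorm (block n (u ω)) ≠ ⊤ := by
      filter_upwards [hfin] with ω hω
      refine ne_top_of_le_ne_top hω (ENNReal.tsum_le_tsum fun n => le_mul_of_one_le_left zero_le ?_)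
      rw [ENNReal.one_le_ofReal]
      exact Real.one_le_rpow (by norm_num) (by positivity)
    have hsum : ∀ x, AEMeasurable (fun ω => blockSum (u ω) x) P := by
      intro x
      refine aemeasurable_of_tendsto_metrizable_ae Filter.atTop
        (f := fun N ω => ∑ n ∈ Finset.range N, block n (u ω) x)
        (fun N => Finset.aemeasurable_fun_sum _ fun n _ => hu n x) ?_
      filter_upwards [hfin'] with ω hω
      exact (hasSum_block hω x).tendsto_sum_nat
    have hmeas : AEMeasurable (fun ω => (⨆ r : ℚ, ‖blockSum (u ω) (r : ℝ)‖ₑ) +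
        ⨆ (r : ℚ) (s : ℚ) (_ : r ≠ s), ‖blockSum (u ω) (r : ℝ) - blockSum (u ω) (s : ℝ)‖ₑ /
          ENNReal.ofReal (|(r : ℝ) - s| ^ γ)) P :=
      (AEMeasurable.iSup fun r : ℚ => (hsum r).enorm).add (AEMeasurable.iSup fun r : ℚ =>
        AEMeasurable.iSup fun s : ℚ => AEMeasurable.iSup fun _ =>
          ((hsum r).sub (hsum s)).enorm.div_const _)
    refine hmeas.congr ?_
    filter_upwards [hfin'] with ω hω
    rw [holderNorm_of_isRepresentedBy (isRepresentedBy_blockSum hω),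
      supNorm_eq_iSup_rat (continuous_blockSum hω),
      holderSeminorm_eq_iSup_rat hpos (continuous_blockSum hω)]

end CircleDistribution

section
variable {Ω : Type*} [MeasurableSpace Ω] {P : Measure Ω} {T : ℝ} {H : Submodule ℝ (Lp ℝ 2 P)}
  {α δ A B : ℝ} {ψ : ℝ → Ω → CircleDistribution}

/-- By lower semicontinuity, the supremum over `[0,T]` is the one over the dyadic times. -/
lemma HasBlockBounds.aemeasurable_iSup_cNorm (hT : 0 < T) (h : HasBlockBounds T H α δ A B ψ)
    {p : ℕ} (hp : p ≠ 0) {γ : ℝ} (hγ0 : γ ≠ 0)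
    (hfin : ∀ᵐ ω ∂P, pathBound p T γ (fun t => ψ t ω) ≠ ⊤) (hc : HasContinuousPathsOn P T ψ) :
    AEMeasurable (fun ω => ⨆ t ∈ Set.Icc (0 : ℝ) T, cNorm γ (ψ t ω)) P := by
  have hm : AEMeasurable (fun ω => ⨆ (k : ℕ) (j : ℕ) (_ : j ≤ 2 ^ k),
      cNorm γ (ψ (dyadicTime T k j) ω)) P := by
    refine AEMeasurable.iSup fun k => AEMeasurable.iSup fun j => AEMeasurable.iSup fun hj => ?_
    have ht := dyadicTime_mem hT hj
    refine aemeasurable_cNorm hγ0 (fun n x => h.aemeasurable_block ht n x) ?_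
    filter_upwards [hfin, hc] with ω h1 h2
    refine ne_top_of_le_ne_top h1 (ENNReal.tsum_le_tsum fun n => ?_)
    exact mul_le_mul_right (supNorm_block_le_blockBound hT hp h2 ht n) _
  refine hm.congr ?_
  filter_upwards [hfin, hc] with ω h1 h2
  refine le_antisymm ?_ ?_
  · refine iSup_le fun k => iSup_le fun j => iSup_le fun hj => ?_
    exact le_iSup₂_of_le (dyadicTime T k j) (dyadicTime_mem hT hj) le_rfl
  · refine iSup₂_le fun t ht => ?_
    refine cNorm_le_of_tendsto hγ0 (u := fun k => ψ (dyadicFloor T k t) ω) h1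
      (fun k n => supNorm_block_le_blockBound hT hp h2 (dyadicFloor_mem hT ht k) n)
      (fun n x => tendsto_block_dyadicFloor hT h2 ht n x) fun k => ?_
    exact le_iSup_of_le k (le_iSup₂_of_le _ (floor_le_two_pow hT ht k) le_rfl)
end

/-! ### The continuous modification -/

namespace CircleDistribution

lemma edist_coeff_le {n : ℕ} {k : ℤ} (hk : k ∈ dyadicFreq n) (u v : CircleDistribution) :
    edist (u.coeff k) (v.coeff k) ≤ ENNReal.ofReal (Real.sqrt (2 * Real.pi)) *
      supNorm fun x => block n u x - block n v x := by
  rw [edist_eq_enorm_sub, ← ofReal_norm]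
  refine (ENNReal.ofReal_le_ofReal (norm_coeff_sub_le hk u v)).trans (le_of_eq ?_)
  rw [ENNReal.ofReal_mul (Real.sqrt_nonneg _), ENNReal.ofReal_toReal
    ((isTrigPoly_block n u).sub (isTrigPoly_block n v)).supNorm_ne_top]

lemma enorm_coeff_le {n : ℕ} {k : ℤ} (hk : k ∈ dyadicFreq n) (u : CircleDistribution) :
    ‖u.coeff k‖ₑ ≤ ENNReal.ofReal (Real.sqrt (2 * Real.pi)) * supNorm (block n u) := by
  rw [← ofReal_norm]
  refine (ENNReal.ofReal_le_ofReal (norm_coeff_le hk u)).trans (le_of_eq ?_)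
  rw [ENNReal.ofReal_mul (Real.sqrt_nonneg _), ENNReal.ofReal_toReal
    (isTrigPoly_block n u).supNorm_ne_top]

/-- The dyadic weights `2^{-γn}` grow at most polynomially in the frequency `k` of the block `n`. -/
lemma two_rpow_size_le (γ : ℝ) (k : ℤ) :
    (2 : ℝ) ^ (-(γ * (Nat.size k.natAbs : ℝ))) ≤ 2 ^ ⌈|γ|⌉₊ * (1 + |(k : ℝ)|) ^ ⌈|γ|⌉₊ := by
  set n := Nat.size k.natAbs with hn
  have h1 : (2 : ℝ) ^ n ≤ 2 * (1 + |(k : ℝ)|) := by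
    have habs : |(k : ℝ)| = (k.natAbs : ℝ) := by
      rw [Nat.cast_natAbs, Int.cast_abs]
    rw [habs]
    rcases Nat.eq_zero_or_pos n with h | h
    · rw [h, pow_zero]
      have : (0 : ℝ) ≤ (k.natAbs : ℝ) := by positivity
      linarith
    · obtain ⟨m, hm⟩ : ∃ m, n = m + 1 := ⟨n - 1, by omega⟩
      have h2 : 2 ^ m ≤ k.natAbs := Nat.lt_size.1 (by omega)
      have h3 : (2 : ℝ) ^ m ≤ k.natAbs := by exact_mod_cast h2
      rw [hm, pow_succ]
      linarith
  calc (2 : ℝ) ^ (-(γ * (n : ℝ))) ≤ (2 : ℝ) ^ ((n : ℝ) * (⌈|γ|⌉₊ : ℝ)) := by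
        refine Real.rpow_le_rpow_of_exponent_le (by norm_num) ?_
        have h4 : -γ ≤ (⌈|γ|⌉₊ : ℝ) := (neg_le_abs γ).trans (Nat.le_ceil _)
        have h5 : (0 : ℝ) ≤ n := by positivity
        nlinarith
    _ = ((2 : ℝ) ^ n) ^ ⌈|γ|⌉₊ := by
        rw [Real.rpow_mul (by norm_num), Real.rpow_natCast, Real.rpow_natCast]
    _ ≤ _ := by rw [← mul_pow]; gcongr

end CircleDistribution

/-- A path of distributions with finite `pathBound` has a weakly continuous regularization, which
agrees with the path at every time at which the path is the limit of its dyadic values. -/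
lemma exists_continuous_path {T : ℝ} (hT : 0 < T) {p : ℕ} (hp : p ≠ 0) {γ : ℝ}
    {ψ : ℝ → CircleDistribution} (hψ : pathBound p T γ ψ ≠ ⊤) :
    ∃ ψ' : ℝ → CircleDistribution,
      (∀ φ : CircleTest, ContinuousOn (fun t => (ψ' t).toLin φ) (Set.Icc (0 : ℝ) T)) ∧
      ∀ t ∈ Set.Icc (0 : ℝ) T, (∀ n, Filter.Tendsto (fun k => gridBound p n fun x =>
        block n (ψ (dyadicFloor T k t)) x - block n (ψ t) x) Filter.atTop (nhds 0)) →
        ψ' t = ψ t := by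
  classical
  set κ := ENNReal.ofReal (Real.sqrt (2 * Real.pi)) with hκ
  set F : ℤ → ℝ → ℂ := fun k t => (ψ t).coeff k with hF
  set N : ℤ → ℕ := fun k => Nat.size k.natAbs with hN
  have hmem : ∀ k, k ∈ dyadicFreq (N k) := fun k => mem_dyadicFreq.2 rfl
  have hV : ∀ k i, ∀ j < 2 ^ i, edist (F k (dyadicTime T i (j + 1))) (F k (dyadicTime T i j)) ≤
      κ * incrBound p T ψ (N k) i := fun k i j hj =>
    (edist_coeff_le (hmem k) _ _).trans
      (mul_le_mul_right (supNorm_sub_le_incrBound hp T ψ (N k) i j hj) _)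
  have hbb : ∀ n, blockBound p T ψ n ≤
      ENNReal.ofReal ((2 : ℝ) ^ (-(γ * (n : ℝ)))) * pathBound p T γ ψ := by
    intro n
    have h1 : ENNReal.ofReal ((2 : ℝ) ^ (γ * (n : ℝ))) * blockBound p T ψ n ≤ pathBound p T γ ψ :=
      ENNReal.le_tsum (f := fun n : ℕ => ENNReal.ofReal ((2 : ℝ) ^ (γ * (n : ℝ))) *
        blockBound p T ψ n) n
    calc blockBound p T ψ n = ENNReal.ofReal ((2 : ℝ) ^ (-(γ * (n : ℝ)))) *
          (ENNReal.ofReal ((2 : ℝ) ^ (γ * (n : ℝ))) * blockBound p T ψ n) := by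
          rw [← mul_assoc, ← ENNReal.ofReal_mul (by positivity), ← Real.rpow_add (by norm_num),
            neg_add_cancel, Real.rpow_zero, ENNReal.ofReal_one, one_mul]
      _ ≤ _ := mul_le_mul_right h1 _
  have hbt : ∀ n, blockBound p T ψ n ≠ ⊤ := fun n =>
    ne_top_of_le_ne_top (ENNReal.mul_ne_top ENNReal.ofReal_ne_top hψ) (hbb n)
  have hVs : ∀ k, ∑' i, κ * incrBound p T ψ (N k) i ≠ ⊤ := fun k => by
    rw [ENNReal.tsum_mul_left]
    exact ENNReal.mul_ne_top ENNReal.ofReal_ne_top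
      (ne_top_of_le_ne_top (hbt (N k)) le_add_self)
  have hex : ∀ k t, ∃ a, t ∈ Set.Icc (0 : ℝ) T →
      Filter.Tendsto (fun i => F k (dyadicFloor T i t)) Filter.atTop (nhds a) := by
    intro k t
    by_cases ht : t ∈ Set.Icc (0 : ℝ) T
    · obtain ⟨a, ha⟩ := exists_tendsto_dyadicFloor hT (hV k) (hVs k) ht
      exact ⟨a, fun _ => ha⟩
    · exact ⟨0, fun h => absurd h ht⟩
  choose c hc using hex
  -- the coefficients `c k t` of the regularization grow at most like `|k| ^ L`
  set L := ⌈|γ|⌉₊ with hL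
  set K : ℝ := Real.sqrt (2 * Real.pi) * (2 ^ L * (pathBound p T γ ψ).toReal) with hK
  have hgrowth : ∀ t ∈ Set.Icc (0 : ℝ) T, ∀ k, ‖c k t‖ ≤ K * (1 + |(k : ℝ)|) ^ L := by
    intro t ht k
    have h1 : ‖c k t‖ₑ ≤ κ * blockBound p T ψ (N k) := by
      refine le_of_tendsto ((continuous_enorm.tendsto _).comp (hc k t ht))
        (Filter.Eventually.of_forall fun i => ?_)
      have h2 := edist_dyadicFloor_zero_le hT (hV k) ht i
      rw [edist_eq_enorm_sub, ENNReal.tsum_mul_left] at h2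
      have h3 : ‖F k 0‖ₑ ≤ κ * gridBound p (N k) (block (N k) (ψ 0)) :=
        (enorm_coeff_le (hmem k) _).trans
          (mul_le_mul_right (supNorm_le_gridBound hp (isTrigPoly_block _ _)) _)
      calc ‖F k (dyadicFloor T i t)‖ₑ = ‖F k 0 + (F k (dyadicFloor T i t) - F k 0)‖ₑ := by
            rw [add_sub_cancel]
        _ ≤ _ := enorm_add_le _ _
        _ ≤ _ := add_le_add h3 h2
        _ = _ := by rw [blockBound, mul_add]
    have h2 : ‖c k t‖ₑ ≤ ENNReal.ofReal (K * (1 + |(k : ℝ)|) ^ L) := by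
      refine h1.trans ((mul_le_mul_right (hbb (N k)) κ).trans ?_)
      rw [← ENNReal.ofReal_toReal hψ, hκ, ← ENNReal.ofReal_mul (by positivity),
        ← ENNReal.ofReal_mul (Real.sqrt_nonneg _), hK]
      refine ENNReal.ofReal_le_ofReal ?_
      rw [mul_assoc]
      refine mul_le_mul_of_nonneg_left ?_ (Real.sqrt_nonneg _)
      calc _ ≤ (2 ^ L * (1 + |(k : ℝ)|) ^ L) * (pathBound p T γ ψ).toReal :=
            mul_le_mul_of_nonneg_right (two_rpow_size_le γ k) ENNReal.toReal_nonneg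
        _ = _ := by ring
    rw [← ofReal_norm] at h2
    exact (ENNReal.ofReal_le_ofReal_iff (by positivity)).1 h2
  refine ⟨fun t => if ht : t ∈ Set.Icc (0 : ℝ) T then
    ofCoeff (fun k => c k t) ⟨K, L, hgrowth t ht⟩ else ψ t, fun φ => ?_, fun t ht hlim => ?_⟩
  · have hcont : ContinuousOn (fun t => ∑' k : ℤ, circleFourier φ k *
        (((Real.sqrt (2 * Real.pi) : ℝ) : ℂ) * c (-k) t)) (Set.Icc (0 : ℝ) T) := by
      refine continuousOn_tsum (fun k => ?_)
        ((CircleTest.summable_one_add_abs_pow_mul_norm_circleFourier φ L).mul_left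
          (Real.sqrt (2 * Real.pi) * K)) fun k t ht => norm_circleFourier_mul_le (hgrowth t ht) φ k
      exact continuousOn_const.mul (continuousOn_const.mul
        (continuousOn_of_tendsto_dyadicFloor hT (hV (-k)) (hVs (-k)) fun t ht => hc (-k) t ht))
    refine hcont.congr fun t ht => ?_
    simp only [dif_pos ht]
    rfl
  · simp only [dif_pos ht]
    refine ext_of_coeff fun k => ?_
    rw [coeff_ofCoeff]
    refine tendsto_nhds_unique (hc k t ht) ?_
    rw [tendsto_iff_edist_tendsto_0]
    have h0 : Filter.Tendsto (fun i => κ * gridBound p (N k) fun x =>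
        block (N k) (ψ (dyadicFloor T i t)) x - block (N k) (ψ t) x) Filter.atTop (nhds 0) := by
      have := ENNReal.Tendsto.const_mul (a := κ) (hlim (N k)) (Or.inr ENNReal.ofReal_ne_top)
      rwa [mul_zero] at this
    refine tendsto_of_tendsto_of_tendsto_of_le_of_le tendsto_const_nhds h0 (fun _ => zero_le)
      fun i => ?_
    exact (edist_coeff_le (hmem k) _ _).trans (mul_le_mul_right
      (supNorm_le_gridBound hp ((isTrigPoly_block _ _).sub (isTrigPoly_block _ _))) _)

namespace HasBlockBounds
variable {Ω : Type*} [MeasurableSpace Ω] {P : Measure Ω} {T : ℝ} {H : Submodule ℝ (Lp ℝ 2 P)}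
  {α δ A B : ℝ} {ψ : ℝ → Ω → CircleDistribution} [IsProbabilityMeasure P] {q : ℕ} {D : ℝ}

/-- At a fixed time, the process is almost surely the limit of its values at dyadic times. -/
lemma ae_tendsto_gridBound (hT : 0 < T) (hδ : 0 < δ) (hq : 1 ≤ q) (hD : MomentBound H q D)
    (hD0 : 0 ≤ D) (hB : 0 ≤ B) (h : HasBlockBounds T H α δ A B ψ) {t : ℝ}
    (ht : t ∈ Set.Icc (0 : ℝ) T) :
    ∀ᵐ ω ∂P, ∀ n, Filter.Tendsto (fun k => gridBound (2 * q) n fun x =>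
      block n (ψ (dyadicFloor T k t) ω) x - block n (ψ t ω) x) Filter.atTop (nhds 0) := by
  rw [ae_all_iff]
  intro n
  have hm : ∀ k, AEMeasurable (fun ω => gridBound (2 * q) n fun x =>
      block n (ψ (dyadicFloor T k t) ω) x - block n (ψ t ω) x) P := fun k =>
    h.aemeasurable_gridBound_sub (dyadicFloor_mem hT ht k) ht _ n
  set b := 64 * D * Real.sqrt B * ((2 : ℝ) ^ (1 / ((2 * q : ℕ) : ℝ) - α)) ^ n with hb
  have hb0 : 0 ≤ b := by positivity
  have hr1 : (2 : ℝ) ^ (-(δ / 2)) < 1 :=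
    Real.rpow_lt_one_of_one_lt_of_neg (by norm_num) (by linarith)
  have hsum : ∫⁻ ω, ∑' k, gridBound (2 * q) n (fun x =>
      block n (ψ (dyadicFloor T k t) ω) x - block n (ψ t ω) x) ∂P ≠ ⊤ := by
    rw [lintegral_tsum hm]
    refine ne_top_of_le_ne_top (b := ∑' k : ℕ, ENNReal.ofReal
      (b * T ^ (δ / 2) * ((2 : ℝ) ^ (-(δ / 2))) ^ k)) ?_ (ENNReal.tsum_le_tsum fun k => ?_)
    · rw [tsum_ofReal_mul_geometric (by positivity) (by positivity) hr1]
      exact ENNReal.ofReal_ne_top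
    · refine (h.lintegral_gridBound_sub_le hq hD hB (dyadicFloor_mem hT ht k) ht n).trans
        (ENNReal.ofReal_le_ofReal ?_)
      have h2 : (0 : ℝ) < 2 ^ k := by positivity
      have e : (T / 2 ^ k) ^ (δ / 2) = T ^ (δ / 2) * ((2 : ℝ) ^ (-(δ / 2))) ^ k := by
        rw [Real.div_rpow hT.le h2.le, ← Real.rpow_natCast, ← Real.rpow_natCast,
          ← Real.rpow_mul (by norm_num), ← Real.rpow_mul (by norm_num), div_eq_mul_inv,
          ← Real.rpow_neg (by norm_num)]
        congr 2; ring
      rw [mul_assoc b, ← e]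
      refine mul_le_mul_of_nonneg_left ?_ hb0
      exact Real.rpow_le_rpow (abs_nonneg _) (abs_dyadicFloor_sub_le hT ht k) (by linarith)
  filter_upwards [ae_lt_top' (AEMeasurable.tsum hm) hsum] with ω hω
  exact ENNReal.tendsto_atTop_zero_of_tsum_ne_top hω.ne

/-- The modification is the weakly continuous regularization of each path with finite `pathBound`. -/
lemma exists_modification (hT : 0 < T) (hδ : 0 < δ) (hq : 1 ≤ q) (hD : MomentBound H q D)
    (hD0 : 0 ≤ D) (hB : 0 ≤ B) (h : HasBlockBounds T H α δ A B ψ) {γ : ℝ}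
    (hfin : ∀ᵐ ω ∂P, pathBound (2 * q) T γ (fun t => ψ t ω) ≠ ⊤) :
    ∃ ψ' : ℝ → Ω → CircleDistribution, IsModificationOn P T ψ' ψ ∧ HasContinuousPathsOn P T ψ' := by
  have hp : 2 * q ≠ 0 := by omega
  have hex : ∀ ω, ∃ ψ' : ℝ → CircleDistribution,
      pathBound (2 * q) T γ (fun t => ψ t ω) ≠ ⊤ →
      (∀ φ : CircleTest, ContinuousOn (fun t => (ψ' t).toLin φ) (Set.Icc (0 : ℝ) T)) ∧
      ∀ t ∈ Set.Icc (0 : ℝ) T, (∀ n, Filter.Tendsto (fun k => gridBound (2 * q) n fun x =>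
        block n (ψ (dyadicFloor T k t) ω) x - block n (ψ t ω) x) Filter.atTop (nhds 0)) →
        ψ' t = ψ t ω := by
    intro ω
    by_cases hω : pathBound (2 * q) T γ (fun t => ψ t ω) ≠ ⊤
    · obtain ⟨ψ', h1⟩ := exists_continuous_path hT hp hω
      exact ⟨ψ', fun _ => h1⟩
    · exact ⟨fun t => ψ t ω, fun h => absurd h hω⟩
  choose ψ' hψ' using hex
  refine ⟨fun t ω => ψ' ω t, fun t ht => ?_, ?_⟩
  · filter_upwards [hfin, h.ae_tendsto_gridBound hT hδ hq hD hD0 hB ht] with ω h1 h2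
    exact (hψ' ω h1).2 t ht h2
  · filter_upwards [hfin] with ω h1
    exact (hψ' ω h1).1

end HasBlockBounds

/-! ### The norm of the process -/

theorem lemmaA3 (T : ℝ) (hT : 0 < T) (m : ℕ) (δ : ℝ) (hδ : 0 < δ)
    (α : ℝ) (hα1 : α < 1) (hα0 : α ≠ 0) (γ : ℝ) (hγα : γ < α) (hγ0 : γ ≠ 0) :
    ∃ C : ℝ, 0 < C ∧
      ∀ {Ω : Type*} [MeasurableSpace Ω] (P : Measure Ω) [IsProbabilityMeasure P]
        (G : Submodule ℝ (Lp ℝ 2 P)) (ψ : ℝ → Ω → CircleDistribution) (A B : ℝ),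
        IsGaussianSpace G → 0 < A → 0 < B →
        (∀ t ∈ Set.Icc (0 : ℝ) T, TakesValuesIn (wienerChaosLE G m) (ψ t)) →
        (∀ (n : ℕ) (x : ℝ), ∀ t ∈ Set.Icc (0 : ℝ) T,
          ∫ ω, ‖CircleDistribution.block n (ψ t ω) x‖ ^ 2 ∂P
            ≤ A * (2 : ℝ) ^ (-2 * (n : ℝ) * α)) →
        (∀ (n : ℕ) (x : ℝ), ∀ t ∈ Set.Icc (0 : ℝ) T, ∀ s ∈ Set.Icc (0 : ℝ) T,
          ∫ ω, ‖CircleDistribution.block n (ψ t ω) x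
              - CircleDistribution.block n (ψ s ω) x‖ ^ 2 ∂P
            ≤ B * (2 : ℝ) ^ (-2 * (n : ℝ) * α) * |t - s| ^ δ) →
        (∃ ψ' : ℝ → Ω → CircleDistribution,
          IsModificationOn P T ψ' ψ ∧ HasContinuousPathsOn P T ψ') ∧
        (∀ ψ' : ℝ → Ω → CircleDistribution,
          IsModificationOn P T ψ' ψ → HasContinuousPathsOn P T ψ' →
          AEMeasurable (fun ω => ⨆ t ∈ Set.Icc (0 : ℝ) T,
            CircleDistribution.cNorm γ (ψ' t ω)) P ∧
          ∫⁻ ω, (⨆ t ∈ Set.Icc (0 : ℝ) T, CircleDistribution.cNorm γ (ψ' t ω)) ∂P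
            ≤ ENNReal.ofReal (C * (A + B) ^ (1 / 2 : ℝ))) := by
  -- a moment of order `2q` so high that the losses `2^{n/2q}` in space and `2^{i/2q}` in time
  -- are absorbed by the gaps `α - γ` and `δ / 2`
  obtain ⟨q, hq2, hqγ, hqδ⟩ : ∃ q : ℕ, 2 ≤ q ∧ 1 / ((2 * q : ℕ) : ℝ) < α - γ ∧
      1 / ((2 * q : ℕ) : ℝ) < δ / 2 := by
    obtain ⟨r, hr⟩ := exists_nat_one_div_lt (lt_min (sub_pos.2 hγα) (half_pos hδ))
    have hle : 1 / ((2 * (r + 2) : ℕ) : ℝ) ≤ 1 / ((r : ℝ) + 1) := by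
      refine one_div_le_one_div_of_le (by positivity) ?_
      push_cast
      have : (0 : ℝ) ≤ r := by positivity
      linarith
    exact ⟨r + 2, by omega, hle.trans_lt (hr.trans_le (min_le_left _ _)),
      hle.trans_lt (hr.trans_le (min_le_right _ _))⟩
  have hq1 : 1 ≤ q := by omega
  have hp : 2 * q ≠ 0 := by omega
  obtain ⟨D, hD1, hD⟩ := exists_momentBound m q hq2
  have hD0 : 0 ≤ D := by linarith
  set C₀ := 64 * D * (1 + T ^ (δ / 2) * (1 - (2 : ℝ) ^ (1 / ((2 * q : ℕ) : ℝ) - δ / 2))⁻¹) *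
        (1 - (2 : ℝ) ^ (γ + (1 / ((2 * q : ℕ) : ℝ) - α)))⁻¹ with hC₀
  have hC₀pos : 0 < C₀ := by
    have h1 : (2 : ℝ) ^ (1 / ((2 * q : ℕ) : ℝ) - δ / 2) < 1 :=
      Real.rpow_lt_one_of_one_lt_of_neg (by norm_num) (by linarith)
    have h2 : (2 : ℝ) ^ (γ + (1 / ((2 * q : ℕ) : ℝ) - α)) < 1 :=
      Real.rpow_lt_one_of_one_lt_of_neg (by norm_num) (by linarith)
    have h3 : 0 < (1 - (2 : ℝ) ^ (1 / ((2 * q : ℕ) : ℝ) - δ / 2))⁻¹ := inv_pos.2 (by linarith)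
    have h4 : 0 < (1 - (2 : ℝ) ^ (γ + (1 / ((2 * q : ℕ) : ℝ) - α)))⁻¹ := inv_pos.2 (by linarith)
    positivity
  refine ⟨3 * C₀, by positivity, ?_⟩
  intro Ω _ P _ G ψ A B hG hA hB hval hsq hsub
  have hψ : HasBlockBounds T (wienerChaosLE G m) α δ A B ψ := ⟨hval, hsq, hsub⟩
  have hDG := hD P G hG
  have hint : ∀ ψ' : ℝ → Ω → CircleDistribution, HasBlockBounds T (wienerChaosLE G m) α δ A B ψ' →
      ∫⁻ ω, pathBound (2 * q) T γ (fun t => ψ' t ω) ∂P ≤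
        ENNReal.ofReal (C₀ * Real.sqrt (A + B)) := fun ψ' h =>
    h.lintegral_pathBound_le hT hq1 hDG hD0 hA.le hB.le hqγ hqδ
  have hfin : ∀ ψ' : ℝ → Ω → CircleDistribution, HasBlockBounds T (wienerChaosLE G m) α δ A B ψ' →
      ∀ᵐ ω ∂P, pathBound (2 * q) T γ (fun t => ψ' t ω) ≠ ⊤ := fun ψ' h => by
    filter_upwards [ae_lt_top' (h.aemeasurable_pathBound hT _ γ)
      (ne_top_of_le_ne_top ENNReal.ofReal_ne_top (hint ψ' h))] with ω hω
    exact hω.ne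
  refine ⟨hψ.exists_modification hT hδ hq1 hDG hD0 hB.le (hfin ψ hψ), fun ψ' hmod hcont => ?_⟩
  have hψ' := hψ.congr hmod
  refine ⟨hψ'.aemeasurable_iSup_cNorm hT hp hγ0 (hfin ψ' hψ') hcont, ?_⟩
  calc _ ≤ ∫⁻ ω, 3 * pathBound (2 * q) T γ (fun t => ψ' t ω) ∂P := by
        refine lintegral_mono_ae ?_
        filter_upwards [hcont] with ω hω
        exact iSup_cNorm_le_pathBound hT hp hγ0 (hγα.trans hα1) hω
    _ ≤ 3 * ENNReal.ofReal (C₀ * Real.sqrt (A + B)) := by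
        rw [lintegral_const_mul' _ _ (by simp)]
        exact mul_le_mul_right (hint ψ' hψ') _
    _ = _ := by
        rw [← ENNReal.ofReal_ofNat, ← ENNReal.ofReal_mul (by norm_num), Real.sqrt_eq_rpow,
          ← mul_assoc]

end
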